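/- **Setting.** Let $\{X_t : t\in\mathbb Z\}$ be a real-valued strictly stationary Markov chain whose distribution is determined by the recursion $X_t=\Psi(X_{t-1},\varepsilon_t)$, $t\ge 1$, where $\varepsilon_1,\varepsilon_2,\dots$ are independent and identically distributed random elements of a measurable space $\mathbb S$, independent of $X_0$, where $\Psi:\mathbb R\times\mathbb S\to\mathbb R$ is measurable, and where $\Psi(X_0,\varepsilon_1)$ and $X_0$ have the same law. Write $(u)_+^\alpha=\max(u,0)^\alpha$ and $\vee$, $\wedge$ for maximum and minimum. Assume the following. 1. There are $0<\alpha<\infty$ and $0\le p\le 1$ such that, as $x\to\infty$, $\Pr(|X_0|>xy)/\Pr(|X_0|>x)\to y^{-\alpha}$ for all $0<y<\infty$, and $\Pr(X_0>x)/\Pr(|X_0|>x)\to p$. Put $p(1)=p$ and $p(-1)=1-p$. 2. There is a measurable $\mathbb V\subset\mathbb S$ with $\Pr(\varepsilon_1\in\mathbb V)=1$ such that for every $\sigma\in\{-1,1\}$ with $p(\sigma)>0$ and every $v\in\mathbb V$ the limit $\phi(v,\sigma)=\lim_{x\to\sigma\infty}x^{-1}\Psi(x,v)$ exists in $\mathbb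 R$. Moreover, if $\Pr[\phi(\varepsilon_1,\sigma)=0]>0$ for some $\sigma\in\{-1,1\}$ with $p(\sigma)>0$, then there is a measurable $\mathbb W\subset\mathbb V$ with $\Pr(\varepsilon_1\in\mathbb W)=1$ such that $\sup_{|y|\le x}|\Psi(y,v)|=O(x)$ as $x\to\infty$ for every $v\in\mathbb W$. **Tail chains.** Let $\mathcal M_{p,\alpha}$ be the set of laws of random pairs $(I,M)$ with $\Pr(I=1)=p=1-\Pr(I=-1)$ and $\mathrm E[(\sigma M)_+^\alpha]\le\Pr(I=\sigma)$ for $\sigma=\pm1$. The laws $\mu,\mu^*\in\mathcal M_{p,\alpha}$ of $(I,M)$ and $(I^*,M^*)$ are adjoint if $\mathrm E[(xI)_+^\alpha\wedge(yM)_+^\alpha]=\mathrm E[(xM^*)_+^\alpha\wedge(yI^*)_+^\alpha]$ for all $x,y\in\mathbb R$. A process $\{M_t:t\in\mathbb Z\}$ is a back-and-forth tail chain with index $\alpha$ and forward transition law $\mu\in\mathcal M_{p,\alpha}$ if $\mathcal L(M_0,M_1)=\mu$; if $\mathcal L(M_0,M_{-1})$ is adjoint to $\mu$; and if for every $t\ge1$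 the conditional law of $M_t$ given $M_{t-1}=x_{t-1},M_{t-2}=x_{t-2},\dots$ is almost surely $\mathcal L(x_{t-1}M_1/M_0\mid M_0=\operatorname{sign}x_{t-1})$ when $x_{t-1}\ne0$ and the point mass at $0$ when $x_{t-1}=0$, and the conditional law of $M_{-t}$ given $M_{-t+1}=x_{-t+1},M_{-t+2}=x_{-t+2},\dots$ is almost surely $\mathcal L(x_{-t+1}M_{-1}/M_0\mid M_0=\operatorname{sign}x_{-t+1})$ when $x_{-t+1}\ne0$ and the point mass at $0$ when $x_{-t+1}=0$. Let $\mu$ be the law of $(M_0,M_0\,\phi(\varepsilon_1,M_0))$, where $M_0$ is independent of $\varepsilon_1$ and $\Pr(M_0=\sigma)=p(\sigma)$ for $\sigma=\pm1$. **Claim.** A back-and-forth tail chain with index $\alpha$ and forward transition law $\mu$ exists (in particular $\mu\in\mathcal M_{p,\alpha}$). For every integer $t\ge0$ and all $x_0,\dots,x_t\in\mathbb R$, the limit $$l_t(x_0,\dots,x_t)=\lim_{x\to\infty}\frac{\Pr(x_0X_0>x\text{ or }\dots\text{ or }x_tX_t>x)}{\Pr(|X_0|>x)}$$ exists in $\mathbb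 R$, and for every such tail chain $\{M_t\}$ it is equal to $$\mathrm E\bigl[(x_0M_0)_+^\alpha\vee\dots\vee(x_tM_t)_+^\alpha\bigr]+\sum_{i=1}^t\mathrm E\bigl[\{(x_iM_0)_+^\alpha\vee\dots\vee(x_tM_{t-i})_+^\alpha\}\mathbf 1(M_{-1}=0)\bigr]$$ and also to $$\mathrm E\bigl[(x_0M_{-t})_+^\alpha\vee\dots\vee(x_tM_0)_+^\alpha\bigr]+\sum_{i=0}^{t-1}\mathrm E\bigl[\{(x_0M_{-i})_+^\alpha\vee\dots\vee(x_iM_0)_+^\alpha\}\mathbf 1(M_1=0)\bigr],$$ all these expectations being finite. -/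

import Mathlib

open MeasureTheory ProbabilityTheory Filter Topology
open scoped ENNReal

noncomputable section

namespace TailChain

/-- The process `Z 0, Z 1, …` is generated by the recursion `Z_t = Ψ(Z_{t-1}, ε_t)`, `t ≥ 1`, from an
initial variable `Z 0` and independent and identically distributed innovations, jointly independent of
`Z 0`. The innovations `ε_1, ε_2, …` are `ε 0, ε 1, …`. -/
structure IsRecursiveChain {Ω S : Type*} [MeasurableSpace Ω] [MeasurableSpace S]
    (P : Measure Ω) (Ψ : ℝ → S → ℝ) (Z : ℕ → Ω → ℝ) (ε : ℕ → Ω → S) : Prop where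
  measurable_map : Measurable (Function.uncurry Ψ)
  measurable_init : Measurable (Z 0)
  measurable_innov : ∀ t, Measurable (ε t)
  indep_innov : iIndepFun ε P
  ident_innov : ∀ t, IdentDistrib (ε t) (ε 0) P P
  indep_init : IndepFun (Z 0) (fun ω t => ε t ω) P
  recursion : ∀ t ω, Z (t + 1) ω = Ψ (Z t ω) (ε t ω)

/-- The two-sided process `X` (on the probability space `(Ω, P)`) is a stationary Markov chain whose
distribution is determined by the recursion `Z_t = Ψ(Z_{t-1}, ε_t)` (realised on `(Ω', P')`), where the
law of `Z_0` is invariant: all finite stretches `(X_m, …, X_{m+n})` are distributed as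
`(Z_0, …, Z_n)`. If `X` itself satisfies the recursion for `t ≥ 1`, one may take `Z_t = X_t`. -/
structure IsStationaryChain {Ω Ω' S : Type*} [MeasurableSpace Ω] [MeasurableSpace Ω']
    [MeasurableSpace S] (P : Measure Ω) (X : ℤ → Ω → ℝ)
    (P' : Measure Ω') (Ψ : ℝ → S → ℝ) (Z : ℕ → Ω' → ℝ) (ε : ℕ → Ω' → S) : Prop where
  chain : IsRecursiveChain P' Ψ Z ε
  invariant : P'.map (fun ω => Ψ (Z 0 ω) (ε 0 ω)) = P'.map (Z 0)
  measurable : ∀ t, Measurable (X t)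
  law : ∀ (m : ℤ) (n : ℕ),
    P.map (fun ω (j : Fin (n + 1)) => X (m + (j : ℕ)) ω) =
      P'.map (fun ω (j : Fin (n + 1)) => Z j ω)

/-- Regular variation of the tail of `|ξ|` with index `α`, and tail balance `p`. -/
structure IsRegVar {Ω : Type*} [MeasurableSpace Ω] (P : Measure Ω) (ξ : Ω → ℝ) (α p : ℝ) :
    Prop where
  index_pos : 0 < α
  balance_nonneg : 0 ≤ p
  balance_le_one : p ≤ 1
  tail : ∀ y : ℝ, 0 < y →
    Tendsto (fun x : ℝ => P.real {ω | x * y < |ξ ω|} / P.real {ω | x < |ξ ω|}) atTop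
      (𝓝 (y ^ (-α)))
  balance :
    Tendsto (fun x : ℝ => P.real {ω | x < ξ ω} / P.real {ω | x < |ξ ω|}) atTop (𝓝 p)

/-- `p(1) = p` and `p(-1) = 1 - p`. -/
def signProb (p σ : ℝ) : ℝ := if σ = 1 then p else 1 - p

/-- The asymptotic condition on `Ψ(x, ·)` for large `|x|`, with `ν` the law of an innovation. For
`σ ∈ {-1, 1}` the limit as `x → σ∞` is written as a limit along `σ * x`, `x → ∞`. The number
`φ(v, σ)` is meaningful only if `p(σ) > 0`, so only such `σ` are considered in the second part. -/
def IsAsympLinear {S : Type*} [MeasurableSpace S] (ν : Measure S) (Ψ : ℝ → S → ℝ) (p : ℝ)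
    (φ : S → ℝ → ℝ) : Prop :=
  ∃ V : Set S, MeasurableSet V ∧ ν V = 1 ∧
    (∀ σ : ℝ, (σ = 1 ∨ σ = -1) → 0 < signProb p σ → ∀ v ∈ V,
      Tendsto (fun x : ℝ => (σ * x)⁻¹ * Ψ (σ * x) v) atTop (𝓝 (φ v σ))) ∧
    ((∃ σ : ℝ, (σ = 1 ∨ σ = -1) ∧ 0 < signProb p σ ∧ 0 < ν {v | φ v σ = 0}) →
      ∃ W : Set S, MeasurableSet W ∧ W ⊆ V ∧ ν W = 1 ∧
        ∀ v ∈ W, ∃ C : ℝ, ∀ᶠ x : ℝ in atTop, ∀ y : ℝ, |y| ≤ x → |Ψ y v| ≤ C * x)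

/-- The law of `(M_0, M_1)`, where `M_1 = M_0 φ(ε_1, M_0)`, the variable `M_0` equals `1` with
probability `p` and `-1` with probability `1 - p`, and `ε_1` has law `ν` and is independent
of `M_0`. -/
def forwardLaw {S : Type*} [MeasurableSpace S] (ν : Measure S) (p : ℝ) (φ : S → ℝ → ℝ) :
    Measure (ℝ × ℝ) :=
  ((ENNReal.ofReal p • Measure.dirac (1 : ℝ) +
      ENNReal.ofReal (1 - p) • Measure.dirac (-1 : ℝ)).prod ν).map
    (fun z => (z.1, z.1 * φ z.2 z.1))

/-- `(u)_+ ^ α` as an extended nonnegative real. -/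
def posPow (α u : ℝ) : ℝ≥0∞ := ENNReal.ofReal ((max u 0) ^ α)

/-- The class of laws of pairs `(I, M)` with `Pr(I = 1) = p = 1 - Pr(I = -1)` and
`E[(σ M)_+ ^ α] ≤ Pr(I = σ)` for `σ = 1, -1`. -/
structure MemClass (p α : ℝ) (μ : Measure (ℝ × ℝ)) : Prop where
  isProb : IsProbabilityMeasure μ
  prob_one : μ {z | z.1 = 1} = ENNReal.ofReal p
  prob_neg_one : μ {z | z.1 = -1} = ENNReal.ofReal (1 - p)
  moment : ∀ σ : ℝ, (σ = 1 ∨ σ = -1) → ∫⁻ z, posPow α (σ * z.2) ∂μ ≤ μ {z | z.1 = σ}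

/-- The adjoint relation in the class `MemClass p α`. -/
structure IsAdjoint (p α : ℝ) (μ μ' : Measure (ℝ × ℝ)) : Prop where
  mem_left : MemClass p α μ
  mem_right : MemClass p α μ'
  identity : ∀ x y : ℝ,
    ∫⁻ z, min (posPow α (x * z.1)) (posPow α (y * z.2)) ∂μ =
      ∫⁻ z, min (posPow α (x * z.2)) (posPow α (y * z.1)) ∂μ'

/-- One step of a tail chain from the state `x`: the point mass at `0` if `x = 0`, and otherwise the
law of `x M / I` given `I = sign x`, where `(I, M)` has law `μ`. -/
def tailStep (μ : Measure (ℝ × ℝ)) (x : ℝ) : Measure ℝ :=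
  open Classical in
  if x = 0 then Measure.dirac 0
  else (μ[|{z : ℝ × ℝ | z.1 = Real.sign x}]).map (fun z => x * z.2 / z.1)

/-- The process `M` is a back-and-forth tail chain with index `α` and forward transition law `μ` (in
the class `MemClass p α`). The conditional laws are regular conditional distributions of `M_t` given
the whole past, and of `M_{-t}` given the whole future. -/
structure IsBFTC {Ω : Type*} [MeasurableSpace Ω] (Q : Measure Ω) [IsProbabilityMeasure Q]
    (p α : ℝ) (μ : Measure (ℝ × ℝ)) (M : ℤ → Ω → ℝ) : Prop where
  measurable : ∀ t, Measurable (M t)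
  law_forward : Q.map (fun ω => (M 0 ω, M 1 ω)) = μ
  law_backward : IsAdjoint p α μ (Q.map (fun ω => (M 0 ω, M (-1) ω)))
  step_forward : ∀ t : ℤ, 1 ≤ t →
    ∀ᵐ h ∂(Q.map (fun ω (s : {s : ℤ // s < t}) => M s ω)),
      condDistrib (M t) (fun ω (s : {s : ℤ // s < t}) => M s ω) Q h =
        tailStep μ (h ⟨t - 1, by omega⟩)
  step_backward : ∀ t : ℤ, 1 ≤ t →
    ∀ᵐ h ∂(Q.map (fun ω (s : {s : ℤ // -t < s}) => M s ω)),
      condDistrib (M (-t)) (fun ω (s : {s : ℤ // -t < s}) => M s ω) Q h =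
        tailStep (Q.map (fun ω => (M 0 ω, M (-1) ω))) (h ⟨-t + 1, by omega⟩)

end TailChain

end

open TailChain

open TailChain

noncomputable section

namespace TailChain

/-! Attach to a tail chain an independent radius R = s^(-1/α), with s distributed by Lebesgue
measure on the positive half-line. Then 1 < R u exactly when s < (u)_+^α, so an expectation of α-th
powers becomes the mass of paths of R M that cross level 1. In this picture the adjoint relation
says that the scaled pairs (R M_0, R M_1) and (R M_{-1}, R M_0) have the same infinite law off the
coordinate axes. This is detailed balance for functions vanishing at 0
(`IsAdjoint.detailed_balance`), and iteration reverses whole path segments whose two endpoint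
functions vanish at 0 (`IsAdjoint.reversal`).

The limit is found by splitting the union of exceedances by the last time i at which one occurs.
Stationarity moves that time to 0. With the innovations frozen, Z_k / Z_0 converges to a product of
slopes when Z_0 is far out on one side; regular variation of Z_0 and dominated convergence then give
the limit of each piece (`IsRecursiveChain.tendsto_event`). That limit is `lastExc`, the mass of
scaled paths exceeding at time 0 and not at the next t - i times. By `IsTwoSided.lastExc_eq` it
depends only on the forward law, so it is the same for every tail chain.

It remains to rewrite the sum of last-exceedance masses. Since max(a, b) = (a - b)_+ + b, the
expected maximum over times 0, ..., n is one such mass plus the expected maximum over times 1, ...,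
n. By detailed balance the latter is the expected maximum over 0, ..., n - 1 restricted to M_{-1} ≠
0 (`IsTwoSided.lintegral_supPow_one`). Collecting the missing parts on M_{-1} = 0 along an induction
gives the first formula. The second is the first one for the time-reversed chain, because summing
over last or over first exceedances gives the same total (`IsTwoSided.sum_lastExc_eq`).

Existence needs the moment bound of the class, which is the limit of an inequality for the
stationary chain between times 0 and 1 (`IsRecursiveChain.lintegral_min_le`). The adjoint law is
then explicit, and a chain is built from a random sign, the innovations going forward, and
independent noise going backward. -/

section

/-! ### Radial decomposition -/

/-- The radius with tail `Leb {s > 0 | t < s ^ (-1/α)} = t ^ (-α)`. -/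
def radius (α s : ℝ) : ℝ := s ^ (-α⁻¹)

lemma radius_pos (α : ℝ) {s : ℝ} (hs : 0 < s) : 0 < radius α s := Real.rpow_pos_of_pos hs _

@[fun_prop]
lemma measurable_radius (α : ℝ) : Measurable (radius α) := by
  unfold radius; fun_prop

@[fun_prop]
lemma measurable_posPow (α : ℝ) : Measurable (posPow α) := by
  unfold posPow; fun_prop

lemma posPow_ne_top (α u : ℝ) : posPow α u ≠ ∞ := ENNReal.ofReal_ne_top

/-- The bridge between exceedances of level 1 and α-th powers: integrating the indicator over s
returns (u)_+^α. -/
lemma one_lt_radius_mul_iff {α s : ℝ} (hα : 0 < α) (hs : 0 < s) (u : ℝ) :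
    1 < radius α s * u ↔ ENNReal.ofReal s < posPow α u := by
  unfold radius posPow
  rw [ENNReal.ofReal_lt_ofReal_iff_of_nonneg hs.le, Real.rpow_neg hs.le, inv_mul_eq_div,
    one_lt_div (Real.rpow_pos_of_pos hs _)]
  have h0 : 0 < s ^ α⁻¹ := Real.rpow_pos_of_pos hs _
  rw [← Real.rpow_inv_lt_iff_of_pos hs.le (le_max_right _ _) hα, lt_max_iff]
  constructor
  · exact Or.inl
  · rintro (h | h)
    · exact h
    · exact absurd h h0.le.not_gt

/-- Indicator of `1 < c * m`. -/
def above (c m : ℝ) : ℝ≥0∞ := {m : ℝ | 1 < c * m}.indicator 1 m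

/-- Indicator of `c * m ≤ 1`. -/
def below (c m : ℝ) : ℝ≥0∞ := {m : ℝ | c * m ≤ 1}.indicator 1 m

lemma above_of_lt {c m : ℝ} (h : 1 < c * m) : above c m = 1 := by simp [above, h]
lemma above_of_le {c m : ℝ} (h : c * m ≤ 1) : above c m = 0 := by simp [above, h]
lemma below_of_lt {c m : ℝ} (h : 1 < c * m) : below c m = 0 := by simp [below, h]
lemma below_of_le {c m : ℝ} (h : c * m ≤ 1) : below c m = 1 := by simp [below, h]

lemma below_add_above (c m : ℝ) : below c m + above c m = 1 := by
  rcases lt_or_ge 1 (c * m) with h | h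
  · simp [above_of_lt h, below_of_lt h]
  · simp [above_of_le h, below_of_le h]

@[fun_prop]
lemma measurable_above (c : ℝ) : Measurable (above c) :=
  measurable_one.indicator (measurableSet_lt measurable_const (by fun_prop))

@[fun_prop]
lemma measurable_below (c : ℝ) : Measurable (below c) :=
  measurable_one.indicator (measurableSet_le (by fun_prop) measurable_const)

lemma above_zero (c : ℝ) : above c 0 = 0 := above_of_le (by simp)

/-- The length of [b, a) is the truncated difference. With b = 0 it recovers a single power or
supremum; with b a supremum it gives the last-exceedance masses. -/
lemma volume_ofReal_lt (a b : ℝ≥0∞) (ha : a ≠ ∞) :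
    ∫⁻ s in Set.Ioi (0 : ℝ), {s : ℝ | ENNReal.ofReal s < a ∧ b ≤ ENNReal.ofReal s}.indicator 1 s
      = a - b := by
  have hm : MeasurableSet {s : ℝ | ENNReal.ofReal s < a ∧ b ≤ ENNReal.ofReal s} := by
    measurability
  rw [lintegral_indicator_one hm, Measure.restrict_apply hm]
  rcases le_total a b with hab | hab
  · rw [tsub_eq_zero_of_le hab]
    convert measure_empty (μ := (volume : Measure ℝ))
    ext s
    simp only [Set.mem_inter_iff, Set.mem_ofPred_eq, Set.mem_empty_iff_false, iff_false]
    rintro ⟨⟨h1, h2⟩, -⟩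
    exact absurd (h1.trans_le (hab.trans h2)) (lt_irrefl _)
  lift a to NNReal using ha
  lift b to NNReal using ne_top_of_le_ne_top ENNReal.coe_ne_top hab
  have : ({s : ℝ | ENNReal.ofReal s < a ∧ b ≤ ENNReal.ofReal s} ∩ Set.Ioi 0 : Set ℝ)
      =ᵐ[volume] (Set.Ico (b : ℝ) a : Set ℝ) := by
    refine eventuallyEq_set.2 ?_
    -- The two sets can differ only at 0, which the interval may contain (b = 0) but the open
    -- half-line does not.
    have h0 : ∀ᵐ s : ℝ, s ≠ 0 := by simp [ae_iff]
    filter_upwards [h0] with s hs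
    simp only [Set.mem_inter_iff, Set.mem_ofPred_eq, Set.mem_Ioi, Set.mem_Ico]
    constructor
    · rintro ⟨⟨h1, h2⟩, h3⟩
      rw [← ENNReal.ofReal_coe_nnreal, ENNReal.ofReal_lt_ofReal_iff_of_nonneg h3.le] at h1
      rw [← ENNReal.ofReal_coe_nnreal, ENNReal.ofReal_le_ofReal_iff h3.le] at h2
      exact ⟨h2, h1⟩
    · rintro ⟨h1, h2⟩
      have h3 : 0 < s := lt_of_le_of_ne (b.2.trans h1) hs.symm
      refine ⟨⟨?_, ?_⟩, h3⟩
      · rwa [← ENNReal.ofReal_coe_nnreal, ENNReal.ofReal_lt_ofReal_iff_of_nonneg h3.le]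
      · rwa [← ENNReal.ofReal_coe_nnreal, ENNReal.ofReal_le_ofReal_iff h3.le]
  rw [measure_congr this, Real.volume_Ico, ENNReal.ofReal_sub _ (NNReal.coe_nonneg b)]
  simp

/-- The law of `(r z₁, r z₂)` with `z` of law `μ` and `r` an independent radius. -/
def radial (α : ℝ) (μ : Measure (ℝ × ℝ)) : Measure (ℝ × ℝ) :=
  ((volume.restrict (Set.Ioi (0 : ℝ))).prod μ).map
    (fun q => (radius α q.1 * q.2.1, radius α q.1 * q.2.2))

lemma lintegral_radial (α : ℝ) (μ : Measure (ℝ × ℝ)) [SFinite μ] {F : ℝ × ℝ → ℝ≥0∞}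
    (hF : Measurable F) :
    ∫⁻ z, F z ∂radial α μ =
      ∫⁻ s in Set.Ioi (0 : ℝ), ∫⁻ z, F (radius α s * z.1, radius α s * z.2) ∂μ := by
  unfold radial
  rw [lintegral_map hF (by fun_prop), lintegral_prod _ (by fun_prop)]

/-- For fixed z both conditions bound s from above, by the two powers, so the s-integral is their
minimum. -/
lemma radial_quadrant {α : ℝ} (hα : 0 < α) (μ : Measure (ℝ × ℝ)) [SFinite μ] (x y : ℝ) :
    radial α μ {z | 1 < x * z.1 ∧ 1 < y * z.2} =
      ∫⁻ z, min (posPow α (x * z.1)) (posPow α (y * z.2)) ∂μ := by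
  have hm : MeasurableSet {z : ℝ × ℝ | 1 < x * z.1 ∧ 1 < y * z.2} := by
    measurability
  have hm' : Measurable ({z : ℝ × ℝ | 1 < x * z.1 ∧ 1 < y * z.2}.indicator
    (1 : ℝ × ℝ → ℝ≥0∞)) := measurable_one.indicator hm
  rw [← lintegral_indicator_one hm, lintegral_radial α μ hm',
    lintegral_lintegral_swap (by fun_prop)]
  refine lintegral_congr fun z => ?_
  rw [← tsub_zero (min _ _), ← volume_ofReal_lt _ 0 (by simp [posPow_ne_top])]
  refine setLIntegral_congr_fun measurableSet_Ioi fun s hs => ?_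
  simp only [Set.indicator, Set.mem_ofPred_eq, Pi.one_apply, zero_le, and_true, lt_min_iff]
  simp only [← one_lt_radius_mul_iff hα hs, mul_left_comm]

/-- A negative x turns the half-lines round; allowing both signs treats all four quadrants of the
plane at once. -/
lemma generateFrom_halflines {x : ℝ} (hx : x ≠ 0) :
    (inferInstance : MeasurableSpace ℝ) =
      MeasurableSpace.generateFrom (Set.range fun a : ℝ => {z | a < x * z}) := by
  rw [BorelSpace.measurable_eq (α := ℝ)]
  rcases lt_or_gt_of_ne hx with h | h
  · rw [borel_eq_generateFrom_Iio]
    refine congrArg MeasurableSpace.generateFrom (Set.ext fun s => ?_)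
    constructor
    · rintro ⟨a, rfl⟩
      refine ⟨x * a, ?_⟩
      ext z
      simp [mul_lt_mul_left_of_neg h]
    · rintro ⟨a, rfl⟩
      refine ⟨a / x, ?_⟩
      ext z
      simp [lt_div_iff_of_neg h, mul_comm]
  · rw [borel_eq_generateFrom_Ioi]
    refine congrArg MeasurableSpace.generateFrom (Set.ext fun s => ?_)
    constructor
    · rintro ⟨a, rfl⟩
      refine ⟨x * a, ?_⟩
      ext z
      simp [mul_lt_mul_iff_right₀ h]
    · rintro ⟨a, rfl⟩
      refine ⟨a / x, ?_⟩
      ext z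
      simp [div_lt_iff₀ h, mul_comm]

lemma ext_of_quadrants {m₁ m₂ : Measure (ℝ × ℝ)} [IsFiniteMeasure m₁] {x y : ℝ} (hx : x ≠ 0)
    (hy : y ≠ 0) (huniv : m₁ Set.univ = m₂ Set.univ)
    (h : ∀ a b : ℝ, m₁ {z | a < x * z.1 ∧ b < y * z.2} = m₂ {z | a < x * z.1 ∧ b < y * z.2}) :
    m₁ = m₂ := by
  have span : ∀ {x : ℝ}, x ≠ 0 →
      IsCountablySpanning (Set.range fun a : ℝ => {z : ℝ | a < x * z}) := by
    intro x hx
    refine ⟨fun n => {z | -(n : ℝ) < x * z}, fun n => ⟨_, rfl⟩, ?_⟩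
    refine Set.eq_univ_of_forall fun z => Set.mem_iUnion.2 ?_
    obtain ⟨n, hn⟩ := exists_nat_gt (-(x * z))
    exact ⟨n, by simp only [Set.mem_ofPred_eq]; linarith⟩
  have pis : ∀ x : ℝ, IsPiSystem (Set.range fun a : ℝ => {z : ℝ | a < x * z}) := by
    rintro x _ ⟨a, rfl⟩ _ ⟨b, rfl⟩ -
    exact ⟨max a b, by ext z; simp⟩
  refine ext_of_generate_finite
    (Set.image2 (· ×ˢ ·) (Set.range fun a : ℝ => {z : ℝ | a < x * z})
      (Set.range fun a : ℝ => {z : ℝ | a < y * z})) ?_ ((pis x).prod (pis y)) ?_ huniv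
  · exact (generateFrom_eq_prod (generateFrom_halflines hx).symm (generateFrom_halflines hy).symm
      (span hx) (span hy)).symm
  · rintro _ ⟨_, ⟨a, rfl⟩, _, ⟨b, rfl⟩, rfl⟩
    exact h a b

lemma IsAdjoint.symm {p α : ℝ} {μ μ' : Measure (ℝ × ℝ)} (h : IsAdjoint p α μ μ') :
    IsAdjoint p α μ' μ :=
  ⟨h.mem_right, h.mem_left, fun x y => by
    simp_rw [min_comm (posPow α (x * _)), h.identity y x]⟩

lemma posPow_mul {α a : ℝ} (ha : 0 ≤ a) (u : ℝ) :
    posPow α (a * u) = ENNReal.ofReal (a ^ α) * posPow α u := by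
  unfold posPow
  rw [← ENNReal.ofReal_mul (by positivity), ← Real.mul_rpow ha (le_max_right _ _),
    mul_max_of_nonneg _ _ ha, mul_zero]


lemma MemClass.lintegral_posPow_ne_top {p α : ℝ} {μ : Measure (ℝ × ℝ)} (hμ : MemClass p α μ)
    (y : ℝ) : ∫⁻ z, posPow α (y * z.2) ∂μ ≠ ∞ := by
  have := hμ.isProb
  obtain ⟨σ, hσ, hy⟩ : ∃ σ : ℝ, (σ = 1 ∨ σ = -1) ∧ y = |y| * σ := by
    rcases le_total 0 y with h | h
    · exact ⟨1, Or.inl rfl, by rw [abs_of_nonneg h, mul_one]⟩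
    · exact ⟨-1, Or.inr rfl, by rw [abs_of_nonpos h]; ring⟩
  rw [hy]
  simp_rw [mul_assoc, posPow_mul (abs_nonneg y)]
  rw [lintegral_const_mul _ (by fun_prop)]
  exact ENNReal.mul_ne_top ENNReal.ofReal_ne_top
    (ne_top_of_le_ne_top (measure_ne_top μ _) (hμ.moment σ hσ))

/-- Seen through `radial_quadrant`, the identity defining the adjoint is an equality of quadrant
masses. -/
lemma IsAdjoint.radial_swap_quadrant {p α : ℝ} {μ μ' : Measure (ℝ × ℝ)} (hα : 0 < α)
    (h : IsAdjoint p α μ μ') (x y : ℝ) :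
    radial α μ {z | 1 < x * z.1 ∧ 1 < y * z.2} =
      (radial α μ').map Prod.swap {z | 1 < x * z.1 ∧ 1 < y * z.2} := by
  have := h.mem_left.isProb
  have := h.mem_right.isProb
  rw [Measure.map_apply measurable_swap (by measurability), radial_quadrant hα, h.identity x y]
  simp_rw [min_comm (posPow α (x * _))]
  rw [← radial_quadrant hα]
  congr 1
  ext z
  simp [and_comm]

lemma radial_quadrant_ne_top {p α : ℝ} {μ : Measure (ℝ × ℝ)} (hα : 0 < α)
    (hμ : MemClass p α μ) (x y : ℝ) : radial α μ {z | 1 < x * z.1 ∧ 1 < y * z.2} ≠ ∞ := by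
  have := hμ.isProb
  rw [radial_quadrant hα]
  exact ne_top_of_le_ne_top (hμ.lintegral_posPow_ne_top y)
    (lintegral_mono fun z => min_le_right _ _)

/-- The radial measures are infinite near the origin, but a quadrant bounded away from the axes has
finite mass, so a π-system argument works there. -/
lemma IsAdjoint.restrict_quadrant {p α : ℝ} {μ μ' : Measure (ℝ × ℝ)} (hα : 0 < α)
    (h : IsAdjoint p α μ μ') {x y : ℝ} (hx : x ≠ 0) (hy : y ≠ 0) :
    (radial α μ).restrict {z | 1 < x * z.1 ∧ 1 < y * z.2} =
      ((radial α μ').map Prod.swap).restrict {z | 1 < x * z.1 ∧ 1 < y * z.2} := by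
  have hfin : IsFiniteMeasure ((radial α μ).restrict {z | 1 < x * z.1 ∧ 1 < y * z.2}) :=
    ⟨by simpa using (radial_quadrant_ne_top hα h.mem_left x y).lt_top⟩
  refine ext_of_quadrants hx hy (by simpa using h.radial_swap_quadrant hα x y) fun a b => ?_
  -- A rectangle cut down to the quadrant is again a quadrant with rescaled coefficients, so the
  -- same mass identity applies to it.
  have key : {z : ℝ × ℝ | a < x * z.1 ∧ b < y * z.2} ∩ {z | 1 < x * z.1 ∧ 1 < y * z.2} =
      {z | 1 < (x / max a 1) * z.1 ∧ 1 < (y / max b 1) * z.2} := by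
    have aux : ∀ a c t : ℝ, 1 < c / max a 1 * t ↔ a < c * t ∧ 1 < c * t := by
      intro a c t
      rw [div_mul_eq_mul_div, one_lt_div (by positivity), max_lt_iff]
    ext z
    simp only [Set.mem_inter_iff, Set.mem_ofPred_eq, aux]
    tauto
  rw [Measure.restrict_apply (by measurability), Measure.restrict_apply (by measurability), key]
  exact h.radial_swap_quadrant hα _ _

/-- The complement of the axes is a countable union of the quadrants with nonzero integer
coefficients. On the axes the adjoint identity says nothing, hence the vanishing condition on F. -/
lemma IsAdjoint.lintegral_radial_swap {p α : ℝ} {μ μ' : Measure (ℝ × ℝ)} (hα : 0 < α)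
    (h : IsAdjoint p α μ μ') {F : ℝ × ℝ → ℝ≥0∞} (hF : Measurable F)
    (h0 : ∀ z, z.1 = 0 ∨ z.2 = 0 → F z = 0) :
    ∫⁻ z, F z ∂radial α μ = ∫⁻ z, F z.swap ∂radial α μ' := by
  let U : ℤ × ℤ → Set (ℝ × ℝ) := fun i =>
    if i.1 ≠ 0 ∧ i.2 ≠ 0 then {z | 1 < (i.1 : ℝ) * z.1 ∧ 1 < (i.2 : ℝ) * z.2} else ∅
  have hU : (radial α μ).restrict (⋃ i, U i) =
      ((radial α μ').map Prod.swap).restrict (⋃ i, U i) := by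
    rw [Measure.restrict_iUnion_congr]
    intro i
    by_cases hi : i.1 ≠ 0 ∧ i.2 ≠ 0
    · simp only [U, if_pos hi]
      exact h.restrict_quadrant hα (by exact_mod_cast hi.1) (by exact_mod_cast hi.2)
    · simp [U, if_neg hi]
  have hmem : ∀ t : ℝ, t ≠ 0 → ∃ i : ℤ, i ≠ 0 ∧ 1 < (i : ℝ) * t := by
    intro t ht
    rcases lt_or_gt_of_ne ht with h | h
    · obtain ⟨n, hn⟩ := exists_nat_gt (1 / -t)
      have h' : 1 < (n : ℝ) * -t := by rwa [div_lt_iff₀ (by linarith)] at hn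
      refine ⟨-n, ?_, by push_cast; linarith⟩
      rintro h0
      have : (n : ℝ) = 0 := by exact_mod_cast neg_eq_zero.1 h0
      rw [this] at h'; linarith
    · obtain ⟨n, hn⟩ := exists_nat_gt (1 / t)
      have h' : 1 < (n : ℝ) * t := by rwa [div_lt_iff₀ h] at hn
      refine ⟨n, ?_, by push_cast; linarith⟩
      rintro h0
      have : (n : ℝ) = 0 := by exact_mod_cast h0
      rw [this] at h'; linarith
  have hsub : ∀ z, z ∉ (⋃ i, U i) → F z = 0 := by
    intro z hz
    apply h0
    by_contra! hne
    obtain ⟨i, hi, hi'⟩ := hmem _ hne.1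
    obtain ⟨j, hj, hj'⟩ := hmem _ hne.2
    exact hz (Set.mem_iUnion.2 ⟨(i, j), by simp [U, hi, hj, hi', hj']⟩)
  have hUm : MeasurableSet (⋃ i, U i) := by
    refine MeasurableSet.iUnion fun i => ?_
    by_cases hi : i.1 ≠ 0 ∧ i.2 ≠ 0
    · simp only [U, if_pos hi]; measurability
    · simp [U, if_neg hi]
  have hind : F = (⋃ i, U i).indicator F := by
    ext z
    by_cases hz : z ∈ ⋃ i, U i
    · rw [Set.indicator_of_mem hz]
    · rw [Set.indicator_of_notMem hz, hsub z hz]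
  rw [← lintegral_map (f := F) hF measurable_swap, hind, lintegral_indicator hUm,
    lintegral_indicator hUm, hU]

/-! ### The transition operator -/

/-- The law of `M / I` given `I = σ`. -/
def stepLaw (μ : Measure (ℝ × ℝ)) (σ : ℝ) : Measure ℝ :=
  (μ[|{z : ℝ × ℝ | z.1 = σ}]).map (fun z => z.2 / z.1)

lemma tailStep_zero (μ : Measure (ℝ × ℝ)) : tailStep μ 0 = Measure.dirac 0 := by
  simp [tailStep]

lemma tailStep_of_ne_zero (μ : Measure (ℝ × ℝ)) {x : ℝ} (hx : x ≠ 0) :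
    tailStep μ x = (stepLaw μ (Real.sign x)).map (fun y => x * y) := by
  rw [tailStep, if_neg hx, stepLaw, Measure.map_map (by fun_prop) (by fun_prop)]
  congr 1
  ext z
  simp [mul_div_assoc]

instance (μ : Measure (ℝ × ℝ)) (σ : ℝ) : IsFiniteMeasure (stepLaw μ σ) := by
  unfold stepLaw; infer_instance

/-- Only a bound is available: conditioning on a sign of probability zero yields the zero measure.
-/
lemma stepLaw_univ_le (μ : Measure (ℝ × ℝ)) (σ : ℝ) : stepLaw μ σ Set.univ ≤ 1 := by
  unfold stepLaw
  rw [Measure.map_apply (by fun_prop) MeasurableSet.univ, Set.preimage_univ]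
  exact prob_le_one

lemma measurable_tailStep (μ : Measure (ℝ × ℝ)) : Measurable (tailStep μ) := by
  have key : ∀ σ, Measurable fun x : ℝ => (stepLaw μ σ).map (fun y => x * y) := by
    intro σ
    refine Measure.measurable_of_measurable_coe _ fun s hs => ?_
    simp_rw [Measure.map_apply (measurable_const_mul _) hs]
    exact measurable_measure_prodMk_left (ν := stepLaw μ σ)
      (s := {q : ℝ × ℝ | q.1 * q.2 ∈ s}) (measurableSet_preimage (by fun_prop) hs)
  have : tailStep μ = fun x => if x = 0 then Measure.dirac 0 else
      if 0 < x then (stepLaw μ 1).map (fun y => x * y)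
      else (stepLaw μ (-1)).map (fun y => x * y) := by
    ext1 x
    split_ifs with h h'
    · rw [h, tailStep_zero]
    · rw [tailStep_of_ne_zero μ h, Real.sign_of_pos h']
    · rw [tailStep_of_ne_zero μ h, Real.sign_of_neg (lt_of_le_of_ne (not_lt.1 h') h)]
  rw [this]
  exact Measurable.ite (measurableSet_singleton 0) measurable_const
    (Measurable.ite measurableSet_Ioi (key 1) (key (-1)))

/-- The transition kernel of a tail chain. -/
def tailKernel (μ : Measure (ℝ × ℝ)) : Kernel ℝ ℝ := ⟨tailStep μ, measurable_tailStep μ⟩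

lemma tailKernel_apply (μ : Measure (ℝ × ℝ)) (x : ℝ) : tailKernel μ x = tailStep μ x := rfl

lemma tailStep_univ_le (μ : Measure (ℝ × ℝ)) (x : ℝ) : tailStep μ x Set.univ ≤ 1 := by
  rcases eq_or_ne x 0 with rfl | h
  · simp [tailStep_zero]
  · rw [tailStep_of_ne_zero μ h, Measure.map_apply (by fun_prop) MeasurableSet.univ,
      Set.preimage_univ]
    exact stepLaw_univ_le μ _

instance (μ : Measure (ℝ × ℝ)) : IsFiniteKernel (tailKernel μ) :=
  ⟨1, ENNReal.one_lt_top, fun x => tailStep_univ_le μ x⟩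

/-- The transition operator of a tail chain. -/
def stepOp (μ : Measure (ℝ × ℝ)) (h : ℝ → ℝ≥0∞) (x : ℝ) : ℝ≥0∞ := ∫⁻ y, h y ∂tailStep μ x

@[fun_prop]
lemma measurable_stepOp (μ : Measure (ℝ × ℝ)) {h : ℝ → ℝ≥0∞} (hh : Measurable h) :
    Measurable (stepOp μ h) :=
  Measurable.lintegral_kernel (κ := tailKernel μ) hh

lemma stepOp_zero (μ : Measure (ℝ × ℝ)) {h : ℝ → ℝ≥0∞} (hh : Measurable h) :
    stepOp μ h 0 = h 0 := by
  rw [stepOp, tailStep_zero, lintegral_dirac' _ hh]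

lemma stepOp_of_ne_zero (μ : Measure (ℝ × ℝ)) {h : ℝ → ℝ≥0∞} (hh : Measurable h) {x : ℝ}
    (hx : x ≠ 0) : stepOp μ h x = ∫⁻ y, h (x * y) ∂stepLaw μ (Real.sign x) := by
  rw [stepOp, tailStep_of_ne_zero μ hx, lintegral_map hh (by fun_prop)]

lemma sign_mul_of_pos {r : ℝ} (hr : 0 < r) (x : ℝ) : Real.sign (r * x) = Real.sign x := by
  rcases lt_trichotomy x 0 with h | rfl | h
  · rw [Real.sign_of_neg h, Real.sign_of_neg (mul_neg_of_pos_of_neg hr h)]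
  · simp
  · rw [Real.sign_of_pos h, Real.sign_of_pos (mul_pos hr h)]

/-- A step multiplies the state by a factor whose law depends on the sign alone, so a positive
radius can be moved into the starting state. -/
lemma stepOp_scale (μ : Measure (ℝ × ℝ)) {h : ℝ → ℝ≥0∞} (hh : Measurable h) {r : ℝ} (hr : 0 < r)
    (x : ℝ) : stepOp μ (fun y => h (r * y)) x = stepOp μ h (r * x) := by
  rcases eq_or_ne x 0 with rfl | hx
  · rw [stepOp_zero μ (by fun_prop), mul_zero, stepOp_zero μ hh]
  · rw [stepOp_of_ne_zero μ (by fun_prop) hx, stepOp_of_ne_zero μ hh (by positivity),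
      sign_mul_of_pos hr]
    simp_rw [mul_assoc]

/-- The law of `I`. -/
def signLaw (p : ℝ) : Measure ℝ :=
  ENNReal.ofReal p • Measure.dirac (1 : ℝ) + ENNReal.ofReal (1 - p) • Measure.dirac (-1 : ℝ)

lemma lintegral_signLaw (p : ℝ) {f : ℝ → ℝ≥0∞} (hf : Measurable f) :
    ∫⁻ σ, f σ ∂signLaw p = ENNReal.ofReal p * f 1 + ENNReal.ofReal (1 - p) * f (-1) := by
  simp [signLaw, lintegral_dirac' _ hf]

instance (p : ℝ) : IsFiniteMeasure (signLaw p) := by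
  unfold signLaw
  have := Measure.smul_finite (Measure.dirac (1 : ℝ)) (c := ENNReal.ofReal p)
    ENNReal.ofReal_ne_top
  have := Measure.smul_finite (Measure.dirac (-1 : ℝ)) (c := ENNReal.ofReal (1 - p))
    ENNReal.ofReal_ne_top
  infer_instance

lemma MemClass.ae_fst {p α : ℝ} {μ : Measure (ℝ × ℝ)} (hμ : MemClass p α μ) :
    ∀ᵐ z ∂μ, z.1 = 1 ∨ z.1 = -1 := by
  have := hμ.isProb
  have hm : ∀ σ : ℝ, MeasurableSet {z : ℝ × ℝ | z.1 = σ} := fun σ =>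
    measurableSet_eq_fun measurable_fst measurable_const
  have h1 : μ ({z | z.1 = 1} ∪ {z | z.1 = -1}) = 1 := by
    refine le_antisymm prob_le_one ?_
    rw [measure_union ?_ (hm _), hμ.prob_one, hμ.prob_neg_one]
    · refine le_trans ?_ ENNReal.ofReal_add_le
      simp
    · rw [Set.disjoint_left]
      intro z (h : z.1 = 1) (h' : z.1 = -1)
      rw [h] at h'
      norm_num at h'
  have := (prob_compl_eq_zero_iff ((hm 1).union (hm (-1)))).2 h1
  rw [ae_iff]
  convert this using 2
  ext z
  simp

/-- Disintegration of the pair along its sign. A sign of probability zero has a degenerate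
conditional law, but then its weight is zero as well. -/
lemma MemClass.lintegral_eq {p α : ℝ} {μ : Measure (ℝ × ℝ)} (hμ : MemClass p α μ)
    {F : ℝ × ℝ → ℝ≥0∞} (hF : Measurable F) :
    ∫⁻ z, F z ∂μ = ∫⁻ σ, stepOp μ (fun y => F (σ, y)) σ ∂signLaw p := by
  have := hμ.isProb
  have hm : ∀ σ : ℝ, MeasurableSet {z : ℝ × ℝ | z.1 = σ} := fun σ =>
    measurableSet_eq_fun measurable_fst measurable_const
  have hdisj : Disjoint {z : ℝ × ℝ | z.1 = 1} {z | z.1 = -1} := by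
    rw [Set.disjoint_left]
    intro z (h : z.1 = 1) (h' : z.1 = -1)
    rw [h] at h'
    norm_num at h'
  have hpiece : ∀ σ : ℝ, (σ = 1 ∨ σ = -1) → ∫⁻ z in {z | z.1 = σ}, F z ∂μ =
      μ {z | z.1 = σ} * stepOp μ (fun y => F (σ, y)) σ := by
    intro σ hσ
    have hσ0 : σ ≠ 0 := by rcases hσ with rfl | rfl <;> norm_num
    have hsg : Real.sign σ = σ := by
      rcases hσ with rfl | rfl
      · exact Real.sign_of_pos one_pos
      · exact Real.sign_of_neg (by norm_num)
    rw [stepOp_of_ne_zero μ (by fun_prop) hσ0, hsg, stepLaw, lintegral_map (by fun_prop)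
      (by fun_prop), ProbabilityTheory.cond, lintegral_smul_measure, smul_eq_mul, ← mul_assoc]
    rcases eq_or_ne (μ {z | z.1 = σ}) 0 with h0 | h0
    · simp [Measure.restrict_eq_zero.2 h0, h0]
    rw [ENNReal.mul_inv_cancel h0 (measure_ne_top _ _), one_mul]
    refine setLIntegral_congr_fun (hm σ) fun z hz => ?_
    have hz' : z.1 = σ := hz
    rw [hz', mul_div_cancel₀ _ hσ0, ← hz']
  have hmeas : Measurable fun σ => stepOp μ (fun y => F (σ, y)) σ :=
    Measurable.lintegral_kernel_prod_right' (κ := tailKernel μ) hF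
  rw [lintegral_signLaw p hmeas, ← hμ.prob_one, ← hμ.prob_neg_one, ← hpiece 1 (Or.inl rfl),
    ← hpiece (-1) (Or.inr rfl), ← lintegral_union (hm _) hdisj]
  have hae : ∀ᵐ z ∂μ, z ∈ {z : ℝ × ℝ | z.1 = 1} ∪ {z | z.1 = -1} := by
    filter_upwards [hμ.ae_fst] with z hz
    simpa using hz
  rw [Measure.restrict_eq_self_of_ae_mem hae]

lemma lintegral_radial_fst {p α : ℝ} {μ : Measure (ℝ × ℝ)} (hμ : MemClass p α μ)
    {f g : ℝ → ℝ≥0∞} (hf : Measurable f) (hg : Measurable g) :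
    ∫⁻ z, f z.1 * g z.2 ∂radial α μ =
      ∫⁻ s in Set.Ioi (0 : ℝ), ∫⁻ σ, f (radius α s * σ) * stepOp μ g (radius α s * σ)
        ∂signLaw p := by
  have := hμ.isProb
  rw [lintegral_radial α μ (by fun_prop)]
  refine setLIntegral_congr_fun measurableSet_Ioi fun s hs => ?_
  rw [hμ.lintegral_eq (F := fun z => f (radius α s * z.1) * g (radius α s * z.2)) (by fun_prop)]
  refine lintegral_congr fun σ => ?_
  rw [← stepOp_scale μ hg (radius_pos α hs), stepOp, stepOp]
  have hm : Measurable fun y => g (radius α s * y) := by fun_prop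
  dsimp only
  rw [lintegral_const_mul _ hm]

/-- Integration against the radial measure whose first marginal is shared by all laws
in `MemClass p α`. -/
def radialInt (p α : ℝ) (f : ℝ → ℝ≥0∞) : ℝ≥0∞ :=
  ∫⁻ s in Set.Ioi (0 : ℝ), ∫⁻ σ, f (radius α s * σ) ∂signLaw p

/-- The forward and backward kernels are in duality with respect to their common radial first
marginal. Both functions must vanish at 0, where the two laws may carry unrelated atoms. -/
lemma IsAdjoint.detailed_balance {p α : ℝ} {μ μ' : Measure (ℝ × ℝ)} (hα : 0 < α)
    (h : IsAdjoint p α μ μ') {f g : ℝ → ℝ≥0∞} (hf : Measurable f) (hg : Measurable g)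
    (hf0 : f 0 = 0) (hg0 : g 0 = 0) :
    radialInt p α (fun x => f x * stepOp μ g x) = radialInt p α (fun x => g x * stepOp μ' f x) := by
  unfold radialInt
  rw [← lintegral_radial_fst h.mem_left hf hg, ← lintegral_radial_fst h.mem_right hg hf,
    h.lintegral_radial_swap hα (by fun_prop)]
  · simp [mul_comm]
  · rintro z (hz | hz) <;> simp [hz, hf0, hg0]

/-- `x ↦ f₀(x) E[f₁(M₁) ⋯ fₙ₋₁(Mₙ₋₁) g(Mₙ) | M₀ = x]` for the list `[f₀, …, fₙ₋₁]`. -/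
def pathOp (μ : Measure (ℝ × ℝ)) (L : List (ℝ → ℝ≥0∞)) (g : ℝ → ℝ≥0∞) : ℝ → ℝ≥0∞ :=
  L.foldr (fun f acc x => f x * stepOp μ acc x) g

@[simp]
lemma pathOp_nil (μ : Measure (ℝ × ℝ)) (g : ℝ → ℝ≥0∞) : pathOp μ [] g = g := rfl

@[simp]
lemma pathOp_cons (μ : Measure (ℝ × ℝ)) (f : ℝ → ℝ≥0∞) (L : List (ℝ → ℝ≥0∞)) (g : ℝ → ℝ≥0∞) :
    pathOp μ (f :: L) g = fun x => f x * stepOp μ (pathOp μ L g) x := rfl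

lemma pathOp_append (μ : Measure (ℝ × ℝ)) (f : ℝ → ℝ≥0∞) (L : List (ℝ → ℝ≥0∞))
    (g : ℝ → ℝ≥0∞) :
    pathOp μ (L ++ [f]) g = pathOp μ L (fun x => f x * stepOp μ g x) := by
  simp [pathOp]

lemma measurable_pathOp (μ : Measure (ℝ × ℝ)) {L : List (ℝ → ℝ≥0∞)} {g : ℝ → ℝ≥0∞}
    (hL : ∀ f ∈ L, Measurable f) (hg : Measurable g) : Measurable (pathOp μ L g) := by
  induction L with
  | nil => exact hg
  | cons f L ih =>
    have hf := hL f (by simp)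
    have := ih fun f hf => hL f (by simp [hf])
    rw [pathOp_cons]
    fun_prop

lemma pathOp_zero (μ : Measure (ℝ × ℝ)) {L : List (ℝ → ℝ≥0∞)} {g : ℝ → ℝ≥0∞}
    (hL : ∀ f ∈ L, Measurable f) (hg : Measurable g) (hg0 : g 0 = 0) : pathOp μ L g 0 = 0 := by
  induction L with
  | nil => exact hg0
  | cons f L ih =>
    have hL' : ∀ f ∈ L, Measurable f := fun f hf => hL f (by simp [hf])
    simp only [pathOp_cons]
    rw [stepOp_zero μ (measurable_pathOp μ hL' hg), ih hL', mul_zero]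

/-- Detailed balance is applied to the first step, with the rest of the path as its second function;
this turns f into a weight on the next state, and the induction continues with a shorter list. Since
0 is absorbing, both functions still vanish there. -/
lemma IsAdjoint.reversal {p α : ℝ} {μ μ' : Measure (ℝ × ℝ)} (hα : 0 < α)
    (h : IsAdjoint p α μ μ') {L : List (ℝ → ℝ≥0∞)} {f g : ℝ → ℝ≥0∞}
    (hL : ∀ f ∈ L, Measurable f) (hf : Measurable f) (hg : Measurable g)
    (hf0 : f 0 = 0) (hg0 : g 0 = 0) :
    radialInt p α (pathOp μ (f :: L) g) = radialInt p α (pathOp μ' (g :: L.reverse) f) := by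
  induction L generalizing f with
  | nil => simpa using h.detailed_balance hα hf hg hf0 hg0
  | cons k L ih =>
    have hL' : ∀ f ∈ L, Measurable f := fun f hf => hL f (by simp [hf])
    have hk := hL k (by simp)
    have hm := measurable_pathOp μ hL' hg
    have h1 := h.detailed_balance hα hf (g := pathOp μ (k :: L) g)
      (measurable_pathOp μ hL hg) hf0 (pathOp_zero μ hL hg hg0)
    have h2 := ih hL' (f := fun x => k x * stepOp μ' f x) (by fun_prop)
      (by simp [stepOp_zero μ' hf, hf0])
    rw [pathOp_cons, h1, List.reverse_cons, ← List.cons_append, pathOp_append, ← h2]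
    congr 1
    ext x
    simp only [pathOp_cons]
    ring

end

section

/-! ### Markov processes driven by the tail kernel -/

variable {Ω : Type*}

/-- `f₀(N_t) ⋯ fₙ₋₁(N_{t+n-1}) g(N_{t+n})` for the list `[f₀, …, fₙ₋₁]`. -/
def pathProd (N : ℤ → Ω → ℝ) : List (ℝ → ℝ≥0∞) → (ℝ → ℝ≥0∞) → ℤ → Ω → ℝ≥0∞
  | [], g, t, ω => g (N t ω)
  | f :: L, g, t, ω => f (N t ω) * pathProd N L g (t + 1) ω

lemma pathProd_map_range (N : ℤ → Ω → ℝ) (n : ℕ) (F : ℕ → ℝ → ℝ≥0∞) (g : ℝ → ℝ≥0∞) (t : ℤ)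
    (ω : Ω) :
    pathProd N ((List.range n).map F) g t ω =
      (∏ k ∈ Finset.range n, F k (N (t + k) ω)) * g (N (t + n) ω) := by
  induction n generalizing t F with
  | zero => simp [pathProd]
  | succ n ih =>
    rw [List.range_succ_eq_map, List.map_cons, List.map_map, pathProd, ih,
      Finset.prod_range_succ']
    simp only [Function.comp_apply, Nat.succ_eq_add_one, Nat.cast_add, Nat.cast_one,
      Nat.cast_zero, add_zero]
    simp only [add_assoc, add_comm (1 : ℤ)]
    ring

variable [MeasurableSpace Ω]

/-- Forward Markov property from time `0` on, with the transitions of `tailStep μ`. -/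
structure IsTailMarkov (Q : Measure Ω) (μ : Measure (ℝ × ℝ)) (N : ℤ → Ω → ℝ) : Prop where
  measurable : ∀ t, Measurable (N t)
  step : ∀ t : ℤ, 1 ≤ t → ∀ (w : ({s : ℤ // s < t} → ℝ) → ℝ≥0∞) (h : ℝ → ℝ≥0∞),
    Measurable w → Measurable h →
    ∫⁻ ω, w (fun s => N s ω) * h (N t ω) ∂Q =
      ∫⁻ ω, w (fun s => N s ω) * stepOp μ h (N (t - 1) ω) ∂Q

/-- The weight may involve the whole past up to time t, including negative times; this is what later
allows conditioning on M_{-1}. -/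
lemma IsTailMarkov.path {Q : Measure Ω} {μ : Measure (ℝ × ℝ)} {N : ℤ → Ω → ℝ}
    (hN : IsTailMarkov Q μ N) {L : List (ℝ → ℝ≥0∞)} {g : ℝ → ℝ≥0∞}
    (hL : ∀ f ∈ L, Measurable f) (hg : Measurable g) {t : ℤ} (ht : 0 ≤ t)
    {w : ({s : ℤ // s < t + 1} → ℝ) → ℝ≥0∞} (hw : Measurable w) :
    ∫⁻ ω, w (fun s => N s ω) * pathProd N L g t ω ∂Q =
      ∫⁻ ω, w (fun s => N s ω) * pathOp μ L g (N t ω) ∂Q := by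
  induction L generalizing t with
  | nil => rfl
  | cons f L ih =>
    have hf := hL f (by simp)
    have hL' : ∀ f ∈ L, Measurable f := fun f hf => hL f (by simp [hf])
    have hm := measurable_pathOp μ hL' hg
    have h1 := ih hL' (t := t + 1) (by omega)
      (w := fun h => w (fun s => h ⟨s, s.2.trans (by omega)⟩) * f (h ⟨t, by omega⟩))
      (by fun_prop)
    have h2 := hN.step (t + 1) (by omega) (fun h => w h * f (h ⟨t, by omega⟩)) _ (by fun_prop) hm
    simp only [pathProd, pathOp_cons]
    simp only [mul_assoc, add_sub_cancel_right] at h1 h2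
    exact h1.trans h2

lemma IsTailMarkov.scale {Q : Measure Ω} {μ : Measure (ℝ × ℝ)} {N : ℤ → Ω → ℝ}
    (hN : IsTailMarkov Q μ N) {r : ℝ} (hr : 0 < r) :
    IsTailMarkov Q μ (fun t ω => r * N t ω) where
  measurable t := (hN.measurable t).const_mul r
  step t ht w h hw hh := by
    have := hN.step t ht (fun x => w (fun s => r * x s)) (fun y => h (r * y)) (by fun_prop)
      (by fun_prop)
    simpa only [stepOp_scale μ hh hr] using this

/-- A process whose future is a chain with transition law `μ` and whose step from time `0` to
time `-1` has the adjoint law `μ'`. -/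
structure IsTwoSided (Q : Measure Ω) (p α : ℝ) (μ μ' : Measure (ℝ × ℝ)) (N : ℤ → Ω → ℝ) :
    Prop where
  index_pos : 0 < α
  markov : IsTailMarkov Q μ N
  law_forward : Q.map (fun ω => (N 0 ω, N 1 ω)) = μ
  law_backward : Q.map (fun ω => (N 0 ω, N (-1) ω)) = μ'
  adjoint : IsAdjoint p α μ μ'

lemma MemClass.lintegral_fst {p α : ℝ} {μ : Measure (ℝ × ℝ)} (hμ : MemClass p α μ)
    {f : ℝ → ℝ≥0∞} (hf : Measurable f) : ∫⁻ z, f z.1 ∂μ = ∫⁻ σ, f σ ∂signLaw p := by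
  have hm : ∀ σ : ℝ, MeasurableSet {z : ℝ × ℝ | z.1 = σ} := fun σ =>
    measurableSet_eq_fun measurable_fst measurable_const
  have : (fun z : ℝ × ℝ => f z.1) =ᵐ[μ] fun z => {z : ℝ × ℝ | z.1 = 1}.indicator
      (fun _ => f 1) z + {z : ℝ × ℝ | z.1 = -1}.indicator (fun _ => f (-1)) z := by
    filter_upwards [hμ.ae_fst] with z hz
    rcases hz with hz | hz
    · simp [Set.indicator, hz, show ¬ ((1 : ℝ) = -1) by norm_num]
    · simp [Set.indicator, hz, show ¬ ((-1 : ℝ) = 1) by norm_num]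
  rw [lintegral_congr_ae this, lintegral_add_left (measurable_const.indicator (hm 1)),
    lintegral_indicator_const (hm 1), lintegral_indicator_const (hm (-1)), lintegral_signLaw p hf,
    hμ.prob_one, hμ.prob_neg_one, mul_comm (f 1), mul_comm (f (-1))]

variable {Q : Measure Ω} {p α : ℝ} {μ μ' : Measure (ℝ × ℝ)} {N : ℤ → Ω → ℝ}

lemma IsTwoSided.lintegral_forward (hN : IsTwoSided Q p α μ μ' N) {F : ℝ × ℝ → ℝ≥0∞}
    (hF : Measurable F) : ∫⁻ ω, F (N 0 ω, N 1 ω) ∂Q = ∫⁻ z, F z ∂μ := by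
  have h0 := hN.markov.measurable 0
  have h1 := hN.markov.measurable 1
  rw [← hN.law_forward, lintegral_map hF (by fun_prop)]

lemma IsTwoSided.lintegral_backward (hN : IsTwoSided Q p α μ μ' N) {F : ℝ × ℝ → ℝ≥0∞}
    (hF : Measurable F) : ∫⁻ ω, F (N 0 ω, N (-1) ω) ∂Q = ∫⁻ z, F z ∂μ' := by
  have h0 := hN.markov.measurable 0
  have h1 := hN.markov.measurable (-1)
  rw [← hN.law_backward, lintegral_map hF (by fun_prop)]

lemma IsTwoSided.lintegral_zero (hN : IsTwoSided Q p α μ μ' N) {f : ℝ → ℝ≥0∞}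
    (hf : Measurable f) : ∫⁻ ω, f (N 0 ω) ∂Q = ∫⁻ σ, f σ ∂signLaw p := by
  rw [← hN.adjoint.mem_left.lintegral_fst hf]
  exact hN.lintegral_forward (F := fun z => f z.1) (by fun_prop)

/-- The integral over all radii of a path functional. -/
def pathInt (Q : Measure Ω) (α : ℝ) (N : ℤ → Ω → ℝ) (L : List (ℝ → ℝ≥0∞)) (g : ℝ → ℝ≥0∞) : ℝ≥0∞ :=
  ∫⁻ s in Set.Ioi (0 : ℝ), ∫⁻ ω, pathProd (fun t ω => radius α s * N t ω) L g 0 ω ∂Q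

/-- The right side mentions no process, only the forward law: this makes path masses comparable
between different tail chains. -/
lemma IsTwoSided.pathInt_eq (hN : IsTwoSided Q p α μ μ' N) {L : List (ℝ → ℝ≥0∞)} {g : ℝ → ℝ≥0∞}
    (hL : ∀ f ∈ L, Measurable f) (hg : Measurable g) :
    pathInt Q α N L g = radialInt p α (pathOp μ L g) := by
  refine setLIntegral_congr_fun measurableSet_Ioi fun s hs => ?_
  have hm := measurable_pathOp μ hL hg
  have h1 := (hN.markov.scale (radius_pos α hs)).path hL hg le_rfl (w := fun _ => 1)
    measurable_const
  simp only [one_mul] at h1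
  simp only [h1]
  exact hN.lintegral_zero (f := fun x => pathOp μ L g (radius α s * x)) (by fun_prop)

/-- The list of indicators of `c_{k+1} m_k ≤ 1` for `k < n`. -/
def belowList (n : ℕ) (c : ℕ → ℝ) : List (ℝ → ℝ≥0∞) :=
  (List.range n).map (fun k => below (c k))

lemma measurable_of_mem_belowList {n : ℕ} {c : ℕ → ℝ} : ∀ f ∈ belowList n c, Measurable f := by
  intro f hf
  obtain ⟨k, -, rfl⟩ := List.mem_map.1 hf
  exact measurable_below _

lemma measurable_of_mem_above_belowList {n : ℕ} {c : ℕ → ℝ} {a : ℝ} :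
    ∀ f ∈ above a :: belowList n c, Measurable f := by
  intro f hf
  rcases List.mem_cons.1 hf with rfl | hf
  · exact measurable_above _
  · exact measurable_of_mem_belowList f hf

lemma belowList_reverse (n : ℕ) (c : ℕ → ℝ) :
    (belowList n c).reverse = belowList n (fun k => c (n - 1 - k)) := by
  refine List.ext_getElem (by simp [belowList]) fun i h1 h2 => ?_
  simp [belowList]

/-- The mass of the paths exceeding at time `0` but not at times `1, …, n`. -/
def lastExc (Q : Measure Ω) (α : ℝ) (N : ℤ → Ω → ℝ) (n : ℕ) (y : ℕ → ℝ) : ℝ≥0∞ :=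
  pathInt Q α N (above (y 0) :: belowList n (fun k => y (k + 1))) 1

/-- The mass of the paths exceeding at times `0` and `n + 1` but not at times `1, …, n`. -/
def returnExc (Q : Measure Ω) (α : ℝ) (N : ℤ → Ω → ℝ) (n : ℕ) (y : ℕ → ℝ) : ℝ≥0∞ :=
  pathInt Q α N (above (y 0) :: belowList n (fun k => y (k + 1))) (above (y (n + 1)))

lemma IsTwoSided.lastExc_eq (hN : IsTwoSided Q p α μ μ' N) (n : ℕ) (y : ℕ → ℝ) :
    lastExc Q α N n y =
      radialInt p α (pathOp μ (above (y 0) :: belowList n (fun k => y (k + 1))) 1) :=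
  hN.pathInt_eq measurable_of_mem_above_belowList measurable_one

lemma measurable_pathProd (hN : ∀ t, Measurable (N t)) {L : List (ℝ → ℝ≥0∞)} {g : ℝ → ℝ≥0∞}
    (hL : ∀ f ∈ L, Measurable f) (hg : Measurable g) (t : ℤ) :
    Measurable (pathProd N L g t) := by
  induction L generalizing t with
  | nil => exact hg.comp (hN t)
  | cons f L ih =>
    exact ((hL f (by simp)).comp (hN t)).mul (ih (fun f hf => hL f (by simp [hf])) (t + 1))

lemma measurable_pathProd_radius (hN : ∀ t, Measurable (N t)) {L : List (ℝ → ℝ≥0∞)}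
    {g : ℝ → ℝ≥0∞} (hL : ∀ f ∈ L, Measurable f) (hg : Measurable g) (t : ℤ) :
    Measurable fun q : ℝ × Ω => pathProd (fun t ω => radius α q.1 * N t ω) L g t q.2 := by
  have : ∀ (L : List (ℝ → ℝ≥0∞)) t (q : ℝ × Ω),
      pathProd (fun t ω => radius α q.1 * N t ω) L g t q.2 =
        pathProd (fun t (q : ℝ × Ω) => radius α q.1 * N t q.2) L g t q := by
    intro L
    induction L with
    | nil => intro t q; rfl
    | cons f L ih => intro t q; simp only [pathProd, ih]
  simp_rw [this]
  refine measurable_pathProd (fun t => ?_) hL hg t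
  have := hN t
  fun_prop

/-- Paths counted over n steps either exceed at time n + 1 or do not. The identity is stated as a
sum because subtraction of extended reals is truncated. -/
lemma lastExc_succ (hN : ∀ t, Measurable (N t)) [SFinite Q] (n : ℕ) (y : ℕ → ℝ) :
    lastExc Q α N (n + 1) y + returnExc Q α N n y = lastExc Q α N n y := by
  unfold lastExc returnExc pathInt
  have hm : ∀ {L : List (ℝ → ℝ≥0∞)} {g : ℝ → ℝ≥0∞}, (∀ f ∈ L, Measurable f) → Measurable g →
    Measurable fun q : ℝ × Ω => pathProd (fun t ω => radius α q.1 * N t ω) L g 0 q.2 :=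
    fun hL hg => measurable_pathProd_radius hN hL hg 0
  rw [← lintegral_add_left]
  swap
  · exact (hm measurable_of_mem_above_belowList measurable_one).lintegral_prod_right'
  refine setLIntegral_congr_fun measurableSet_Ioi fun s hs => ?_
  rw [← lintegral_add_left]
  swap
  · exact (hm measurable_of_mem_above_belowList measurable_one).comp measurable_prodMk_left
  refine lintegral_congr fun ω => ?_
  simp only [pathProd, belowList, pathProd_map_range, Pi.one_apply, mul_one]
  rw [Finset.prod_range_succ, ← mul_add, ← mul_add, zero_add, add_comm (1 : ℤ) n,
    show ((n : ℤ) + 1) = ((n + 1 : ℕ) : ℤ) by push_cast; ring, below_add_above, mul_one]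

/-- Both ends of such a path are exceedances, so both end indicators vanish at 0 and reversal
applies. It would not apply to `lastExc`, whose final state is free. -/
lemma IsTwoSided.returnExc_eq (hN : IsTwoSided Q p α μ μ' N) {Ω' : Type*} [MeasurableSpace Ω']
    {Q' : Measure Ω'} {N' : ℤ → Ω' → ℝ} (hN' : IsTwoSided Q' p α μ' μ N') (n : ℕ) (y : ℕ → ℝ) :
    returnExc Q α N n y = returnExc Q' α N' n (fun k => y (n + 1 - k)) := by
  unfold returnExc
  rw [hN.pathInt_eq measurable_of_mem_above_belowList (measurable_above _),
    hN'.pathInt_eq measurable_of_mem_above_belowList (measurable_above _),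
    hN.adjoint.reversal hN.index_pos measurable_of_mem_belowList (measurable_above _)
      (measurable_above _) (above_zero _) (above_zero _), belowList_reverse]
  congr 2
  · congr 1
    refine List.map_congr_left fun k hk => ?_
    have := List.mem_range.1 hk
    dsimp only
    rw [show n - 1 - k + 1 = n + 1 - (k + 1) by omega]
  · simp

end

section

/-! ### The two formulas for a tail chain -/

/-- The maximum of `(c_k N_{t+k})_+ ^ α` over `k < n`. -/
def supPow {Ω : Type*} (α : ℝ) (N : ℤ → Ω → ℝ) (c : ℕ → ℝ) (t : ℤ) (n : ℕ) (ω : Ω) : ℝ≥0∞ :=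
  ⨆ k ∈ Finset.range n, posPow α (c k * N (t + k) ω)

variable {Ω : Type*} {α : ℝ} {N : ℤ → Ω → ℝ} {c : ℕ → ℝ}

lemma supPow_ne_top (t : ℤ) (n : ℕ) (ω : Ω) : supPow α N c t n ω ≠ ∞ := by
  refine ne_top_of_le_ne_top (b := ∑ k ∈ Finset.range n, posPow α (c k * N (t + k) ω)) ?_ ?_
  · exact ENNReal.sum_ne_top.2 fun k _ => posPow_ne_top _ _
  · exact iSup₂_le fun k hk => Finset.single_le_sum_of_canonicallyOrdered
      (f := fun k : ℕ => posPow α (c k * N (t + k) ω)) hk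

lemma supPow_succ (t : ℤ) (n : ℕ) (ω : Ω) :
    supPow α N c t (n + 1) ω =
      max (posPow α (c 0 * N t ω)) (supPow α N (fun k => c (k + 1)) (t + 1) n ω) := by
  refine le_antisymm (iSup₂_le fun k hk => ?_) (max_le ?_ (iSup₂_le fun k hk => ?_))
  · rcases k with _ | k
    · simp
    · refine le_max_of_le_right (le_iSup₂_of_le k (by simpa using hk) ?_)
      dsimp only
      rw [show t + ((k + 1 : ℕ) : ℤ) = t + 1 + k by push_cast; ring]
  · exact le_iSup₂_of_le 0 (by simp) (by simp)
  · refine le_iSup₂_of_le (k + 1) (by simpa using hk) ?_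
    rw [show t + ((k + 1 : ℕ) : ℤ) = t + 1 + k by push_cast; ring]

lemma prod_below_eq (hα : 0 < α) {s : ℝ} (hs : 0 < s) (t : ℤ) (n : ℕ) (ω : Ω) :
    ∏ k ∈ Finset.range n, below (c k) (radius α s * N (t + k) ω) =
      {s : ℝ | supPow α N c t n ω ≤ ENNReal.ofReal s}.indicator 1 s := by
  have hiff : ∀ k : ℕ, c k * (radius α s * N (t + k) ω) ≤ 1 ↔
      posPow α (c k * N (t + k) ω) ≤ ENNReal.ofReal s := by
    intro k
    rw [← not_lt, ← not_lt, ← one_lt_radius_mul_iff hα hs, mul_left_comm]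
  by_cases h : supPow α N c t n ω ≤ ENNReal.ofReal s
  · rw [Set.indicator_of_mem (by exact h)]
    refine Finset.prod_eq_one fun k hk => below_of_le ((hiff k).2 ?_)
    exact (le_iSup₂_of_le k hk le_rfl).trans h
  · rw [Set.indicator_of_notMem (by exact h)]
    have : ∃ k ∈ Finset.range n, ¬ posPow α (c k * N (t + k) ω) ≤ ENNReal.ofReal s := by
      by_contra! hcon
      exact h (iSup₂_le hcon)
    obtain ⟨k, hk, hk'⟩ := this
    exact Finset.prod_eq_zero hk (below_of_lt (not_le.1 fun h' => hk' ((hiff k).1 h')))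

lemma sum_firstExc_add_prod (u : ℕ → ℝ) (n : ℕ) :
    ∑ j ∈ Finset.range n, (∏ k ∈ Finset.range j, below (c k) (u k)) * above (c j) (u j) +
      ∏ k ∈ Finset.range n, below (c k) (u k) = 1 := by
  induction n with
  | zero => simp
  | succ n ih =>
    rw [Finset.sum_range_succ, Finset.prod_range_succ, add_assoc, ← mul_add, add_comm (above _ _),
      below_add_above, mul_one, ih]

/-- The supremum exceeds s exactly when there is a first exceedance. Each term ends in an `above`
indicator and so vanishes on a path absorbed at 0, as detailed balance requires. The trivial second
condition matches `volume_ofReal_lt` with b = 0. -/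
lemma sum_firstExc_eq (hα : 0 < α) {s : ℝ} (hs : 0 < s) (t : ℤ) (n : ℕ) (ω : Ω) :
    ∑ j ∈ Finset.range n,
        pathProd (fun t ω => radius α s * N t ω) (belowList j c) (above (c j)) t ω =
      {s : ℝ | ENNReal.ofReal s < supPow α N c t n ω ∧ 0 ≤ ENNReal.ofReal s}.indicator 1 s := by
  have h1 := sum_firstExc_add_prod (c := c) (fun k => radius α s * N (t + k) ω) n
  rw [prod_below_eq hα hs] at h1
  simp only [belowList, pathProd_map_range]
  by_cases h : supPow α N c t n ω ≤ ENNReal.ofReal s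
  · rw [Set.indicator_of_mem (by exact h), Pi.one_apply] at h1
    rw [Set.indicator_of_notMem (by simpa using h)]
    simpa using ENNReal.add_right_inj ENNReal.one_ne_top |>.1
      ((add_comm _ _).trans (h1.trans (add_zero 1).symm))
  · rw [Set.indicator_of_notMem (by exact h), add_zero] at h1
    rw [Set.indicator_of_mem (by simpa using h), h1, Pi.one_apply]

variable [MeasurableSpace Ω] {Q : Measure Ω} {p : ℝ} {μ μ' : Measure (ℝ × ℝ)}

lemma measurable_supPow (hN : ∀ t, Measurable (N t)) (t : ℤ) (n : ℕ) :
    Measurable (supPow α N c t n) := by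
  unfold supPow
  refine Measurable.iSup fun k => Measurable.iSup fun _ => ?_
  have := hN (t + k)
  fun_prop

/-- For a fixed path the admissible s fill the interval from the later maximum up to the power at
time 0. -/
lemma lastExc_eq_lintegral (hα : 0 < α) [SFinite Q] (hN : ∀ t, Measurable (N t)) (n : ℕ)
    (y : ℕ → ℝ) :
    lastExc Q α N n y =
      ∫⁻ ω, (posPow α (y 0 * N 0 ω) - supPow α N (fun k => y (k + 1)) 1 n ω) ∂Q := by
  unfold lastExc pathInt
  rw [lintegral_lintegral_swap]
  swap
  · exact (measurable_pathProd_radius hN measurable_of_mem_above_belowList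
      measurable_one 0).aemeasurable
  refine lintegral_congr fun ω => ?_
  rw [← volume_ofReal_lt _ _ (posPow_ne_top _ _)]
  refine setLIntegral_congr_fun measurableSet_Ioi fun s hs => ?_
  simp only [pathProd, belowList, pathProd_map_range, Pi.one_apply, mul_one, zero_add]
  rw [prod_below_eq hα hs]
  have hiff : 1 < y 0 * (radius α s * N 0 ω) ↔ ENNReal.ofReal s < posPow α (y 0 * N 0 ω) := by
    rw [← one_lt_radius_mul_iff hα hs, mul_left_comm]
  by_cases h1 : 1 < y 0 * (radius α s * N 0 ω)
  · simp [above_of_lt h1, Set.indicator, ← hiff, h1]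
  · simp [above_of_le (not_lt.1 h1), Set.indicator, ← hiff, h1]

lemma lintegral_supPow_succ (hα : 0 < α) [SFinite Q] (hN : ∀ t, Measurable (N t)) (n : ℕ)
    (y : ℕ → ℝ) :
    ∫⁻ ω, supPow α N y 0 (n + 1) ω ∂Q =
      lastExc Q α N n y + ∫⁻ ω, supPow α N (fun k => y (k + 1)) 1 n ω ∂Q := by
  have h0 := hN 0
  rw [lastExc_eq_lintegral hα hN, ← lintegral_add_right _ (measurable_supPow hN 1 n)]
  refine lintegral_congr fun ω => ?_
  rw [supPow_succ, tsub_add_eq_max, zero_add]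

lemma lintegral_mul_supPow (hα : 0 < α) [SFinite Q] (hN : ∀ t, Measurable (N t)) (t : ℤ) (n : ℕ)
    {w : Ω → ℝ≥0∞} (hw : Measurable w) :
    ∫⁻ ω, w ω * supPow α N c t n ω ∂Q =
      ∑ j ∈ Finset.range n, ∫⁻ s in Set.Ioi (0 : ℝ), ∫⁻ ω, w ω *
        pathProd (fun t ω => radius α s * N t ω) (belowList j c) (above (c j)) t ω ∂Q := by
  have hm : ∀ j, Measurable fun q : ℝ × Ω => w q.2 *
      pathProd (fun t ω => radius α q.1 * N t ω) (belowList j c) (above (c j)) t q.2 := fun j =>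
    (hw.comp measurable_snd).mul
      (measurable_pathProd_radius hN measurable_of_mem_belowList (measurable_above _) t)
  rw [← lintegral_finsetSum _ fun j _ => (hm j).lintegral_prod_right']
  have h1 : ∀ s : ℝ, ∑ j ∈ Finset.range n, ∫⁻ ω, w ω *
        pathProd (fun t ω => radius α s * N t ω) (belowList j c) (above (c j)) t ω ∂Q =
      ∫⁻ ω, ∑ j ∈ Finset.range n, w ω *
        pathProd (fun t ω => radius α s * N t ω) (belowList j c) (above (c j)) t ω ∂Q := fun s =>
    (lintegral_finsetSum _ fun j _ => (hm j).comp measurable_prodMk_left).symm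
  simp_rw [h1]
  rw [lintegral_lintegral_swap (Finset.measurable_fun_sum _ fun j _ => hm j).aemeasurable]
  refine lintegral_congr fun ω => ?_
  rw [← tsub_zero (supPow α N c t n ω), ← volume_ofReal_lt _ _ (supPow_ne_top _ _ _),
    ← lintegral_const_mul]
  · refine setLIntegral_congr_fun measurableSet_Ioi fun s hs => ?_
    simp only [← Finset.mul_sum]
    rw [sum_firstExc_eq hα hs]
  · exact measurable_one.indicator (by measurability)

/-- A shift of time by one step. After the first-exceedance decomposition each term is a function V
of the starting state, with V 0 = 0; the adjoint relation turns V(M_1) into V(M_0) on the event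
M_{-1} ≠ 0. -/
lemma IsTwoSided.lintegral_supPow_one [SFinite Q] (hN : IsTwoSided Q p α μ μ' N) (n : ℕ) :
    ∫⁻ ω, supPow α N c 1 n ω ∂Q = ∫⁻ ω in {ω | N (-1) ω ≠ 0}, supPow α N c 0 n ω ∂Q := by
  have hα := hN.index_pos
  have hmeas := hN.markov.measurable
  have hset : MeasurableSet {ω | N (-1) ω ≠ 0} :=
    (measurableSet_eq_fun (hmeas (-1)) measurable_const).compl
  have := hN.adjoint.mem_left.isProb
  have := hN.adjoint.mem_right.isProb
  have hne : Measurable ({x : ℝ | x ≠ 0}.indicator (1 : ℝ → ℝ≥0∞)) :=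
    measurable_one.indicator (measurableSet_singleton 0).compl
  have hR : ∀ n ω, {ω | N (-1) ω ≠ 0}.indicator (supPow α N c 0 n) ω =
      {x : ℝ | x ≠ 0}.indicator (1 : ℝ → ℝ≥0∞) (N (-1) ω) * supPow α N c 0 n ω := by
    intro n ω
    by_cases h : N (-1) ω = 0 <;> simp [Set.indicator, h]
  rw [← lintegral_indicator hset]
  simp_rw [hR]
  rw [lintegral_mul_supPow hα hmeas 0 n
    (w := fun ω => {x : ℝ | x ≠ 0}.indicator (1 : ℝ → ℝ≥0∞) (N (-1) ω)) (hne.comp (hmeas (-1)))]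
  have h1 := lintegral_mul_supPow (c := c) (Q := Q) hα hmeas 1 n (w := fun _ => 1) measurable_const
  simp only [one_mul] at h1
  rw [h1]
  refine Finset.sum_congr rfl fun j _ => ?_
  have hL : ∀ f ∈ belowList j c, Measurable f := measurable_of_mem_belowList
  have hg := measurable_above (c j)
  set V := pathOp μ (belowList j c) (above (c j)) with hV
  have hVm : Measurable V := measurable_pathOp μ hL hg
  have hV0 : V 0 = 0 := pathOp_zero μ hL hg (above_zero _)
  have hscale : ∀ r : ℝ, 0 < r → ∀ x : ℝ, {x : ℝ | x ≠ 0}.indicator (1 : ℝ → ℝ≥0∞) (r * x) =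
      {x : ℝ | x ≠ 0}.indicator (1 : ℝ → ℝ≥0∞) x := by
    intro r hr x
    simp [Set.indicator, hr.ne']
  -- The indicator of a nonzero first coordinate can be inserted at no cost, since M_0 = ±1 almost
  -- surely. It makes the integrand vanish on both axes, and after the swap it falls on M_{-1}.
  calc _ = ∫⁻ s in Set.Ioi (0 : ℝ), ∫⁻ z, {x : ℝ | x ≠ 0}.indicator 1 (radius α s * z.1) *
          V (radius α s * z.2) ∂μ := by
        refine setLIntegral_congr_fun measurableSet_Ioi fun s hs => ?_
        have hr := radius_pos α hs
        have h2 := (hN.markov.scale hr).path hL hg zero_le_one (w := fun _ => 1) measurable_const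
        simp only [one_mul] at h2
        simp only [h2]
        rw [hN.lintegral_forward (F := fun z => V (radius α s * z.2)) (by fun_prop)]
        refine lintegral_congr_ae ?_
        filter_upwards [hN.adjoint.mem_left.ae_fst] with z hz
        rw [hscale _ hr]
        have hz0 : z.1 ≠ 0 := by rcases hz with hz | hz <;> rw [hz] <;> norm_num
        simp [Set.indicator, hz0]
    _ = ∫⁻ z, {x : ℝ | x ≠ 0}.indicator 1 z.1 * V z.2 ∂radial α μ :=
        (lintegral_radial α μ (F := fun z => {x : ℝ | x ≠ 0}.indicator 1 z.1 * V z.2)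
          (by fun_prop)).symm
    _ = ∫⁻ z, {x : ℝ | x ≠ 0}.indicator 1 z.2 * V z.1 ∂radial α μ' := by
        rw [hN.adjoint.lintegral_radial_swap hα (by fun_prop)]
        · simp
        · rintro z (hz | hz) <;> simp [hz, hV0]
    _ = _ := by
        rw [lintegral_radial α μ' (F := fun z => {x : ℝ | x ≠ 0}.indicator 1 z.2 * V z.1)
          (by fun_prop)]
        refine setLIntegral_congr_fun measurableSet_Ioi fun s hs => ?_
        have hr := radius_pos α hs
        have h2 := (hN.markov.scale hr).path hL hg le_rfl
          (w := fun h => {x : ℝ | x ≠ 0}.indicator 1 (h ⟨-1, by norm_num⟩)) (by fun_prop)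
        simp only [hscale _ hr] at h2 ⊢
        simp only [h2]
        exact (hN.lintegral_backward (F := fun z => {x : ℝ | x ≠ 0}.indicator 1 z.2 *
          V (radius α s * z.1)) (by fun_prop)).symm

lemma IsTwoSided.lintegral_supPow_eq [SFinite Q] (hN : IsTwoSided Q p α μ μ' N) (n : ℕ) :
    ∫⁻ ω, supPow α N c 0 n ω ∂Q =
      ∫⁻ ω in {ω | N (-1) ω = 0}, supPow α N c 0 n ω ∂Q + ∫⁻ ω, supPow α N c 1 n ω ∂Q := by
  have hset : MeasurableSet {ω | N (-1) ω = 0} :=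
    measurableSet_eq_fun (hN.markov.measurable (-1)) measurable_const
  rw [hN.lintegral_supPow_one, ← lintegral_add_compl _ hset]
  rfl

lemma IsTwoSided.lastExc_zero [SFinite Q] (hN : IsTwoSided Q p α μ μ' N) (y : ℕ → ℝ) :
    lastExc Q α N 0 y = ∫⁻ σ, posPow α (y 0 * σ) ∂signLaw p := by
  have h1 := lintegral_supPow_succ hN.index_pos (Q := Q) hN.markov.measurable 0 y
  have h2 : ∀ ω, supPow α N y 0 1 ω = posPow α (y 0 * N 0 ω) := fun ω => by simp [supPow]
  have h3 : ∀ ω, supPow α N (fun k => y (k + 1)) 1 0 ω = 0 := fun ω => by simp [supPow]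
  simp only [zero_add, h2, h3, lintegral_const, zero_mul, add_zero] at h1
  rw [← h1, hN.lintegral_zero (f := fun x => posPow α (y 0 * x)) (by fun_prop)]

/-- Induction on t, removing the earliest time: the maximum splits into a last-exceedance mass and
the maximum from time 1 on. Shifting the latter back to time 0 costs the part on M_{-1} = 0, which
is the new term of the second sum. -/
lemma IsTwoSided.lintegral_supPow_add_sum [SFinite Q] (hN : IsTwoSided Q p α μ μ' N) (t : ℕ)
    (y : ℕ → ℝ) :
    ∫⁻ ω, supPow α N y 0 (t + 1) ω ∂Q + ∑ i ∈ Finset.range t,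
        ∫⁻ ω in {ω | N (-1) ω = 0}, supPow α N (fun k => y (i + 1 + k)) 0 (t - i) ω ∂Q =
      ∑ i ∈ Finset.range (t + 1), lastExc Q α N (t - i) (fun k => y (i + k)) := by
  induction t generalizing y with
  | zero =>
    simp only [zero_add, Finset.range_zero, Finset.sum_empty, add_zero, Finset.range_one,
      Finset.sum_singleton, Nat.sub_zero]
    rw [← zero_add 1, lintegral_supPow_succ hN.index_pos hN.markov.measurable]
    simp [supPow]
  | succ t ih =>
    rw [Finset.sum_range_succ', Finset.sum_range_succ' _ (t + 1),
      lintegral_supPow_succ hN.index_pos hN.markov.measurable]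
    have h1 := ih (fun k => y (k + 1))
    have h2 := hN.lintegral_supPow_eq (c := fun k => y (k + 1)) (t + 1)
    rw [h2] at h1
    simp only [zero_add, Nat.sub_zero, Nat.add_sub_add_right]
    have e1 : ∀ i k : ℕ, y (i + 1 + k + 1) = y (i + 1 + 1 + k) := fun i k => by
      congr 1; omega
    have e2 : ∀ i k : ℕ, y (i + k + 1) = y (i + 1 + k) := fun i k => by congr 1; omega
    have e3 : ∀ k : ℕ, y (1 + k) = y (k + 1) := fun k => by rw [add_comm]
    simp only [e1, e2] at h1
    simp only [e3]
    rw [← h1]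
    ring

/-- The masses decrease in n, and the one for n = 0 is a moment of a random sign. -/
lemma IsTwoSided.lastExc_ne_top [IsProbabilityMeasure Q] (hN : IsTwoSided Q p α μ μ' N) (n : ℕ)
    (y : ℕ → ℝ) : lastExc Q α N n y ≠ ∞ := by
  have := hN.adjoint.mem_left.isProb
  have h0 : lastExc Q α N 0 y ≠ ∞ := by
    rw [hN.lastExc_zero, lintegral_signLaw _ (by fun_prop)]
    exact ENNReal.add_ne_top.2 ⟨ENNReal.mul_ne_top ENNReal.ofReal_ne_top (posPow_ne_top _ _),
      ENNReal.mul_ne_top ENNReal.ofReal_ne_top (posPow_ne_top _ _)⟩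
  induction n with
  | zero => exact h0
  | succ n ih =>
    exact ne_top_of_le_ne_top ih
      (le_self_add.trans (lastExc_succ (α := α) (Q := Q) hN.markov.measurable n y).le)

lemma lastExc_congr {n : ℕ} {y y' : ℕ → ℝ} (h : ∀ k ≤ n, y k = y' k) :
    lastExc Q α N n y = lastExc Q α N n y' := by
  unfold lastExc belowList
  rw [h 0 n.zero_le]
  congr 2
  refine List.map_congr_left fun k hk => ?_
  dsimp only
  rw [h (k + 1) (by have := List.mem_range.1 hk; omega)]

lemma lastExc_add_sum_returnExc [SFinite Q] (hN : ∀ t, Measurable (N t)) (n : ℕ) (y : ℕ → ℝ) :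
    lastExc Q α N n y + ∑ i ∈ Finset.range n, returnExc Q α N i y = lastExc Q α N 0 y := by
  induction n with
  | zero => simp
  | succ n ih =>
    rw [Finset.sum_range_succ, ← ih, ← lastExc_succ hN n]
    ring

/-- Counting by last exceedance equals counting by first exceedance. In the induction the longest
forward mass is the unrestricted mass minus all return masses; reversed, each return mass is exactly
what shortens a mass of the backward chain by one step. In y (i - k) only k ≤ i matters, so
truncated subtraction is harmless. -/
lemma IsTwoSided.sum_lastExc_eq [IsProbabilityMeasure Q] (hN : IsTwoSided Q p α μ μ' N)
    {Ω' : Type*} [MeasurableSpace Ω'] {Q' : Measure Ω'} [IsProbabilityMeasure Q']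
    {N' : ℤ → Ω' → ℝ} (hN' : IsTwoSided Q' p α μ' μ N') (t : ℕ) (y : ℕ → ℝ) :
    ∑ i ∈ Finset.range (t + 1), lastExc Q α N (t - i) (fun k => y (i + k)) =
      ∑ i ∈ Finset.range (t + 1), lastExc Q' α N' i (fun k => y (i - k)) := by
  have h00 : ∀ y, lastExc Q α N 0 y = lastExc Q' α N' 0 y := by
    intro y
    rw [hN.lastExc_zero, hN'.lastExc_zero]
  induction t generalizing y with
  | zero =>
    simp only [zero_add, Finset.range_one, Finset.sum_singleton, Nat.sub_zero]
    rw [h00]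
    exact lastExc_congr fun k hk => by simp [Nat.le_zero.1 hk]
  | succ t ih =>
    -- The return masses are added to both sides and cancelled at the end, which needs their
    -- finiteness.
    have hsum : ∑ i ∈ Finset.range (t + 1), returnExc Q α N i y ≠ ∞ := by
      refine ne_top_of_le_ne_top (hN.lastExc_ne_top 0 y) ?_
      rw [← lastExc_add_sum_returnExc hN.markov.measurable (t + 1) y]
      exact le_add_self
    rw [← ENNReal.add_left_inj hsum, Finset.sum_range_succ', Finset.sum_range_succ' _ (t + 1)]
    have h1 := ih (fun k => y (k + 1))
    have h2 := lastExc_add_sum_returnExc (α := α) (Q := Q) hN.markov.measurable (t + 1) y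
    simp only [zero_add, Nat.sub_zero, Nat.add_sub_add_right]
    have e2 : ∀ i k : ℕ, y (i + k + 1) = y (i + 1 + k) := fun i k => by congr 1; omega
    simp only [e2] at h1
    rw [h1, add_assoc, h2, add_right_comm, ← Finset.sum_add_distrib]
    congr 1
    · refine Finset.sum_congr rfl fun i _ => ?_
      rw [hN.returnExc_eq hN', lastExc_succ hN'.markov.measurable]
      exact lastExc_congr fun k hk => by congr 1; omega
    · rw [h00]
      exact lastExc_congr fun k hk => by congr 1; omega

end

section

/-! ### Back-and-forth tail chains -/

lemma lintegral_mul_condDistrib {Ω A : Type*} [MeasurableSpace Ω] [MeasurableSpace A]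
    {Q : Measure Ω} [IsFiniteMeasure Q] {H : Ω → A} {Y : Ω → ℝ} (hH : Measurable H)
    (hY : Measurable Y) {κ : A → Measure ℝ}
    (h : ∀ᵐ a ∂(Q.map H), condDistrib Y H Q a = κ a) {w : A → ℝ≥0∞} {f : ℝ → ℝ≥0∞}
    (hw : Measurable w) (hf : Measurable f) :
    ∫⁻ ω, w (H ω) * f (Y ω) ∂Q = ∫⁻ a, w a * ∫⁻ y, f y ∂κ a ∂(Q.map H) := by
  have h1 : ∫⁻ ω, w (H ω) * f (Y ω) ∂Q =
      ∫⁻ z, w z.1 * f z.2 ∂(Q.map fun ω => (H ω, Y ω)) := by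
    rw [lintegral_map (by fun_prop) (by fun_prop)]
  rw [h1, ← compProd_map_condDistrib hY.aemeasurable, Measure.lintegral_compProd (by fun_prop)]
  refine lintegral_congr_ae ?_
  filter_upwards [h] with a ha
  rw [lintegral_const_mul _ hf, ha]

section

variable {Ω : Type*} [MeasurableSpace Ω] {Q : Measure Ω} [IsProbabilityMeasure Q] {p α : ℝ}
  {μ : Measure (ℝ × ℝ)} {M : ℤ → Ω → ℝ}

lemma IsBFTC.isTwoSided (hα : 0 < α) (hM : IsBFTC Q p α μ M) :
    IsTwoSided Q p α μ (Q.map (fun ω => (M 0 ω, M (-1) ω))) M where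
  index_pos := hα
  markov :=
    { measurable := hM.measurable
      step := by
        intro t ht w h hw hh
        have hmeas := hM.measurable
        have hH : Measurable fun ω (s : {s : ℤ // s < t}) => M s ω := by fun_prop
        rw [lintegral_mul_condDistrib hH (hmeas t) (hM.step_forward t ht) hw hh]
        have := measurable_stepOp μ hh
        exact lintegral_map (f := fun x => w x * stepOp μ h (x ⟨t - 1, by omega⟩))
          (by fun_prop) hH }
  law_forward := hM.law_forward
  law_backward := rfl
  adjoint := hM.law_backward

/-- Reversing time exchanges the forward law and its adjoint, so everything proved for two-sided
processes also holds backward. -/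
lemma IsBFTC.isTwoSided_neg (hα : 0 < α) (hM : IsBFTC Q p α μ M) :
    IsTwoSided Q p α (Q.map (fun ω => (M 0 ω, M (-1) ω))) μ (fun t => M (-t)) where
  index_pos := hα
  markov :=
    { measurable := fun t => hM.measurable (-t)
      step := by
        intro t ht w h hw hh
        have hmeas := hM.measurable
        have hH : Measurable fun ω (s : {s : ℤ // -t < s}) => M s ω := by fun_prop
        have h1 := lintegral_mul_condDistrib hH (hmeas (-t)) (hM.step_backward t ht)
          (w := fun x => w (fun s => x ⟨-s, by have := s.2; omega⟩)) (by fun_prop) hh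
        have h2 := measurable_stepOp (Q.map (fun ω => (M 0 ω, M (-1) ω))) hh
        rw [h1, show -(t - 1) = -t + 1 by ring]
        exact lintegral_map (f := fun x : {s : ℤ // -t < s} → ℝ =>
          w (fun s => x ⟨-s, by have := s.2; omega⟩) *
            stepOp (Q.map (fun ω => (M 0 ω, M (-1) ω))) h (x ⟨-t + 1, by omega⟩))
          (by fun_prop) hH }
  law_forward := rfl
  law_backward := by simpa using hM.law_forward
  adjoint := hM.law_backward.symm

lemma IsBFTC.sum_lastExc_eq_forward (hα : 0 < α) (hM : IsBFTC Q p α μ M) (t : ℕ) (x : ℕ → ℝ) :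
    ∑ i ∈ Finset.range (t + 1), lastExc Q α M (t - i) (fun k => x (i + k)) =
      ∫⁻ ω, (⨆ j ∈ Finset.range (t + 1), posPow α (x j * M j ω)) ∂Q +
        ∑ i ∈ Finset.Icc 1 t, ∫⁻ ω in {ω | M (-1) ω = 0},
          (⨆ j ∈ Finset.Icc i t, posPow α (x j * M ((j : ℤ) - i) ω)) ∂Q := by
  rw [← (hM.isTwoSided hα).lintegral_supPow_add_sum]
  congr 1
  · simp [supPow]
  · refine Finset.sum_bij (fun i _ => i + 1) ?_ ?_ ?_ ?_
    · intro i hi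
      simp only [Finset.mem_range, Finset.mem_Icc] at *
      omega
    · intro i _ j _ h
      omega
    · intro i hi
      simp only [Finset.mem_range, Finset.mem_Icc] at *
      exact ⟨i - 1, by omega, by omega⟩
    · intro i hi
      have hi' := Finset.mem_range.1 hi
      refine lintegral_congr fun ω => le_antisymm (iSup₂_le fun k hk => ?_)
        (iSup₂_le fun j hj => ?_)
      · simp only [Finset.mem_range] at hk
        refine le_iSup₂_of_le (i + 1 + k) (by simp only [Finset.mem_Icc]; omega) ?_
        dsimp only
        rw [show (((i + 1 + k : ℕ) : ℤ) - ((i + 1 : ℕ) : ℤ)) = 0 + k by push_cast; ring]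
      · simp only [Finset.mem_Icc] at hj
        refine le_iSup₂_of_le (j - (i + 1)) (by simp only [Finset.mem_range]; omega) ?_
        dsimp only
        rw [show i + 1 + (j - (i + 1)) = j by omega,
          show (0 + ((j - (i + 1) : ℕ) : ℤ)) = (j : ℤ) - ((i + 1 : ℕ) : ℤ) by omega]

/-- The forward identity for the reversed chain and the reversed weights, joined to the original sum
by `IsTwoSided.sum_lastExc_eq`. State -1 of the reversed chain is M_1. -/
lemma IsBFTC.sum_lastExc_eq_backward (hα : 0 < α) (hM : IsBFTC Q p α μ M) (t : ℕ) (x : ℕ → ℝ) :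
    ∑ i ∈ Finset.range (t + 1), lastExc Q α M (t - i) (fun k => x (i + k)) =
      ∫⁻ ω, (⨆ j ∈ Finset.range (t + 1), posPow α (x j * M ((j : ℤ) - t) ω)) ∂Q +
        ∑ i ∈ Finset.range t, ∫⁻ ω in {ω | M 1 ω = 0},
          (⨆ j ∈ Finset.range (i + 1), posPow α (x j * M ((j : ℤ) - i) ω)) ∂Q := by
  have hN := hM.isTwoSided_neg hα
  have hsup : ∀ n, n ≤ t → ∀ ω, supPow α (fun t => M (-t))
      (fun k => x (t - (t - n + k))) 0 (n + 1) ω =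
      ⨆ j ∈ Finset.range (n + 1), posPow α (x j * M ((j : ℤ) - n) ω) := by
    intro n hn ω
    refine le_antisymm (iSup₂_le fun k hk => ?_) (iSup₂_le fun j hj => ?_)
    · simp only [Finset.mem_range] at hk
      refine le_iSup₂_of_le (n - k) (by simp only [Finset.mem_range]; omega) ?_
      dsimp only
      rw [show t - (t - n + k) = n - k by omega,
        show (-(0 + k : ℤ)) = ((n - k : ℕ) : ℤ) - n by omega]
    · simp only [Finset.mem_range] at hj
      refine le_iSup₂_of_le (n - j) (by simp only [Finset.mem_range]; omega) ?_
      dsimp only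
      rw [show t - (t - n + (n - j)) = j by omega,
        show (-(0 + (n - j : ℕ) : ℤ)) = (j : ℤ) - n by omega]
  rw [(hM.isTwoSided hα).sum_lastExc_eq hN t x]
  have h1 := hN.lintegral_supPow_add_sum t (fun k => x (t - k))
  have h2 : ∑ i ∈ Finset.range (t + 1), lastExc Q α (fun t => M (-t)) i (fun k => x (i - k)) =
      ∑ i ∈ Finset.range (t + 1), lastExc Q α (fun t => M (-t)) (t - i)
        (fun k => x (t - (i + k))) := by
    rw [← Finset.sum_range_reflect]
    refine Finset.sum_congr rfl fun i hi => ?_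
    simp only [Finset.mem_range] at hi
    rw [show t + 1 - 1 - i = t - i by omega]
    simp only [Nat.sub_sub]
  rw [h2, ← h1]
  congr 1
  · refine lintegral_congr fun ω => ?_
    rw [← hsup t le_rfl]
    simp
  · rw [← Finset.sum_range_reflect]
    refine Finset.sum_congr rfl fun i hi => ?_
    simp only [Finset.mem_range] at hi
    simp only [neg_neg]
    refine lintegral_congr fun ω => ?_
    rw [← hsup i hi.le]
    simp only [show t - (t - 1 - i) = i + 1 by omega, show t - 1 - i + 1 = t - i by omega]

end

end

section

/-! ### Existence of the adjoint law -/

lemma posPow_zero {α : ℝ} (hα : 0 < α) : posPow α 0 = 0 := by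
  simp [posPow, Real.zero_rpow hα.ne']

lemma posPow_one (α : ℝ) : posPow α 1 = 1 := by simp [posPow]

lemma posPow_of_nonpos {α u : ℝ} (hα : 0 < α) (hu : u ≤ 0) : posPow α u = 0 := by
  simp [posPow, max_eq_right hu, Real.zero_rpow hα.ne']

lemma posPow_eq_zero_iff {α u : ℝ} (hα : 0 < α) : posPow α u = 0 ↔ u ≤ 0 := by
  refine ⟨fun h => ?_, posPow_of_nonpos hα⟩
  by_contra! hu
  rw [posPow, max_eq_left hu.le, ENNReal.ofReal_eq_zero] at h
  exact absurd (Real.rpow_pos_of_pos hu α) h.not_gt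

lemma posPow_abs_mul {α a : ℝ} (ha : a ≠ 0) (u : ℝ) :
    posPow α |a| * posPow α (u / |a|) = posPow α u := by
  have h : posPow α |a| = ENNReal.ofReal (|a| ^ α) := by rw [posPow, max_eq_left (abs_nonneg a)]
  rw [h, ← posPow_mul (abs_nonneg a), mul_div_cancel₀ _ (abs_ne_zero.2 ha)]

@[fun_prop]
lemma measurable_sign : Measurable Real.sign := by
  unfold Real.sign
  exact Measurable.ite measurableSet_Iio measurable_const
    (Measurable.ite measurableSet_Ioi measurable_const measurable_const)

/-- The mass that the adjoint law puts on `(σ, 0)`. -/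
def adjointAtom (p α : ℝ) (μ : Measure (ℝ × ℝ)) (σ : ℝ) : ℝ≥0∞ :=
  ENNReal.ofReal (signProb p σ) - ∫⁻ z, posPow α (σ * z.2) ∂μ

/-- The adjoint law: the law of `(sign M, I / |M|)` weighted by `|M| ^ α`, and atoms
at `(1, 0)` and `(-1, 0)`. -/
def adjointLaw (p α : ℝ) (μ : Measure (ℝ × ℝ)) : Measure (ℝ × ℝ) :=
  (μ.withDensity (fun z => posPow α |z.2|)).map (fun z => (Real.sign z.2, z.1 / |z.2|)) +
    (adjointAtom p α μ 1 • Measure.dirac ((1 : ℝ), (0 : ℝ)) +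
      adjointAtom p α μ (-1) • Measure.dirac ((-1 : ℝ), (0 : ℝ)))

lemma lintegral_adjointLaw (p α : ℝ) (μ : Measure (ℝ × ℝ)) {F : ℝ × ℝ → ℝ≥0∞}
    (hF : Measurable F) :
    ∫⁻ z, F z ∂adjointLaw p α μ =
      ∫⁻ z, posPow α |z.2| * F (Real.sign z.2, z.1 / |z.2|) ∂μ +
        (adjointAtom p α μ 1 * F (1, 0) + adjointAtom p α μ (-1) * F (-1, 0)) := by
  have h1 : Measurable fun z : ℝ × ℝ => posPow α |z.2| := by fun_prop
  have h2 : Measurable fun z : ℝ × ℝ => F (Real.sign z.2, z.1 / |z.2|) := by fun_prop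
  simp only [adjointLaw, lintegral_add_measure, lintegral_smul_measure, smul_eq_mul,
    lintegral_dirac' _ hF]
  rw [lintegral_map hF (by fun_prop), lintegral_withDensity_eq_lintegral_mul _ h1 h2]
  rfl

lemma MemClass.measure_fst {p α : ℝ} {μ : Measure (ℝ × ℝ)} (hμ : MemClass p α μ) {σ : ℝ}
    (hσ : σ = 1 ∨ σ = -1) : μ {z | z.1 = σ} = ENNReal.ofReal (signProb p σ) := by
  rcases hσ with rfl | rfl
  · simpa [signProb] using hμ.prob_one
  · simpa [signProb, show ¬ ((-1 : ℝ) = 1) by norm_num] using hμ.prob_neg_one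

lemma adjointLaw_fst {p α : ℝ} (hα : 0 < α) {μ : Measure (ℝ × ℝ)} (hμ : MemClass p α μ) {σ : ℝ}
    (hσ : σ = 1 ∨ σ = -1) :
    adjointLaw p α μ {z | z.1 = σ} = ENNReal.ofReal (signProb p σ) := by
  have hm : MeasurableSet {z : ℝ × ℝ | z.1 = σ} :=
    measurableSet_eq_fun measurable_fst measurable_const
  have hpt : ∀ z : ℝ × ℝ, posPow α |z.2| *
      {z : ℝ × ℝ | z.1 = σ}.indicator 1 (Real.sign z.2, z.1 / |z.2|) = posPow α (σ * z.2) := by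
    intro z
    rcases lt_trichotomy z.2 0 with h | h | h
    · rcases hσ with rfl | rfl
      · rw [posPow_of_nonpos hα (show 1 * z.2 ≤ 0 by linarith)]
        simp [Set.indicator, Real.sign_of_neg h, show ¬ ((-1 : ℝ) = 1) by norm_num]
      · simp [Set.indicator, Real.sign_of_neg h, abs_of_neg h]
    · simp [h, posPow_zero hα]
    · rcases hσ with rfl | rfl
      · simp [Set.indicator, Real.sign_of_pos h, abs_of_pos h]
      · rw [posPow_of_nonpos hα (show -1 * z.2 ≤ 0 by linarith)]
        simp [Set.indicator, Real.sign_of_pos h, show ¬ ((1 : ℝ) = -1) by norm_num]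
  rw [← lintegral_indicator_one hm, lintegral_adjointLaw p α μ (measurable_one.indicator hm),
    lintegral_congr hpt]
  have hle : ∫⁻ z, posPow α (σ * z.2) ∂μ ≤ ENNReal.ofReal (signProb p σ) :=
    (hμ.moment σ hσ).trans (hμ.measure_fst hσ).le
  have : adjointAtom p α μ 1 * {z : ℝ × ℝ | z.1 = σ}.indicator 1 (1, 0) +
      adjointAtom p α μ (-1) * {z : ℝ × ℝ | z.1 = σ}.indicator 1 (-1, 0) =
        adjointAtom p α μ σ := by
    rcases hσ with rfl | rfl
    · simp [Set.indicator, show ¬ ((-1 : ℝ) = 1) by norm_num]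
    · simp [Set.indicator, show ¬ ((1 : ℝ) = -1) by norm_num]
  rw [this, adjointAtom, add_tsub_cancel_of_le hle]

/-- The density |M|^α cancels the division by |M| inside each power, by homogeneity, which gives the
identity on M ≠ 0. The atoms fill up each sign probability; their masses are genuine differences
because of the moment bound. -/
lemma isAdjoint_adjointLaw {p α : ℝ} (hα : 0 < α) (hp0 : 0 ≤ p) (hp1 : p ≤ 1)
    {μ : Measure (ℝ × ℝ)} (hμ : MemClass p α μ) : IsAdjoint p α μ (adjointLaw p α μ) where
  mem_left := hμ
  mem_right :=
    { isProb := by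
        have hm : ∀ σ : ℝ, MeasurableSet {z : ℝ × ℝ | z.1 = σ} := fun σ =>
          measurableSet_eq_fun measurable_fst measurable_const
        have hpt : ∀ z : ℝ × ℝ, posPow α |z.2| * 1 =
            posPow α (1 * z.2) + posPow α (-1 * z.2) := by
          intro z
          rcases le_total z.2 0 with h | h
          · rw [posPow_of_nonpos hα (show 1 * z.2 ≤ 0 by linarith), abs_of_nonpos h]
            simp
          · rw [posPow_of_nonpos hα (show -1 * z.2 ≤ 0 by linarith), abs_of_nonneg h]
            simp
        have hle : ∀ σ : ℝ, (σ = 1 ∨ σ = -1) →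
            ∫⁻ z, posPow α (σ * z.2) ∂μ ≤ ENNReal.ofReal (signProb p σ) := fun σ hσ =>
          (hμ.moment σ hσ).trans (hμ.measure_fst hσ).le
        constructor
        rw [← lintegral_one, lintegral_adjointLaw p α μ measurable_const, lintegral_congr hpt,
          lintegral_add_left (by fun_prop), adjointAtom, adjointAtom, mul_one, mul_one,
          add_add_add_comm, add_tsub_cancel_of_le (hle 1 (Or.inl rfl)),
          add_tsub_cancel_of_le (hle (-1) (Or.inr rfl))]
        simp only [signProb, if_true, if_neg (show ¬ ((-1 : ℝ) = 1) by norm_num)]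
        rw [← ENNReal.ofReal_add hp0 (by linarith)]
        simp
      prob_one := by simpa [signProb] using adjointLaw_fst hα hμ (Or.inl rfl)
      prob_neg_one := by
        simpa [signProb, show ¬ ((-1 : ℝ) = 1) by norm_num] using
          adjointLaw_fst hα hμ (Or.inr rfl)
      moment := by
        intro σ hσ
        rw [adjointLaw_fst hα hμ hσ, ← hμ.measure_fst hσ,
          lintegral_adjointLaw p α μ (by fun_prop)]
        simp only [mul_zero, posPow_zero hα, add_zero]
        have hm : MeasurableSet {z : ℝ × ℝ | z.1 = σ} :=
          measurableSet_eq_fun measurable_fst measurable_const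
        rw [← lintegral_indicator_one hm]
        refine lintegral_mono_ae ?_
        filter_upwards [hμ.ae_fst] with z hz
        rcases eq_or_ne z.2 0 with h0 | h0
        · simp [h0, posPow_zero hα]
        -- After cancellation the integrand is (σ I)_+^α, the indicator of I = σ.
        · rw [← mul_div_assoc, posPow_abs_mul h0]
          have hn : ¬ ((-1 : ℝ) = 1) := by norm_num
          have hn' : ¬ ((1 : ℝ) = -1) := by norm_num
          rcases hσ with rfl | rfl <;> rcases hz with hz | hz <;>
            simp [Set.indicator, hz, hn, hn', posPow_one, posPow_of_nonpos hα] }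
  identity := by
    intro x y
    rw [lintegral_adjointLaw p α μ (by fun_prop)]
    simp only [mul_zero, posPow_zero hα, zero_min, add_zero]
    refine lintegral_congr fun z => ?_
    rcases eq_or_ne z.2 0 with h0 | h0
    · simp [h0, posPow_zero hα]
    · have h1 : y * Real.sign z.2 = y * z.2 / |z.2| := by
        rw [mul_div_assoc]
        congr 1
        rcases lt_or_gt_of_ne h0 with h | h
        · rw [Real.sign_of_neg h, abs_of_neg h, div_neg, div_self h0]
        · rw [Real.sign_of_pos h, abs_of_pos h, div_self h0]
      rw [h1, ← mul_div_assoc, mul_min, posPow_abs_mul h0, posPow_abs_mul h0]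

/-! ### Chains driven by independent noise -/

/-- One step from the state `m` with the multipliers `u.1` for positive and `u.2` for negative
states. -/
def stepFn (m : ℝ) (u : ℝ × ℝ) : ℝ := if 0 < m then m * u.1 else m * u.2

@[fun_prop]
lemma measurable_stepFn : Measurable (Function.uncurry stepFn) := by
  unfold stepFn Function.uncurry
  exact Measurable.ite (measurableSet_lt measurable_const (by fun_prop)) (by fun_prop)
    (by fun_prop)

lemma measurable_stepFn_comp {A : Type*} [MeasurableSpace A] {f : A → ℝ} {g : A → ℝ × ℝ}
    (hf : Measurable f) (hg : Measurable g) : Measurable fun a => stepFn (f a) (g a) :=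
  measurable_stepFn.comp (hf.prodMk hg)

/-- The states that a tail chain visits: `0` and those whose sign has positive probability. -/
def validStates (p : ℝ) : Set ℝ := {m | m ≠ 0 → 0 < signProb p (Real.sign m)}

lemma measurableSet_validStates (p : ℝ) : MeasurableSet (validStates p) := by
  have h1 : Measurable fun m : ℝ => signProb p (Real.sign m) := by
    have : Measurable (signProb p) := by
      unfold signProb
      exact Measurable.ite (measurableSet_singleton 1) measurable_const measurable_const
    fun_prop
  have : validStates p = {0} ∪ {m | 0 < signProb p (Real.sign m)} := by
    ext m
    simp only [validStates, Set.mem_ofPred_eq, Set.mem_union, Set.mem_singleton_iff]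
    tauto
  rw [this]
  exact (measurableSet_singleton 0).union (measurableSet_lt measurable_const h1)

/-- The multipliers with law `ν` drive a chain with the transitions of `tailStep μ`. -/
structure Drives (p : ℝ) (μ ν : Measure (ℝ × ℝ)) : Prop where
  isProb : IsProbabilityMeasure ν
  fst : 0 < p → ν.map Prod.fst = stepLaw μ 1
  snd : p < 1 → ν.map Prod.snd = stepLaw μ (-1)

lemma Drives.map_stepFn {p : ℝ} {μ ν : Measure (ℝ × ℝ)} (h : Drives p μ ν) {m : ℝ}
    (hm : m ∈ validStates p) : ν.map (stepFn m) = tailStep μ m := by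
  have := h.isProb
  rcases lt_trichotomy m 0 with hm0 | rfl | hm0
  · have hp : p < 1 := by
      have := hm hm0.ne
      rw [Real.sign_of_neg hm0, signProb, if_neg (by norm_num)] at this
      linarith
    rw [tailStep_of_ne_zero μ hm0.ne, Real.sign_of_neg hm0, ← h.snd hp,
      Measure.map_map (by fun_prop) (by fun_prop)]
    congr 1
    ext u
    simp [stepFn, hm0.not_gt]
  · have : stepFn 0 = fun _ => 0 := by ext u; simp [stepFn]
    rw [this, tailStep_zero, Measure.map_const, measure_univ, one_smul]
  · have hp : 0 < p := by
      have := hm hm0.ne'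
      rwa [Real.sign_of_pos hm0, signProb, if_pos rfl] at this
    rw [tailStep_of_ne_zero μ hm0.ne', Real.sign_of_pos hm0, ← h.fst hp,
      Measure.map_map (by fun_prop) (by fun_prop)]
    congr 1
    ext u
    simp [stepFn, hm0]

/-- If the opposite sign has probability zero, the moment bound forces (-σ M)_+ = 0, so a step
cannot change sign. -/
lemma MemClass.ae_stepLaw_nonneg {p α : ℝ} (hα : 0 < α) {μ : Measure (ℝ × ℝ)}
    (hμ : MemClass p α μ) {σ : ℝ} (hσ : σ = 1 ∨ σ = -1) (h : signProb p (-σ) ≤ 0) :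
    ∀ᵐ y ∂stepLaw μ σ, 0 ≤ y := by
  have hσ' : -σ = 1 ∨ -σ = -1 := by
    rcases hσ with rfl | rfl
    · exact Or.inr rfl
    · exact Or.inl (by norm_num)
  have h1 := (hμ.moment (-σ) hσ').trans (hμ.measure_fst hσ').le
  rw [ENNReal.ofReal_of_nonpos h, nonpos_iff_eq_zero, lintegral_eq_zero_iff (by fun_prop)] at h1
  have hm : MeasurableSet {z : ℝ × ℝ | z.1 = σ} :=
    measurableSet_eq_fun measurable_fst measurable_const
  unfold stepLaw
  rw [ae_map_iff (by fun_prop) measurableSet_Ici]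
  have h2 : ∀ᵐ z ∂μ[|{z : ℝ × ℝ | z.1 = σ}], z.1 = σ := ae_cond_mem hm
  have h3 : ∀ᵐ z ∂μ[|{z : ℝ × ℝ | z.1 = σ}], posPow α (-σ * z.2) = 0 :=
    cond_absolutelyContinuous.ae_le h1
  filter_upwards [h2, h3] with z hz hz'
  rw [posPow_eq_zero_iff hα] at hz'
  rw [hz]
  rcases hσ with rfl | rfl
  · simpa using hz'
  · have : z.2 ≤ 0 := by simpa using hz'
    rw [div_neg, div_one]
    linarith

/-- Nothing is known about the multiplier for a sign of probability zero; almost surely it is never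
used. -/
lemma Drives.ae_stepFn_mem {p α : ℝ} (hα : 0 < α) (hp0 : 0 ≤ p) (hp1 : p ≤ 1)
    {μ ν : Measure (ℝ × ℝ)} (hμ : MemClass p α μ) (h : Drives p μ ν) :
    ∀ᵐ u ∂ν, ∀ m ∈ validStates p, stepFn m u ∈ validStates p := by
  have hfst : p = 1 → ∀ᵐ u ∂ν, 0 ≤ u.1 := by
    intro hp
    have := hμ.ae_stepLaw_nonneg hα (σ := 1) (Or.inl rfl)
      (by simp [signProb, hp, show ¬ ((-1 : ℝ) = 1) by norm_num])
    rw [← h.fst (by linarith)] at this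
    exact ae_of_ae_map measurable_fst.aemeasurable this
  have hsnd : p = 0 → ∀ᵐ u ∂ν, 0 ≤ u.2 := by
    intro hp
    have := hμ.ae_stepLaw_nonneg hα (σ := -1) (Or.inr rfl) (by simp [signProb, hp])
    rw [← h.snd (by linarith)] at this
    exact ae_of_ae_map measurable_snd.aemeasurable this
  have hpos : 0 < p → ∀ m, 0 < m → m ∈ validStates p := fun hp m hm _ => by
    rw [Real.sign_of_pos hm]; simpa [signProb] using hp
  have hneg : p < 1 → ∀ m, m < 0 → m ∈ validStates p := fun hp m hm _ => by
    rw [Real.sign_of_neg hm]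
    simpa [signProb, show ¬ ((-1 : ℝ) = 1) by norm_num] using hp
  have hzero : (0 : ℝ) ∈ validStates p := fun h => absurd rfl h
  rcases hp0.eq_or_lt with hp | hp
  · filter_upwards [hsnd hp.symm] with u hu m hm
    rcases lt_trichotomy m 0 with h' | rfl | h'
    · rw [stepFn, if_neg h'.not_gt]
      rcases (mul_nonpos_of_nonpos_of_nonneg h'.le hu).eq_or_lt with h0 | h0
      · rw [h0]; exact hzero
      · exact hneg (by linarith) _ h0
    · simpa [stepFn] using hzero
    · have := hm h'.ne'
      rw [Real.sign_of_pos h', signProb, if_pos rfl] at this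
      linarith
  rcases hp1.eq_or_lt with hp' | hp'
  · filter_upwards [hfst hp'] with u hu m hm
    rcases lt_trichotomy m 0 with h' | rfl | h'
    · have := hm h'.ne
      rw [Real.sign_of_neg h', signProb, if_neg (by norm_num)] at this
      linarith
    · simpa [stepFn] using hzero
    · rw [stepFn, if_pos h']
      rcases (mul_nonneg h'.le hu).eq_or_lt with h0 | h0
      · rw [← h0]; exact hzero
      · exact hpos hp _ h0
  · refine ae_of_all _ fun u m _ => ?_
    rcases lt_trichotomy (stepFn m u) 0 with h' | h' | h'
    · exact hneg hp' _ h'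
    · rw [h']; exact hzero
    · exact hpos hp _ h'

end

/-! ### Two-sided walks driven by independent multipliers -/

section

/-- The path from `m` with multipliers `u 0, u 1, …`. -/
def walk (u : ℕ → ℝ × ℝ) (m : ℝ) : ℕ → ℝ
  | 0 => m
  | n + 1 => stepFn (walk u m n) (u n)

/-- The two-sided path that is `m` at time `0`, with multipliers `u` forward and `v` backward. -/
def twoSidedWalk (m : ℝ) (u v : ℕ → ℝ × ℝ) (t : ℤ) : ℝ :=
  if 0 ≤ t then walk u m t.toNat else walk v m (-t).toNat

lemma twoSidedWalk_natCast (m : ℝ) (u v : ℕ → ℝ × ℝ) (n : ℕ) :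
    twoSidedWalk m u v n = walk u m n := by
  simp [twoSidedWalk]

lemma twoSidedWalk_neg (m : ℝ) (u v : ℕ → ℝ × ℝ) (t : ℤ) :
    twoSidedWalk m u v (-t) = twoSidedWalk m v u t := by
  unfold twoSidedWalk
  rcases lt_trichotomy t 0 with h | rfl | h
  · rw [if_pos (by omega), if_neg (by omega)]
  · simp [walk]
  · rw [if_neg (by omega), if_pos h.le, neg_neg]

lemma walk_congr {u u' : ℕ → ℝ × ℝ} {n : ℕ} (h : ∀ k < n, u k = u' k) (m : ℝ) :
    walk u m n = walk u' m n := by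
  induction n with
  | zero => rfl
  | succ n ih => rw [walk, walk, ih fun k hk => h k (by omega), h n (by omega)]

lemma walk_mem_validStates {p : ℝ} {u : ℕ → ℝ × ℝ} {m : ℝ} (hm : m ∈ validStates p)
    (hu : ∀ n, ∀ m ∈ validStates p, stepFn m (u n) ∈ validStates p) (n : ℕ) :
    walk u m n ∈ validStates p := by
  induction n with
  | zero => exact hm
  | succ n ih => exact hu n _ ih

lemma measurable_walk (n : ℕ) :
    Measurable fun q : ℝ × (ℕ → ℝ × ℝ) => walk q.2 q.1 n := by
  induction n with
  | zero => exact measurable_fst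
  | succ n ih => exact measurable_stepFn_comp ih ((measurable_pi_apply n).comp measurable_snd)

lemma measurable_twoSidedWalk (t : ℤ) :
    Measurable fun q : ℝ × (ℕ → ℝ × ℝ) × (ℕ → ℝ × ℝ) => twoSidedWalk q.1 q.2.1 q.2.2 t := by
  unfold twoSidedWalk
  split_ifs
  · exact (measurable_walk _).comp
      (measurable_fst.prodMk (measurable_fst.comp measurable_snd))
  · exact (measurable_walk _).comp
      (measurable_fst.prodMk (measurable_snd.comp measurable_snd))

/-- The sequence `u` cut off at time `n`. -/
def trunc (n : ℕ) (u : ℕ → ℝ × ℝ) (k : ℕ) : ℝ × ℝ := if k < n then u k else 0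

lemma measurable_trunc (n : ℕ) : Measurable (trunc n) := by
  refine measurable_pi_lambda _ fun k => ?_
  unfold trunc
  split_ifs
  · exact measurable_pi_apply k
  · exact measurable_const

lemma twoSidedWalk_trunc {n : ℕ} (m : ℝ) (u v : ℕ → ℝ × ℝ) {t : ℤ} (ht : t ≤ n) :
    twoSidedWalk m (trunc n u) v t = twoSidedWalk m u v t := by
  unfold twoSidedWalk
  split_ifs with h
  · exact walk_congr (fun k hk => by simp [trunc, show k < n by omega]) m
  · rfl

section

variable {Ω : Type*} [MeasurableSpace Ω] {Q : Measure Ω} {p α : ℝ} {μ μ' ν ν' : Measure (ℝ × ℝ)}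
  {I : Ω → ℝ} {U V : ℕ → Ω → ℝ × ℝ}

/-- The initial sign `I` has law `signLaw p`, and `U n` has law `ν` and is independent
of `I`, `U 0, …, U (n - 1)` and `V`. -/
structure IsNoise (Q : Measure Ω) (p : ℝ) (ν : Measure (ℝ × ℝ)) (I : Ω → ℝ)
    (U V : ℕ → Ω → ℝ × ℝ) : Prop where
  measurable_init : Measurable I
  measurable_left : ∀ n, Measurable (U n)
  measurable_right : ∀ n, Measurable (V n)
  map_init : Q.map I = signLaw p
  indep : ∀ (n : ℕ) (F : (ℝ × (ℕ → ℝ × ℝ) × (ℕ → ℝ × ℝ)) × (ℝ × ℝ) → ℝ≥0∞), Measurable F →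
    ∫⁻ ω, F ((I ω, trunc n (fun k => U k ω), fun k => V k ω), U n ω) ∂Q =
      ∫⁻ ω, ∫⁻ u, F ((I ω, trunc n (fun k => U k ω), fun k => V k ω), u) ∂ν ∂Q

/-- The two-sided process driven by the noise. -/
def noiseChain (I : Ω → ℝ) (U V : ℕ → Ω → ℝ × ℝ) (t : ℤ) (ω : Ω) : ℝ :=
  twoSidedWalk (I ω) (fun k => U k ω) (fun k => V k ω) t

lemma IsNoise.measurable_noiseChain (h : IsNoise Q p ν I U V) (t : ℤ) :
    Measurable (noiseChain I U V t) := by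
  have h1 := h.measurable_init
  have h2 := h.measurable_left
  have h3 := h.measurable_right
  exact (measurable_twoSidedWalk t).comp (f := fun ω => (I ω, (fun k => U k ω), fun k => V k ω))
    (by fun_prop)

lemma IsNoise.ae_init (hp0 : 0 ≤ p) (hp1 : p ≤ 1) (h : IsNoise Q p ν I U V) :
    ∀ᵐ ω ∂Q, I ω ∈ validStates p := by
  refine ae_of_ae_map h.measurable_init.aemeasurable ?_
  rw [h.map_init, signLaw, ae_add_measure_iff]
  have hs := measurableSet_validStates p
  constructor
  · rcases hp0.eq_or_lt with hp | hp
    · simp [← hp]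
    · refine Measure.ae_smul_measure ?_ _
      refine (mem_ae_dirac_iff hs).2 fun _ => ?_
      simpa [Real.sign_of_pos one_pos, signProb] using hp
  · rcases hp1.eq_or_lt with hp | hp
    · simp [hp]
    · refine Measure.ae_smul_measure ?_ _
      refine (mem_ae_dirac_iff hs).2 fun _ => ?_
      simpa [Real.sign_of_neg (show (-1 : ℝ) < 0 by norm_num), signProb,
        show ¬ ((-1 : ℝ) = 1) by norm_num] using hp

lemma IsNoise.ae_left (h : IsNoise Q p ν I U V) [IsProbabilityMeasure Q] {s : Set (ℝ × ℝ)}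
    (hs : ∀ᵐ u ∂ν, u ∈ s) : ∀ᵐ ω ∂Q, ∀ n, U n ω ∈ s := by
  refine ae_all_iff.2 fun n => ?_
  -- The set s need not be measurable, so the complement is replaced by a measurable hull of the
  -- same measure.
  have h1 : ν (toMeasurable ν sᶜ) = 0 := by
    rw [measure_toMeasurable]; exact hs
  have hm := measurableSet_toMeasurable ν sᶜ
  have h2 := h.indep n (fun z => (toMeasurable ν sᶜ).indicator 1 z.2)
    ((measurable_one.indicator hm).comp measurable_snd)
  simp only [lintegral_indicator_one hm, h1, lintegral_zero] at h2
  have h3 : Measurable fun ω => (toMeasurable ν sᶜ).indicator (1 : ℝ × ℝ → ℝ≥0∞) (U n ω) :=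
    (measurable_one.indicator hm).comp (h.measurable_left n)
  rw [lintegral_eq_zero_iff h3] at h2
  filter_upwards [h2] with ω hω
  by_contra hcon
  have : U n ω ∈ toMeasurable ν sᶜ := subset_toMeasurable ν _ hcon
  simp [Set.indicator, this] at hω

/-- The states before time n + 1 depend only on the sign, the first n forward multipliers and the
backward noise, and the next multiplier is independent of all of these. -/
lemma IsNoise.lintegral_step [IsProbabilityMeasure Q] (hα : 0 < α) (hp0 : 0 ≤ p) (hp1 : p ≤ 1)
    (hμ : MemClass p α μ) (hν : Drives p μ ν) (h : IsNoise Q p ν I U V) {t : ℤ} (ht : 1 ≤ t)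
    {F : ({s : ℤ // s < t} → ℝ) × ℝ → ℝ≥0∞} (hF : Measurable F) :
    ∫⁻ ω, F (fun s => noiseChain I U V s ω, noiseChain I U V t ω) ∂Q =
      ∫⁻ ω, ∫⁻ y, F (fun s => noiseChain I U V s ω, y)
        ∂tailStep μ (noiseChain I U V (t - 1) ω) ∂Q := by
  obtain ⟨n, rfl⟩ : ∃ n : ℕ, t = n + 1 := ⟨(t - 1).toNat, by omega⟩
  have hmeasF : Measurable fun z : (ℝ × (ℕ → ℝ × ℝ) × (ℕ → ℝ × ℝ)) × (ℝ × ℝ) =>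
      F (fun s => twoSidedWalk z.1.1 z.1.2.1 z.1.2.2 s,
        stepFn (twoSidedWalk z.1.1 z.1.2.1 z.1.2.2 n) z.2) := by
    refine hF.comp (Measurable.prodMk (measurable_pi_lambda _ fun s => ?_) ?_)
    · exact (measurable_twoSidedWalk s).comp measurable_fst
    · exact measurable_stepFn_comp ((measurable_twoSidedWalk n).comp measurable_fst) measurable_snd
  have h1 := h.indep n _ hmeasF
  have h2 : ∀ ω (s : {s : ℤ // s < (n : ℤ) + 1}),
      twoSidedWalk (I ω) (trunc n (fun k => U k ω)) (fun k => V k ω) s =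
        noiseChain I U V s ω := fun ω s =>
    twoSidedWalk_trunc _ _ _ (by have := s.2; omega)
  have h3 : ∀ ω, twoSidedWalk (I ω) (trunc n (fun k => U k ω)) (fun k => V k ω) n =
        noiseChain I U V n ω := fun ω => twoSidedWalk_trunc _ _ _ le_rfl
  have h4 : ∀ ω, stepFn (noiseChain I U V n ω) (U n ω) = noiseChain I U V (n + 1) ω := by
    intro ω
    have : noiseChain I U V ((n : ℤ) + 1) ω = noiseChain I U V ((n + 1 : ℕ) : ℤ) ω := by
      push_cast; rfl
    rw [this, noiseChain, noiseChain, twoSidedWalk_natCast, twoSidedWalk_natCast, walk]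
  simp only [h2, h3, h4] at h1
  rw [h1]
  refine lintegral_congr_ae ?_
  filter_upwards [h.ae_init hp0 hp1, h.ae_left (hν.ae_stepFn_mem hα hp0 hp1 hμ)] with ω hω hω'
  have h5 : noiseChain I U V n ω ∈ validStates p := by
    rw [noiseChain, twoSidedWalk_natCast]
    exact walk_mem_validStates hω hω' n
  have h6 : Measurable (stepFn (noiseChain I U V n ω)) :=
    measurable_stepFn_comp measurable_const measurable_id
  rw [add_sub_cancel_right, ← hν.map_stepFn h5, lintegral_map (by fun_prop) h6]

lemma IsNoise.lintegral_init (h : IsNoise Q p ν I U V) {f : ℝ → ℝ≥0∞} (hf : Measurable f) :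
    ∫⁻ ω, f (I ω) ∂Q = ∫⁻ σ, f σ ∂signLaw p := by
  rw [← h.map_init, lintegral_map hf h.measurable_init]

lemma IsNoise.map_zero_one [IsProbabilityMeasure Q] (hα : 0 < α) (hp0 : 0 ≤ p) (hp1 : p ≤ 1)
    (hμ : MemClass p α μ) (hν : Drives p μ ν) (h : IsNoise Q p ν I U V) :
    Q.map (fun ω => (noiseChain I U V 0 ω, noiseChain I U V 1 ω)) = μ := by
  refine Measure.ext_of_lintegral _ fun F hF => ?_
  have h0 := h.measurable_noiseChain 0
  have h1 := h.measurable_noiseChain 1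
  have hI : ∀ ω, noiseChain I U V 0 ω = I ω := fun ω => by simp [noiseChain, twoSidedWalk, walk]
  rw [lintegral_map hF (by fun_prop)]
  have h2 := h.lintegral_step hα hp0 hp1 hμ hν le_rfl (F := fun z => F (z.1 ⟨0, by norm_num⟩, z.2))
    (by fun_prop)
  rw [h2, hμ.lintegral_eq hF]
  simp only [sub_self, hI]
  exact h.lintegral_init (f := fun σ => stepOp μ (fun y => F (σ, y)) σ)
    (Measurable.lintegral_kernel_prod_right' (κ := tailKernel μ) hF)

end

lemma condDistrib_ae_of_lintegral {Ω A : Type*} [MeasurableSpace Ω] [MeasurableSpace A]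
    {Q : Measure Ω} [IsFiniteMeasure Q] {H : Ω → A} {Y : Ω → ℝ} (hH : Measurable H)
    (hY : Measurable Y) (κ : Kernel A ℝ) [IsFiniteKernel κ]
    (h : ∀ F : A × ℝ → ℝ≥0∞, Measurable F →
      ∫⁻ ω, F (H ω, Y ω) ∂Q = ∫⁻ ω, ∫⁻ y, F (H ω, y) ∂κ (H ω) ∂Q) :
    ∀ᵐ a ∂(Q.map H), condDistrib Y H Q a = κ a := by
  refine condDistrib_ae_eq_of_measure_eq_compProd H hY.aemeasurable
    (Measure.ext_of_lintegral _ fun F hF => ?_)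
  rw [lintegral_map hF (by fun_prop), h F hF, Measure.lintegral_compProd hF,
    lintegral_map (f := fun a => ∫⁻ y, F (a, y) ∂κ a) ?_ hH]
  exact Measurable.lintegral_kernel_prod_right' hF

/-- The walk is symmetric under exchanging the two noises and reversing time, so the backward
transitions follow from the forward argument with U and V interchanged. -/
lemma isBFTC_of_isNoise {Ω : Type*} [MeasurableSpace Ω] {Q : Measure Ω} {p α : ℝ}
    {μ μ' ν ν' : Measure (ℝ × ℝ)} {I : Ω → ℝ} {U V : ℕ → Ω → ℝ × ℝ}
    [IsProbabilityMeasure Q] [IsProbabilityMeasure (Q.map fun ω t => noiseChain I U V t ω)]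
    (hα : 0 < α) (hp0 : 0 ≤ p) (hp1 : p ≤ 1) (hadj : IsAdjoint p α μ μ') (hν : Drives p μ ν)
    (hν' : Drives p μ' ν') (hU : IsNoise Q p ν I U V) (hV : IsNoise Q p ν' I V U) :
    IsBFTC (Q.map fun ω t => noiseChain I U V t ω) p α μ (fun t m => m t) := by
  have hmeas : Measurable fun ω t => noiseChain I U V t ω :=
    measurable_pi_lambda _ hU.measurable_noiseChain
  have hneg : ∀ t ω, noiseChain I V U t ω = noiseChain I U V (-t) ω := fun t ω =>
    (twoSidedWalk_neg _ _ _ t).symm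
  have hback : (Q.map fun ω t => noiseChain I U V t ω).map (fun m => (m 0, m (-1))) = μ' := by
    rw [Measure.map_map (by fun_prop) hmeas, ← hV.map_zero_one hα hp0 hp1 hadj.mem_right hν']
    simp [Function.comp_def, hneg]
  refine ⟨fun t => measurable_pi_apply t, ?_, ?_, fun t ht => ?_, fun t ht => ?_⟩
  · rw [Measure.map_map (by fun_prop) hmeas]
    exact hU.map_zero_one hα hp0 hp1 hadj.mem_left hν
  · rwa [hback]
  · refine condDistrib_ae_of_lintegral (by fun_prop) (by fun_prop)
      ((tailKernel μ).comap (fun h : {s : ℤ // s < t} → ℝ => h ⟨t - 1, by omega⟩)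
        (by fun_prop)) fun F hF => ?_
    simp only [Kernel.comap_apply, tailKernel_apply]
    rw [lintegral_map (by fun_prop) hmeas, hU.lintegral_step hα hp0 hp1 hadj.mem_left hν ht hF,
      lintegral_map ?_ hmeas]
    exact (Measurable.lintegral_kernel_prod_right' (κ := (tailKernel μ).comap
      (fun h : {s : ℤ // s < t} → ℝ => h ⟨t - 1, by omega⟩) (by fun_prop)) hF).comp
      (f := fun (m : ℤ → ℝ) (s : {s : ℤ // s < t}) => m s) (by fun_prop)
  · rw [hback]
    refine condDistrib_ae_of_lintegral (by fun_prop) (by fun_prop)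
      ((tailKernel μ').comap (fun h : {s : ℤ // -t < s} → ℝ => h ⟨-t + 1, by omega⟩)
        (by fun_prop)) fun F hF => ?_
    simp only [Kernel.comap_apply, tailKernel_apply]
    rw [lintegral_map (by fun_prop) hmeas]
    have h1 := hV.lintegral_step hα hp0 hp1 hadj.mem_right hν' ht
      (F := fun z => F (fun s => z.1 ⟨-s, by have := s.2; omega⟩, z.2)) (by fun_prop)
    simp only [hneg, neg_neg] at h1
    rw [h1, lintegral_map ?_ hmeas]
    · simp [show -(t - 1) = -t + 1 by ring]
    exact (Measurable.lintegral_kernel_prod_right' (κ := (tailKernel μ').comap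
      (fun h : {s : ℤ // -t < s} → ℝ => h ⟨-t + 1, by omega⟩) (by fun_prop)) hF).comp
      (f := fun (m : ℤ → ℝ) (s : {s : ℤ // -t < s}) => m s) (by fun_prop)

end

section

/-! ### A concrete back-and-forth tail chain -/

lemma isProbabilityMeasure_signLaw {p : ℝ} (hp0 : 0 ≤ p) (hp1 : p ≤ 1) :
    IsProbabilityMeasure (signLaw p) := by
  constructor
  simp only [signLaw, Measure.add_apply, Measure.smul_apply, measure_univ, smul_eq_mul, mul_one]
  rw [← ENNReal.ofReal_add hp0 (by linarith)]
  simp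

lemma isProbabilityMeasure_stepLaw {μ : Measure (ℝ × ℝ)} [IsProbabilityMeasure μ] {σ : ℝ}
    (h : μ {z | z.1 = σ} ≠ 0) : IsProbabilityMeasure (stepLaw μ σ) := by
  have := cond_isProbabilityMeasure h
  exact Measure.isProbabilityMeasure_map (by fun_prop)

lemma MemClass.exists_drives {p α : ℝ} {μ : Measure (ℝ × ℝ)} (hμ : MemClass p α μ) :
    ∃ ν, Drives p μ ν := by
  have := hμ.isProb
  obtain ⟨ν₁, hν₁, h₁⟩ : ∃ ν₁ : Measure ℝ, IsProbabilityMeasure ν₁ ∧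
      (0 < p → ν₁ = stepLaw μ 1) := by
    by_cases hp : 0 < p
    · refine ⟨stepLaw μ 1, isProbabilityMeasure_stepLaw ?_, fun _ => rfl⟩
      rw [hμ.prob_one]
      simpa using hp
    -- An arbitrary default: for p = 0 the multiplier of positive states has no prescribed law.
    · exact ⟨Measure.dirac 0, inferInstance, fun h => absurd h hp⟩
  obtain ⟨ν₂, hν₂, h₂⟩ : ∃ ν₂ : Measure ℝ, IsProbabilityMeasure ν₂ ∧
      (p < 1 → ν₂ = stepLaw μ (-1)) := by
    by_cases hp : p < 1
    · refine ⟨stepLaw μ (-1), isProbabilityMeasure_stepLaw ?_, fun _ => rfl⟩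
      rw [hμ.prob_neg_one]
      simpa using hp
    · exact ⟨Measure.dirac 0, inferInstance, fun h => absurd h hp⟩
  refine ⟨ν₁.prod ν₂, inferInstance, fun hp => ?_, fun hp => ?_⟩
  · rw [← h₁ hp, Measure.map_fst_prod, measure_univ, one_smul]
  · rw [← h₂ hp, Measure.map_snd_prod, measure_univ, one_smul]

/-! ### Independence on the product space carrying the sign and both noises -/

lemma lintegral_prod_prod {E Ω Ω₂ : Type*} [MeasurableSpace E] [MeasurableSpace Ω]
    [MeasurableSpace Ω₂] {η : Measure E} {P : Measure Ω} {P₂ : Measure Ω₂} [SFinite η] [SFinite P]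
    [SFinite P₂] {G : E × Ω × Ω₂ → ℝ≥0∞} (hG : Measurable G) :
    ∫⁻ ω, G ω ∂η.prod (P.prod P₂) = ∫⁻ σ, ∫⁻ a, ∫⁻ b, G (σ, a, b) ∂P₂ ∂P ∂η := by
  rw [lintegral_prod _ hG.aemeasurable]
  refine lintegral_congr fun σ => ?_
  have hm : Measurable fun q => G (σ, q) := by fun_prop
  rw [lintegral_prod _ hm.aemeasurable]

lemma lintegral_prod_prod_swap {E Ω Ω₂ : Type*} [MeasurableSpace E] [MeasurableSpace Ω]
    [MeasurableSpace Ω₂] {η : Measure E} {P : Measure Ω} {P₂ : Measure Ω₂} [SFinite η] [SFinite P]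
    [SFinite P₂] {G : E × Ω × Ω₂ → ℝ≥0∞} (hG : Measurable G) :
    ∫⁻ ω, G ω ∂η.prod (P.prod P₂) = ∫⁻ σ, ∫⁻ b, ∫⁻ a, G (σ, a, b) ∂P ∂P₂ ∂η := by
  rw [lintegral_prod_prod hG]
  refine lintegral_congr fun σ => ?_
  have hm : Measurable fun q : Ω × Ω₂ => G (σ, q.1, q.2) := by fun_prop
  exact lintegral_lintegral_swap hm.aemeasurable

section

variable {E Ω Ω₂ A B C : Type*} [MeasurableSpace E] [MeasurableSpace Ω] [MeasurableSpace Ω₂]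
  [MeasurableSpace A] [MeasurableSpace B] [MeasurableSpace C] {η : Measure E} {P : Measure Ω}
  {P₂ : Measure Ω₂} [SFinite η] [SFinite P] [SFinite P₂] {ν : Measure C} [SFinite ν]
  {T : Ω → A} {R : Ω₂ → B} {Y : Ω → C}

lemma lintegral_indep_left (hT : Measurable T) (hR : Measurable R) (hY : Measurable Y)
    (h : ∀ F : A × C → ℝ≥0∞, Measurable F →
      ∫⁻ ω, F (T ω, Y ω) ∂P = ∫⁻ ω, ∫⁻ u, F (T ω, u) ∂ν ∂P)
    {F : (E × A × B) × C → ℝ≥0∞} (hF : Measurable F) :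
    ∫⁻ ω, F ((ω.1, T ω.2.1, R ω.2.2), Y ω.2.1) ∂η.prod (P.prod P₂) =
      ∫⁻ ω, ∫⁻ u, F ((ω.1, T ω.2.1, R ω.2.2), u) ∂ν ∂η.prod (P.prod P₂) := by
  have hm' : Measurable fun ω : E × Ω × Ω₂ => ∫⁻ u, F ((ω.1, T ω.2.1, R ω.2.2), u) ∂ν :=
    Measurable.lintegral_prod_right' (f := fun q : (E × Ω × Ω₂) × C =>
      F ((q.1.1, T q.1.2.1, R q.1.2.2), q.2)) (by fun_prop)
  rw [lintegral_prod_prod_swap hm', lintegral_prod_prod_swap (by fun_prop)]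
  refine lintegral_congr fun σ => lintegral_congr fun b => ?_
  exact h (fun q => F ((σ, q.1, R b), q.2)) (by fun_prop)

lemma lintegral_indep_right (hT : Measurable T) (hR : Measurable R) (hY : Measurable Y)
    (h : ∀ F : A × C → ℝ≥0∞, Measurable F →
      ∫⁻ ω, F (T ω, Y ω) ∂P = ∫⁻ ω, ∫⁻ u, F (T ω, u) ∂ν ∂P)
    {F : (E × A × B) × C → ℝ≥0∞} (hF : Measurable F) :
    ∫⁻ ω, F ((ω.1, T ω.2.2, R ω.2.1), Y ω.2.2) ∂η.prod (P₂.prod P) =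
      ∫⁻ ω, ∫⁻ u, F ((ω.1, T ω.2.2, R ω.2.1), u) ∂ν ∂η.prod (P₂.prod P) := by
  have hm' : Measurable fun ω : E × Ω₂ × Ω => ∫⁻ u, F ((ω.1, T ω.2.2, R ω.2.1), u) ∂ν :=
    Measurable.lintegral_prod_right' (f := fun q : (E × Ω₂ × Ω) × C =>
      F ((q.1.1, T q.1.2.2, R q.1.2.1), q.2)) (by fun_prop)
  rw [lintegral_prod_prod hm', lintegral_prod_prod (by fun_prop)]
  refine lintegral_congr fun σ => lintegral_congr fun b => ?_
  exact h (fun q => F ((σ, q.1, R b), q.2)) (by fun_prop)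

end

lemma lintegral_of_indepFun {Ω A B : Type*} [MeasurableSpace Ω] [MeasurableSpace A]
    [MeasurableSpace B] {P : Measure Ω} [IsProbabilityMeasure P] {f : Ω → A} {g : Ω → B}
    (hf : Measurable f) (hg : Measurable g) (h : IndepFun f g P) {F : A × B → ℝ≥0∞}
    (hF : Measurable F) :
    ∫⁻ ω, F (f ω, g ω) ∂P = ∫⁻ ω, ∫⁻ b, F (f ω, b) ∂(P.map g) ∂P := by
  have := Measure.isProbabilityMeasure_map (μ := P) hg.aemeasurable
  rw [← lintegral_map (f := F) (g := fun ω => (f ω, g ω)) hF (by fun_prop),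
    (indepFun_iff_map_prod_eq_prod_map_map hf.aemeasurable hg.aemeasurable).1 h,
    lintegral_prod _ hF.aemeasurable, lintegral_map hF.lintegral_prod_right' hf]

section

variable {Ω : Type*} [MeasurableSpace Ω] {P : Measure Ω} {U : ℕ → Ω → ℝ × ℝ}
  {ν : Measure (ℝ × ℝ)}

lemma indepFun_trunc (hU : ∀ n, Measurable (U n)) (h : iIndepFun U P) (n : ℕ) :
    IndepFun (fun ω => trunc n (fun k => U k ω)) (U n) P := by
  have h1 := h.indepFun_finset (Finset.range n) {n} (by simp) hU
  have h2 : Measurable fun (a : Finset.range n → ℝ × ℝ) (k : ℕ) =>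
      if hk : k ∈ Finset.range n then a ⟨k, hk⟩ else 0 := by
    refine measurable_pi_lambda _ fun k => ?_
    split_ifs with hk
    · exact measurable_pi_apply _
    · exact measurable_const
  have h3 := h1.comp h2 (measurable_pi_apply (⟨n, by simp⟩ : ({n} : Finset ℕ)))
  convert h3 using 1
  · ext1 ω
    funext k
    simp [trunc]
  · rfl

variable [IsProbabilityMeasure P]

lemma lintegral_trunc (hU : ∀ n, Measurable (U n)) (h : iIndepFun U P)
    (hν : ∀ n, P.map (U n) = ν) (n : ℕ) {F : (ℕ → ℝ × ℝ) × (ℝ × ℝ) → ℝ≥0∞} (hF : Measurable F) :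
    ∫⁻ ω, F (trunc n (fun k => U k ω), U n ω) ∂P =
      ∫⁻ ω, ∫⁻ u, F (trunc n (fun k => U k ω), u) ∂ν ∂P := by
  rw [← hν n]
  exact lintegral_of_indepFun ((measurable_trunc n).comp (by fun_prop)) (hU n)
    (indepFun_trunc hU h n) hF

variable {Ω₂ : Type*} [MeasurableSpace Ω₂] {P₂ : Measure Ω₂} [IsProbabilityMeasure P₂]
  {V : ℕ → Ω₂ → ℝ × ℝ} {p : ℝ}

lemma isNoise_left [SFinite ν] (hU : ∀ n, Measurable (U n))
    (h : iIndepFun U P) (hν : ∀ n, P.map (U n) = ν) (hV : ∀ n, Measurable (V n)) :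
    IsNoise ((signLaw p).prod (P.prod P₂)) p ν Prod.fst (fun n ω => U n ω.2.1)
      (fun n ω => V n ω.2.2) where
  measurable_init := measurable_fst
  measurable_left n := (hU n).comp (measurable_fst.comp measurable_snd)
  measurable_right n := (hV n).comp (measurable_snd.comp measurable_snd)
  map_init := by rw [Measure.map_fst_prod, measure_univ, one_smul]
  indep n F hF := lintegral_indep_left ((measurable_trunc n).comp (measurable_pi_lambda _ hU))
    (measurable_pi_lambda _ hV) (hU n) (fun F hF => lintegral_trunc hU h hν n hF) hF

lemma isNoise_right [SFinite ν] (hU : ∀ n, Measurable (U n))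
    (h : iIndepFun U P) (hν : ∀ n, P.map (U n) = ν) (hV : ∀ n, Measurable (V n)) :
    IsNoise ((signLaw p).prod (P₂.prod P)) p ν Prod.fst (fun n ω => U n ω.2.2)
      (fun n ω => V n ω.2.1) where
  measurable_init := measurable_fst
  measurable_left n := (hU n).comp (measurable_snd.comp measurable_snd)
  measurable_right n := (hV n).comp (measurable_fst.comp measurable_snd)
  map_init := by rw [Measure.map_fst_prod, measure_univ, one_smul]
  indep n F hF := lintegral_indep_right ((measurable_trunc n).comp (measurable_pi_lambda _ hU))
    (measurable_pi_lambda _ hV) (hU n) (fun F hF => lintegral_trunc hU h hν n hF) hF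

end

/-! ### The forward transition law -/

section

variable {S : Type*} [MeasurableSpace S] {ν : Measure S} [IsProbabilityMeasure ν] {p : ℝ}
  {φ : S → ℝ → ℝ} {Ψ : ℝ → S → ℝ}

lemma signProb_one (p : ℝ) : signProb p 1 = p := by simp [signProb]

lemma signProb_neg_one (p : ℝ) : signProb p (-1) = 1 - p := by
  simp [signProb, show ¬ ((-1 : ℝ) = 1) by norm_num]

/-- No measurability of φ is assumed. For signs of positive probability it is an almost sure limit
of measurable functions along the integers, hence almost surely equal to a measurable one; for other
signs 0 is used. -/
lemma exists_multipliers (hΨ : Measurable (Function.uncurry Ψ)) (hφ : IsAsympLinear ν Ψ p φ) :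
    ∃ m : S → ℝ × ℝ, Measurable m ∧ ∀ᵐ v ∂ν, ∀ σ : ℝ, (σ = 1 ∨ σ = -1) → 0 < signProb p σ →
      stepFn σ (m v) = σ * φ v σ := by
  obtain ⟨V, hV, hV1, hlim, -⟩ := hφ
  have hVae : ∀ᵐ v ∂ν, v ∈ V := (prob_compl_eq_zero_iff hV).2 hV1
  have key : ∀ σ : ℝ, (σ = 1 ∨ σ = -1) → ∃ g : S → ℝ, Measurable g ∧
      (0 < signProb p σ → ∀ᵐ v ∂ν, g v = φ v σ) := by
    intro σ hσ
    by_cases hp : 0 < signProb p σ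
    · have hae : AEMeasurable (fun v => φ v σ) ν := by
        refine aemeasurable_of_tendsto_metrizable_ae atTop
          (f := fun (n : ℕ) v => (σ * (n : ℝ))⁻¹ * Ψ (σ * n) v) (fun n => ?_) ?_
        · have : Measurable fun v => Ψ (σ * n) v := hΨ.comp measurable_prodMk_left
          exact (this.const_mul _).aemeasurable
        · filter_upwards [hVae] with v hv
          exact (hlim σ hσ hp v hv).comp tendsto_natCast_atTop_atTop
      exact ⟨hae.mk _, hae.measurable_mk, fun _ => hae.ae_eq_mk.symm⟩
    · exact ⟨fun _ => 0, measurable_const, fun h => absurd h hp⟩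
  obtain ⟨g₁, hg₁, h₁⟩ := key 1 (Or.inl rfl)
  obtain ⟨g₂, hg₂, h₂⟩ := key (-1) (Or.inr rfl)
  refine ⟨fun v => (g₁ v, g₂ v), by fun_prop, ?_⟩
  have h₁' : ∀ᵐ v ∂ν, 0 < signProb p 1 → g₁ v = φ v 1 := by
    by_cases hp : 0 < signProb p 1
    · filter_upwards [h₁ hp] with v hv _ using hv
    · exact ae_of_all _ fun v h => absurd h hp
  have h₂' : ∀ᵐ v ∂ν, 0 < signProb p (-1) → g₂ v = φ v (-1) := by
    by_cases hp : 0 < signProb p (-1)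
    · filter_upwards [h₂ hp] with v hv _ using hv
    · exact ae_of_all _ fun v h => absurd h hp
  filter_upwards [h₁', h₂'] with v hv₁ hv₂ σ hσ hp
  rcases hσ with rfl | rfl
  · simp [stepFn, hv₁ hp]
  · simp [stepFn, hv₂ hp, show ¬ ((0 : ℝ) < -1) by norm_num]

lemma ae_signLaw (p : ℝ) :
    ∀ᵐ σ ∂signLaw p, (σ = 1 ∨ σ = -1) ∧ 0 < signProb p σ := by
  rw [signLaw, ae_add_measure_iff]
  have hm : ∀ σ : ℝ, MeasurableSet {σ : ℝ | (σ = 1 ∨ σ = -1) ∧ 0 < signProb p σ} := fun σ =>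
    Set.Finite.measurableSet ((Set.toFinite {1, -1}).subset fun x hx => hx.1)
  constructor
  · rcases le_or_gt p 0 with hp | hp
    · simp [ENNReal.ofReal_of_nonpos hp]
    · refine Measure.ae_smul_measure ?_ _
      exact (mem_ae_dirac_iff (hm 1)).2 ⟨Or.inl rfl, by rwa [signProb_one]⟩
  · rcases le_or_gt (1 - p) 0 with hp | hp
    · simp [ENNReal.ofReal_of_nonpos hp]
    · refine Measure.ae_smul_measure ?_ _
      exact (mem_ae_dirac_iff (hm 1)).2 ⟨Or.inr rfl, by rwa [signProb_neg_one]⟩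

/-- Replacing φ by its measurable version changes the defining map only on a null set, since signs
of probability zero carry no mass. -/
lemma lintegral_forwardLaw {m : S → ℝ × ℝ} (hm : Measurable m)
    (h : ∀ᵐ v ∂ν, ∀ σ : ℝ, (σ = 1 ∨ σ = -1) → 0 < signProb p σ → stepFn σ (m v) = σ * φ v σ)
    {F : ℝ × ℝ → ℝ≥0∞} (hF : Measurable F) :
    ∫⁻ z, F z ∂forwardLaw ν p φ = ∫⁻ σ, ∫⁻ v, F (σ, stepFn σ (m v)) ∂ν ∂signLaw p := by
  have h1 : forwardLaw ν p φ =
      ((signLaw p).prod ν).map (fun z => (z.1, stepFn z.1 (m z.2))) := by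
    refine Measure.map_congr ?_
    have h2 : ∀ᵐ z ∂(signLaw p).prod ν, (z.1 = 1 ∨ z.1 = -1) ∧ 0 < signProb p z.1 :=
      Measure.quasiMeasurePreserving_fst.ae (ae_signLaw p)
    have h3 : ∀ᵐ z ∂(signLaw p).prod ν, ∀ σ : ℝ, (σ = 1 ∨ σ = -1) → 0 < signProb p σ →
        stepFn σ (m z.2) = σ * φ z.2 σ := Measure.quasiMeasurePreserving_snd.ae h
    change _ =ᵐ[(signLaw p).prod ν] _
    filter_upwards [h2, h3] with z hz hz'
    rw [hz' z.1 hz.1 hz.2]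
  have h4 : Measurable fun z : ℝ × S => stepFn z.1 (m z.2) :=
    measurable_stepFn_comp measurable_fst (hm.comp measurable_snd)
  rw [h1, lintegral_map hF (by fun_prop), lintegral_prod _ (by fun_prop)]

lemma forwardLaw_fst {m : S → ℝ × ℝ} (hm : Measurable m)
    (h : ∀ᵐ v ∂ν, ∀ σ : ℝ, (σ = 1 ∨ σ = -1) → 0 < signProb p σ → stepFn σ (m v) = σ * φ v σ)
    {σ : ℝ} (hσ : σ = 1 ∨ σ = -1) {s : Set ℝ} (hs : MeasurableSet s) :
    forwardLaw ν p φ ({z | z.1 = σ} ∩ {z | z.2 / z.1 ∈ s}) =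
      ENNReal.ofReal (signProb p σ) * ν {v | stepFn σ (m v) / σ ∈ s} := by
  have hms : MeasurableSet ({z : ℝ × ℝ | z.1 = σ} ∩ {z | z.2 / z.1 ∈ s}) :=
    (measurableSet_eq_fun measurable_fst measurable_const).inter
      (measurableSet_preimage (by fun_prop) hs)
  have hind : Measurable (({z : ℝ × ℝ | z.1 = σ} ∩ {z | z.2 / z.1 ∈ s}).indicator
      (1 : ℝ × ℝ → ℝ≥0∞)) := measurable_one.indicator hms
  have hst : Measurable fun z : ℝ × S => stepFn z.1 (m z.2) :=
    measurable_stepFn_comp measurable_fst (hm.comp measurable_snd)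
  rw [← lintegral_indicator_one hms, lintegral_forwardLaw hm h hind,
    lintegral_signLaw _ (Measurable.lintegral_prod_right' (f := fun z : ℝ × S =>
      ({z : ℝ × ℝ | z.1 = σ} ∩ {z | z.2 / z.1 ∈ s}).indicator 1 (z.1, stepFn z.1 (m z.2)))
      (by fun_prop))]
  have hset : MeasurableSet {v | stepFn σ (m v) / σ ∈ s} := by
    have : Measurable fun v => stepFn σ (m v) := measurable_stepFn_comp measurable_const hm
    exact measurableSet_preimage (f := fun v => stepFn σ (m v) / σ) (by fun_prop) hs
  rw [← lintegral_indicator_one hset]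
  have e : ∀ v, ({z : ℝ × ℝ | z.1 = σ} ∩ {z | z.2 / z.1 ∈ s}).indicator (1 : ℝ × ℝ → ℝ≥0∞)
      (σ, stepFn σ (m v)) = {v | stepFn σ (m v) / σ ∈ s}.indicator 1 v := by
    intro v
    by_cases hv : stepFn σ (m v) / σ ∈ s
    · rw [Set.indicator_of_mem (by exact ⟨rfl, hv⟩), Set.indicator_of_mem (by exact hv)]
      rfl
    · rw [Set.indicator_of_notMem (by exact fun h => hv h.2),
        Set.indicator_of_notMem (by exact hv)]
  have e' : ∀ τ y, τ ≠ σ → ({z : ℝ × ℝ | z.1 = σ} ∩ {z | z.2 / z.1 ∈ s}).indicator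
      (1 : ℝ × ℝ → ℝ≥0∞) (τ, y) = 0 := fun τ y h =>
    Set.indicator_of_notMem (by exact fun h' => h h'.1) _
  rcases hσ with rfl | rfl
  · simp only [e, e' (-1) _ (by norm_num), signProb_one, lintegral_const, zero_mul, mul_zero,
      add_zero]
  · simp only [e, e' 1 _ (by norm_num), signProb_neg_one, lintegral_const, zero_mul, mul_zero,
      zero_add]

lemma forwardLaw_fst_eq {m : S → ℝ × ℝ} (hm : Measurable m)
    (h : ∀ᵐ v ∂ν, ∀ σ : ℝ, (σ = 1 ∨ σ = -1) → 0 < signProb p σ → stepFn σ (m v) = σ * φ v σ)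
    {σ : ℝ} (hσ : σ = 1 ∨ σ = -1) :
    forwardLaw ν p φ {z | z.1 = σ} = ENNReal.ofReal (signProb p σ) := by
  simpa using forwardLaw_fst hm h hσ MeasurableSet.univ

lemma drives_forwardLaw {m : S → ℝ × ℝ} (hm : Measurable m)
    (h : ∀ᵐ v ∂ν, ∀ σ : ℝ, (σ = 1 ∨ σ = -1) → 0 < signProb p σ → stepFn σ (m v) = σ * φ v σ) :
    Drives p (forwardLaw ν p φ) (ν.map m) := by
  have key : ∀ σ : ℝ, (σ = 1 ∨ σ = -1) → 0 < signProb p σ →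
      stepLaw (forwardLaw ν p φ) σ = ν.map (fun v => stepFn σ (m v) / σ) := by
    intro σ hσ hp
    have hst : Measurable fun v => stepFn σ (m v) := measurable_stepFn_comp measurable_const hm
    ext s hs
    rw [stepLaw, Measure.map_apply (by fun_prop) hs, Measure.map_apply (by fun_prop) hs,
      cond_apply (measurableSet_eq_fun measurable_fst measurable_const),
      forwardLaw_fst_eq hm h hσ]
    have := forwardLaw_fst hm h hσ hs
    have h0 : ENNReal.ofReal (signProb p σ) ≠ 0 := by simpa using hp
    refine (congrArg _ this).trans ?_
    rw [← mul_assoc, ENNReal.inv_mul_cancel h0 ENNReal.ofReal_ne_top, one_mul]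
    rfl
  refine ⟨Measure.isProbabilityMeasure_map hm.aemeasurable, fun hp => ?_, fun hp => ?_⟩
  · rw [key 1 (Or.inl rfl) (by rwa [signProb_one]), Measure.map_map measurable_fst hm]
    congr 1
    ext v
    simp [stepFn]
  · rw [key (-1) (Or.inr rfl) (by rw [signProb_neg_one]; linarith),
      Measure.map_map measurable_snd hm]
    congr 1
    ext v
    simp [stepFn, show ¬ ((0 : ℝ) < -1) by norm_num]

end

end

section

/-! ### Asymptotics of the recursion -/

/-- The orbit of `z` under the recursion with innovations `e 0, e 1, …`. -/
def orbit {S : Type*} (Ψ : ℝ → S → ℝ) (e : ℕ → S) (z : ℝ) : ℕ → ℝ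
  | 0 => z
  | n + 1 => Ψ (orbit Ψ e z n) (e n)

lemma sign_eq_or {w : ℝ} (hw : w ≠ 0) : Real.sign w = 1 ∨ Real.sign w = -1 := by
  rcases lt_or_gt_of_ne hw with h | h
  · exact Or.inr (Real.sign_of_neg h)
  · exact Or.inl (Real.sign_of_pos h)

lemma stepFn_eq_mul_sign {w : ℝ} (hw : w ≠ 0) (u : ℝ × ℝ) :
    stepFn w u = w * (Real.sign w * stepFn (Real.sign w) u) := by
  rcases lt_or_gt_of_ne hw with h | h
  · simp [Real.sign_of_neg h, stepFn, h.not_gt, show ¬ ((0 : ℝ) < -1) by norm_num]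
  · simp [Real.sign_of_pos h, stepFn, h]

/-- Here y(r) runs to infinity on the side of w, so f(y)/y tends to the slope there, and it is
multiplied by y(r)/r → w. -/
lemma tendsto_div_of_ne_zero {f y : ℝ → ℝ} {w : ℝ} {u : ℝ × ℝ} (hw : w ≠ 0)
    (hy : Tendsto (fun r => y r / r) atTop (𝓝 w))
    (hf : Tendsto (fun x => (Real.sign w * x)⁻¹ * f (Real.sign w * x)) atTop
      (𝓝 (Real.sign w * stepFn (Real.sign w) u))) :
    Tendsto (fun r => f (y r) / r) atTop (𝓝 (stepFn w u)) := by
  set τ := Real.sign w with hτ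
  have hττ : τ * τ = 1 := by
    rcases sign_eq_or hw with h | h <;> rw [hτ, h] <;> norm_num
  have hτw : 0 < τ * w := by
    rcases lt_or_gt_of_ne hw with h | h
    · rw [hτ, Real.sign_of_neg h]; linarith
    · rw [hτ, Real.sign_of_pos h]; linarith
  have h1 : Tendsto (fun r => r * (τ * (y r / r))) atTop atTop :=
    tendsto_id.atTop_mul_pos hτw (hy.const_mul τ)
  have h2 : (fun r => r * (τ * (y r / r))) =ᶠ[atTop] fun r => τ * y r := by
    filter_upwards [eventually_gt_atTop 0] with r hr
    field_simp
  have h3 := hf.comp (h1.congr' h2)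
  have h4 := hy.mul h3
  rw [stepFn_eq_mul_sign hw]
  refine h4.congr' ?_
  filter_upwards [(h1.congr' h2).eventually_gt_atTop 0] with r hr
  have hyr : y r ≠ 0 := by
    rintro h0
    rw [h0, mul_zero] at hr
    exact lt_irrefl _ hr
  simp only [Function.comp_apply, ← mul_assoc, hττ, one_mul]
  rw [div_mul_eq_mul_div, mul_inv_cancel₀ hyr, div_mul_eq_mul_div, one_mul]

/-- Now y(r) = o(r) may stay bounded or oscillate, so the asymptotic slopes give nothing. The linear
bound on all of [-x, x], taken at x a small multiple of r, takes their place. -/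
lemma tendsto_div_of_zero {f y : ℝ → ℝ} {C : ℝ}
    (hy : Tendsto (fun r => y r / r) atTop (𝓝 0))
    (hf : ∀ᶠ x : ℝ in atTop, ∀ y : ℝ, |y| ≤ x → |f y| ≤ C * x) :
    Tendsto (fun r => f (y r) / r) atTop (𝓝 0) := by
  rw [Metric.tendsto_nhds]
  intro η hη
  have hδ : 0 < η / (|C| + 1) := by positivity
  have h1 := (Metric.tendsto_nhds.1 hy) _ hδ
  have h2 : Tendsto (fun r : ℝ => η / (|C| + 1) * r) atTop atTop :=
    tendsto_id.const_mul_atTop hδ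
  filter_upwards [h1, h2.eventually hf, eventually_gt_atTop 0] with r hr1 hr2 hr
  rw [dist_zero_right, Real.norm_eq_abs, abs_div, abs_of_pos hr, div_lt_iff₀ hr] at hr1 ⊢
  refine (hr2 _ hr1.le).trans_lt ?_
  have h3 : C * (η / (|C| + 1) * r) ≤ |C| * (η / (|C| + 1) * r) :=
    mul_le_mul_of_nonneg_right (le_abs_self C) (by positivity)
  have h4 : |C| * (η / (|C| + 1) * r) < η * r := by
    rw [← mul_assoc]
    refine mul_lt_mul_of_pos_right ?_ hr
    rw [mul_div_assoc', div_lt_iff₀ (by positivity)]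
    nlinarith [abs_nonneg C]
  exact h3.trans_lt h4

section

variable {S : Type*} {Ψ : ℝ → S → ℝ} {p : ℝ} {e : ℕ → S} {u : ℕ → ℝ × ℝ}

/-- Induction along the orbit. A vanishing limit is handled by the growth bound; without that bound
no slope vanishes, and the walk never reaches 0. -/
lemma tendsto_orbit_div
    (hlim : ∀ n (σ : ℝ), (σ = 1 ∨ σ = -1) → 0 < signProb p σ →
      Tendsto (fun x => (σ * x)⁻¹ * Ψ (σ * x) (e n)) atTop (𝓝 (σ * stepFn σ (u n))))
    (hval : ∀ n, ∀ m ∈ validStates p, stepFn m (u n) ∈ validStates p)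
    (hbdd : (∀ n, ∃ C : ℝ, ∀ᶠ x : ℝ in atTop, ∀ y : ℝ, |y| ≤ x → |Ψ y (e n)| ≤ C * x) ∨
      ∀ n (σ : ℝ), (σ = 1 ∨ σ = -1) → 0 < signProb p σ → stepFn σ (u n) ≠ 0)
    {σ : ℝ} (hσ : σ = 1 ∨ σ = -1) (hp : 0 < signProb p σ) (n : ℕ) :
    Tendsto (fun r => orbit Ψ e (σ * r) n / r) atTop (𝓝 (walk u σ n)) := by
  have hσ0 : σ ≠ 0 := by rcases hσ with rfl | rfl <;> norm_num
  have hsσ : Real.sign σ = σ := by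
    rcases hσ with rfl | rfl
    · exact Real.sign_of_pos one_pos
    · exact Real.sign_of_neg (by norm_num)
  have hσv : σ ∈ validStates p := fun _ => by rwa [hsσ]
  induction n with
  | zero =>
    refine tendsto_const_nhds.congr' ?_
    filter_upwards [eventually_ne_atTop 0] with r hr
    simp only [orbit, walk]
    field_simp
  | succ n ih =>
    have hv := walk_mem_validStates hσv hval n
    simp only [orbit, walk]
    by_cases hw : walk u σ n = 0
    · rcases hbdd with hbdd | hne
      · obtain ⟨C, hC⟩ := hbdd n
        rw [hw] at ih ⊢
        have : stepFn 0 (u n) = 0 := by simp [stepFn]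
        rw [this]
        exact tendsto_div_of_zero ih hC
      · exfalso
        have : ∀ k, walk u σ k ≠ 0 := by
          intro k
          induction k with
          | zero => exact hσ0
          | succ k ihk =>
            rw [walk, stepFn_eq_mul_sign ihk]
            have h1 := walk_mem_validStates hσv hval k ihk
            have h2 := hne k _ (sign_eq_or ihk) h1
            have h3 : Real.sign (walk u σ k) ≠ 0 := by
              rcases sign_eq_or ihk with h | h <;> rw [h] <;> norm_num
            exact mul_ne_zero ihk (mul_ne_zero h3 h2)
        exact this n hw
    · exact tendsto_div_of_ne_zero (f := fun y => Ψ y (e n)) hw ih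
        (hlim n _ (sign_eq_or hw) (hv hw))

end

/-! ### Regular variation -/

section

variable {π : Measure ℝ} {α p : ℝ}

/-- The tail of `|ξ|` for `ξ` of law `π`. -/
def absTail (π : Measure ℝ) (u : ℝ) : ℝ := π.real {z | u < |z|}

lemma isRegVar_map {Ω : Type*} [MeasurableSpace Ω] {P : Measure Ω} {ξ : Ω → ℝ}
    (hξ : Measurable ξ) (h : IsRegVar P ξ α p) : IsRegVar (P.map ξ) id α p := by
  have h1 : ∀ u, (P.map ξ).real {z | u < |id z|} = P.real {ω | u < |ξ ω|} := fun u =>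
    map_measureReal_apply hξ (measurableSet_lt measurable_const (by fun_prop))
  have h2 : ∀ u, (P.map ξ).real {z | u < id z} = P.real {ω | u < ξ ω} := fun u =>
    map_measureReal_apply hξ (measurableSet_lt measurable_const (by fun_prop))
  refine ⟨h.index_pos, h.balance_nonneg, h.balance_le_one, ?_, ?_⟩
  · simpa only [h1] using h.tail
  · simpa only [h1, h2] using h.balance

lemma IsRegVar.absTail_pos (h : IsRegVar π id α p) : ∀ᶠ u in atTop, 0 < absTail π u := by
  -- A quotient by zero is 0 by convention, so the limit 1 at y = 1 rules out a tail that vanishes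
  -- for arbitrarily large levels.
  have h1 := h.tail 1 one_pos
  rw [Real.one_rpow] at h1
  filter_upwards [h1.eventually_ne one_ne_zero] with u hu
  refine lt_of_le_of_ne measureReal_nonneg fun h0 => hu ?_
  have : π.real {z | u < |id z|} = 0 := h0.symm
  rw [this, div_zero]

lemma signProb_nonneg (hp0 : 0 ≤ p) (hp1 : p ≤ 1) (σ : ℝ) : 0 ≤ signProb p σ := by
  unfold signProb
  split_ifs <;> linarith

variable [IsProbabilityMeasure π]

lemma IsRegVar.tendsto_sign (h : IsRegVar π id α p) {σ : ℝ} (hσ : σ = 1 ∨ σ = -1) :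
    Tendsto (fun u => π.real {z | u < σ * z} / absTail π u) atTop (𝓝 (signProb p σ)) := by
  rcases hσ with rfl | rfl
  · simpa [signProb_one, absTail] using h.balance
  · rw [signProb_neg_one]
    have h1 := (tendsto_const_nhds (x := (1 : ℝ))).sub h.balance
    refine h1.congr' ?_
    filter_upwards [h.absTail_pos, eventually_ge_atTop 0] with u hu hu0
    have h2 : absTail π u = π.real {z | u < z} + π.real {z | u < -1 * z} := by
      unfold absTail
      rw [← measureReal_union ?_ (measurableSet_lt measurable_const (by fun_prop))]
      · congr 1
        ext z
        simp only [Set.mem_ofPred_eq, Set.mem_union, lt_abs, neg_one_mul]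
      · rw [Set.disjoint_left]
        intro z (hz : u < z) (hz' : u < -1 * z)
        linarith
    have h3 : π.real {z | u < |id z|} = absTail π u := rfl
    rw [h3, one_sub_div hu.ne', h2]
    simp only [id]
    ring_nf

lemma IsRegVar.tendsto_scaled (h : IsRegVar π id α p) {σ : ℝ} (hσ : σ = 1 ∨ σ = -1) {b : ℝ}
    (hb : 0 ≤ b) :
    Tendsto (fun u => π.real {z | u < b * (σ * z)} / absTail π u) atTop
      (𝓝 (signProb p σ * b ^ α)) := by
  rcases hb.eq_or_lt with rfl | hb
  · rw [Real.zero_rpow h.index_pos.ne', mul_zero]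
    refine tendsto_const_nhds.congr' ?_
    filter_upwards [eventually_ge_atTop 0] with u hu
    have : {z : ℝ | u < 0 * (σ * z)} = ∅ := by
      ext z
      simp [hu]
    rw [this, measureReal_empty, zero_div]
  · have hinv : Tendsto (fun u : ℝ => u * b⁻¹) atTop atTop :=
      tendsto_id.atTop_mul_const (inv_pos.2 hb)
    have h1 := ((h.tendsto_sign hσ).comp hinv).mul (h.tail b⁻¹ (inv_pos.2 hb))
    rw [Real.rpow_neg (inv_pos.2 hb).le, Real.inv_rpow hb.le, inv_inv] at h1
    refine h1.congr' ?_
    filter_upwards [hinv.eventually h.absTail_pos] with u hu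
    have h2 : {z : ℝ | u * b⁻¹ < σ * z} = {z | u < b * (σ * z)} := by
      ext z
      simp only [Set.mem_ofPred_eq]
      rw [← div_eq_mul_inv, div_lt_iff₀ hb, mul_comm b]
    have h3 : π.real {z | u * b⁻¹ < |id z|} = absTail π (u * b⁻¹) := rfl
    simp only [Function.comp_apply]
    rw [h2, h3, div_mul_div_cancel₀ hu.ne']
    rfl

lemma IsRegVar.tendsto_band (h : IsRegVar π id α p) {σ : ℝ} (hσ : σ = 1 ∨ σ = -1) {a b : ℝ}
    (ha : 0 ≤ a) (hb : 0 ≤ b) :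
    Tendsto (fun u => π.real {z | u < a * (σ * z) ∧ b * (σ * z) ≤ u} / absTail π u) atTop
      (𝓝 (signProb p σ * (a ^ α - min a b ^ α))) := by
  have h1 := (h.tendsto_scaled hσ ha).sub (h.tendsto_scaled hσ (le_min ha hb))
  rw [← mul_sub] at h1
  refine h1.congr' ?_
  filter_upwards [eventually_ge_atTop 0] with u hu
  rw [← sub_div]
  congr 1
  rw [← measureReal_sdiff]
  · congr 1
    ext z
    simp only [Set.mem_sdiff, Set.mem_ofPred_eq, not_lt]
    refine and_congr_right fun hz => ?_
    have hz0 : 0 < σ * z := by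
      by_contra! hcon
      linarith [mul_nonpos_of_nonneg_of_nonpos ha hcon]
    rw [min_mul_of_nonneg _ _ hz0.le, min_le_iff]
    exact ⟨fun h => h.resolve_left hz.not_ge, Or.inr⟩
  · intro z hz
    simp only [Set.mem_ofPred_eq] at hz ⊢
    have hz0 : 0 < σ * z := by
      by_contra! hcon
      linarith [mul_nonpos_of_nonneg_of_nonpos (le_min ha hb) hcon]
    rw [min_mul_of_nonneg _ _ hz0.le, lt_min_iff] at hz
    exact hz.1
  · exact measurableSet_lt measurable_const (by fun_prop)

/-- On the event, σz exceeds u/a and is therefore large, so W z lies within ε of its limit w. The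
event is squeezed between bands with constant factors w ± ε, and the band limit is continuous in the
factor. -/
lemma IsRegVar.tendsto_event (h : IsRegVar π id α p) {σ : ℝ} (hσ : σ = 1 ∨ σ = -1) {a w : ℝ}
    (ha : 0 ≤ a) {W : ℝ → ℝ} (hW0 : ∀ z, 0 ≤ W z)
    (hW : Tendsto (fun r => W (σ * r)) atTop (𝓝 w)) :
    Tendsto (fun u => π.real {z | u < a * (σ * z) ∧ W z * (σ * z) ≤ u} / absTail π u) atTop
      (𝓝 (signProb p σ * (a ^ α - min a w ^ α))) := by
  have hα := h.index_pos
  have hw : 0 ≤ w := ge_of_tendsto' hW fun r => hW0 _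
  have hσσ : σ * σ = 1 := by rcases hσ with rfl | rfl <;> norm_num
  have hcont : Continuous fun b : ℝ => signProb p σ * (a ^ α - min a (max b 0) ^ α) := by
    have : Continuous fun b : ℝ => min a (max b 0) ^ α :=
      (continuous_const.min (continuous_id.max continuous_const)).rpow_const
        fun _ => Or.inr hα.le
    fun_prop
  have hsq : ∀ ε > 0, ∀ᶠ u in atTop, ∀ z, u < a * (σ * z) →
      0 < σ * z ∧ w - ε < W z ∧ W z < w + ε := by
    intro ε hε
    obtain ⟨R, hR⟩ := eventually_atTop.1 (Metric.tendsto_nhds.1 hW ε hε)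
    filter_upwards [eventually_gt_atTop 0, eventually_gt_atTop (a * R)] with u hu hu' z hz
    have ha' : 0 < a := by
      refine lt_of_le_of_ne ha fun h0 => ?_
      rw [← h0, zero_mul] at hz
      linarith
    have hz0 : 0 < σ * z := by
      by_contra! hcon
      linarith [mul_nonpos_of_nonneg_of_nonpos ha hcon]
    have hzR : R < σ * z := lt_of_mul_lt_mul_left (hu'.trans hz) ha
    have := hR (σ * z) hzR.le
    rw [← mul_assoc, hσσ, one_mul, Real.dist_eq, abs_lt] at this
    exact ⟨hz0, by linarith, by linarith⟩
  have hval : signProb p σ * (a ^ α - min a w ^ α) =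
      signProb p σ * (a ^ α - min a (max w 0) ^ α) := by rw [max_eq_left hw]
  rw [hval, tendsto_order]
  constructor
  · intro c hc
    have h1 : ∀ᶠ ε in 𝓝[>] (0 : ℝ),
        c < signProb p σ * (a ^ α - min a (max (w + ε) 0) ^ α) := by
      have : Tendsto (fun ε : ℝ => signProb p σ * (a ^ α - min a (max (w + ε) 0) ^ α))
          (𝓝[>] 0) (𝓝 (signProb p σ * (a ^ α - min a (max (w + 0) 0) ^ α))) :=
        ((hcont.comp (continuous_const.add continuous_id)).tendsto 0).mono_left nhdsWithin_le_nhds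
      rw [add_zero] at this
      exact this.eventually (lt_mem_nhds hc)
    obtain ⟨ε, hε, hε0⟩ := (h1.and self_mem_nhdsWithin).exists
    have hε0' : 0 < ε := hε0
    rw [max_eq_left (by linarith)] at hε
    have h2 := (h.tendsto_band hσ ha (b := w + ε) (by linarith)).eventually (lt_mem_nhds hε)
    filter_upwards [h2, hsq ε hε0', h.absTail_pos] with u hu hu' hT
    refine hu.trans_le ?_
    gcongr ?_ / _
    refine measureReal_mono fun z hz => ⟨hz.1, ?_⟩
    obtain ⟨hz0, -, hz2⟩ := hu' z hz.1
    exact (mul_le_mul_of_nonneg_right hz2.le hz0.le).trans hz.2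
  · intro c hc
    have h1 : ∀ᶠ ε in 𝓝[>] (0 : ℝ),
        signProb p σ * (a ^ α - min a (max (w - ε) 0) ^ α) < c := by
      have : Tendsto (fun ε : ℝ => signProb p σ * (a ^ α - min a (max (w - ε) 0) ^ α))
          (𝓝[>] 0) (𝓝 (signProb p σ * (a ^ α - min a (max (w - 0) 0) ^ α))) :=
        ((hcont.comp (continuous_const.sub continuous_id)).tendsto 0).mono_left nhdsWithin_le_nhds
      rw [sub_zero] at this
      exact this.eventually (gt_mem_nhds hc)
    obtain ⟨ε, hε, hε0⟩ := (h1.and self_mem_nhdsWithin).exists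
    have hε0' : 0 < ε := hε0
    -- The lower factor w - ε may be negative, while the band limit needs a nonnegative one.
    have h2 := (h.tendsto_band hσ ha (b := max (w - ε) 0) (le_max_right _ _)).eventually
      (gt_mem_nhds hε)
    filter_upwards [h2, hsq ε hε0', h.absTail_pos] with u hu hu' hT
    refine lt_of_le_of_lt ?_ hu
    gcongr ?_ / _
    refine measureReal_mono fun z hz => ⟨hz.1, ?_⟩
    obtain ⟨hz0, hz1, -⟩ := hu' z hz.1
    exact (mul_le_mul_of_nonneg_right (max_le hz1.le (hW0 z)) hz0.le).trans hz.2

end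

end

/-! ### Exceedance limits for the chain, with the innovations frozen -/

section

section

variable {S : Type*} {Ψ : ℝ → S → ℝ} {α p : ℝ}

/-- The maximum of `0` and `y_k z_{k+1} / (σ z)` over `k < n`, for the orbit `z, z_1, z_2, …`. -/
def orbitMax (Ψ : ℝ → S → ℝ) (e : ℕ → S) (σ : ℝ) (n : ℕ) (y : ℕ → ℝ) (z : ℝ) : NNReal :=
  (Finset.range n).sup fun k => (y k * (orbit Ψ e z (k + 1) / (σ * z))).toNNReal

/-- Puts the conditions at all later times into the single inequality of `IsRegVar.tendsto_event`.
Including 0 in the maximum is harmless for positive u. -/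
lemma orbitMax_mul_le_iff {e : ℕ → S} {σ : ℝ} {n : ℕ} {y : ℕ → ℝ} {z u : ℝ} (hu : 0 < u)
    (hz : 0 < σ * z) :
    (orbitMax Ψ e σ n y z : ℝ) * (σ * z) ≤ u ↔
      ∀ k ∈ Finset.range n, y k * orbit Ψ e z (k + 1) ≤ u := by
  rw [← le_div_iff₀ hz]
  have hdiv : 0 ≤ u / (σ * z) := by positivity
  lift u / (σ * z) to NNReal using hdiv with c hc
  rw [NNReal.coe_le_coe, orbitMax, Finset.sup_le_iff]
  refine forall₂_congr fun k _ => ?_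
  rw [Real.toNNReal_le_iff_le_coe, hc, ← mul_div_assoc, div_le_div_iff_of_pos_right hz]

lemma toNNReal_posPow (α x : ℝ) : posPow α x = ENNReal.ofReal ((x.toNNReal : ℝ) ^ α) := by
  rw [posPow, Real.coe_toNNReal']

lemma iSup_posPow_eq (hα : 0 < α) (n : ℕ) (x : ℕ → ℝ) :
    ⨆ k ∈ Finset.range n, posPow α (x k) =
      ENNReal.ofReal ((((Finset.range n).sup fun k => (x k).toNNReal : NNReal) : ℝ) ^ α) := by
  refine le_antisymm (iSup₂_le fun k hk => ?_) ?_
  · rw [toNNReal_posPow]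
    refine ENNReal.ofReal_le_ofReal (Real.rpow_le_rpow NNReal.zero_le_coe ?_ hα.le)
    exact_mod_cast Finset.le_sup (f := fun k => (x k).toNNReal) hk
  · rcases (Finset.range n).eq_empty_or_nonempty with h | h
    · simp [h, Real.zero_rpow hα.ne']
    · obtain ⟨k, hk, hk'⟩ := Finset.exists_mem_eq_sup _ h fun k => (x k).toNNReal
      rw [hk', ← toNNReal_posPow]
      exact le_iSup₂_of_le k hk le_rfl

lemma ofReal_sub_min_rpow (hα : 0 < α) {a w : ℝ} (ha : 0 ≤ a) (hw : 0 ≤ w) :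
    ENNReal.ofReal (a ^ α - min a w ^ α) = ENNReal.ofReal (a ^ α) - ENNReal.ofReal (w ^ α) := by
  rcases le_total a w with h | h
  · rw [min_eq_left h, sub_self, ENNReal.ofReal_zero,
      tsub_eq_zero_of_le (ENNReal.ofReal_le_ofReal (Real.rpow_le_rpow ha h hα.le))]
  · rw [min_eq_right h, ENNReal.ofReal_sub _ (Real.rpow_nonneg hw α)]

lemma tendsto_orbitMax {e : ℕ → S} {σ : ℝ} (hσ : σ = 1 ∨ σ = -1) {n : ℕ} {y wk : ℕ → ℝ}
    (h : ∀ k < n, Tendsto (fun r => orbit Ψ e (σ * r) (k + 1) / r) atTop (𝓝 (wk k))) :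
    Tendsto (fun r => (orbitMax Ψ e σ n y (σ * r) : ℝ)) atTop
      (𝓝 (((Finset.range n).sup fun k => (y k * wk k).toNNReal : NNReal) : ℝ)) := by
  have hσσ : σ * σ = 1 := by rcases hσ with rfl | rfl <;> norm_num
  refine (NNReal.continuous_coe.tendsto _).comp ?_
  unfold orbitMax
  refine Tendsto.finset_sup_nhds_apply (L := NNReal) fun k hk => ?_
  refine (continuous_real_toNNReal.tendsto _).comp ?_
  simp only [← mul_assoc, hσσ, one_mul]
  exact (h k (Finset.mem_range.1 hk)).const_mul (y k)

variable {Ω' : Type*} [MeasurableSpace Ω'] [MeasurableSpace S] {P' : Measure Ω'}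
  {Z : ℕ → Ω' → ℝ} {ε : ℕ → Ω' → S}

lemma IsRecursiveChain.eq_orbit (h : IsRecursiveChain P' Ψ Z ε) (n : ℕ) (ω : Ω') :
    Z n ω = orbit Ψ (fun k => ε k ω) (Z 0 ω) n := by
  induction n with
  | zero => rfl
  | succ n ih => rw [h.recursion, ih, orbit]

lemma measurable_orbit (hΨ : Measurable (Function.uncurry Ψ)) (n : ℕ) :
    Measurable fun q : ℝ × (ℕ → S) => orbit Ψ q.2 q.1 n := by
  induction n with
  | zero => exact measurable_fst
  | succ n ih =>
    exact hΨ.comp (ih.prodMk ((measurable_pi_apply n).comp measurable_snd))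

lemma IsRecursiveChain.measurable (h : IsRecursiveChain P' Ψ Z ε) (n : ℕ) : Measurable (Z n) := by
  have h1 : Z n = fun ω => orbit Ψ (fun k => ε k ω) (Z 0 ω) n := by
    ext ω; exact h.eq_orbit n ω
  rw [h1]
  exact (measurable_orbit h.measurable_map n).comp
    (h.measurable_init.prodMk (measurable_pi_lambda _ h.measurable_innov))

variable [IsProbabilityMeasure P']

lemma IsRecursiveChain.measure_event (h : IsRecursiveChain P' Ψ Z ε) {A : Set (ℝ × (ℕ → S))}
    (hA : MeasurableSet A) :
    P' {ω | (Z 0 ω, fun k => ε k ω) ∈ A} =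
      ∫⁻ ω, (P'.map (Z 0)) {z | (z, fun k => ε k ω) ∈ A} ∂P' := by
  have he : Measurable fun ω k => ε k ω := measurable_pi_lambda _ h.measurable_innov
  have hz := h.measurable_init
  have := Measure.isProbabilityMeasure_map (μ := P') hz.aemeasurable
  have := Measure.isProbabilityMeasure_map (μ := P') he.aemeasurable
  have h1 : P' {ω | (Z 0 ω, fun k => ε k ω) ∈ A} =
      (P'.map fun ω => (Z 0 ω, fun k => ε k ω)) A :=
    (Measure.map_apply (hz.prodMk he) hA).symm
  rw [h1, (indepFun_iff_map_prod_eq_prod_map_map hz.aemeasurable he.aemeasurable).1 h.indep_init,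
    Measure.prod_apply_symm hA, lintegral_map (measurable_measure_prodMk_right hA) he]
  rfl

/-- The innovations are independent of the start, so the probability is an average over frozen
innovations, each with a known limit. Dominated convergence completes the argument. -/
lemma IsRecursiveChain.tendsto_event (h : IsRecursiveChain P' Ψ Z ε)
    (hRV : IsRegVar (P'.map (Z 0)) id α p) {σ : ℝ} (hσ : σ = 1 ∨ σ = -1) {a : ℝ} (ha : 0 ≤ a)
    (n : ℕ) (y : ℕ → ℝ) (wk : ℕ → Ω' → ℝ)
    (hwk : 0 < signProb p σ → ∀ᵐ ω ∂P', ∀ k < n,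
      Tendsto (fun r => orbit Ψ (fun k => ε k ω) (σ * r) (k + 1) / r) atTop (𝓝 (wk k ω))) :
    Tendsto (fun u => ENNReal.ofReal
        (P'.real {ω | u < a * (σ * Z 0 ω) ∧ ∀ k ∈ Finset.range n, y k * Z (k + 1) ω ≤ u} /
          absTail (P'.map (Z 0)) u)) atTop
      (𝓝 (ENNReal.ofReal (signProb p σ) * ∫⁻ ω, (ENNReal.ofReal (a ^ α) -
        ⨆ k ∈ Finset.range n, posPow α (y k * wk k ω)) ∂P')) := by
  have hz := h.measurable_init
  have hα := hRV.index_pos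
  have := Measure.isProbabilityMeasure_map (μ := P') hz.aemeasurable
  set π := P'.map (Z 0) with hπ
  have hq := signProb_nonneg hRV.balance_nonneg hRV.balance_le_one σ
  let A : ℝ → Set (ℝ × (ℕ → S)) := fun u =>
    {q | u < a * (σ * q.1) ∧ ∀ k ∈ Finset.range n, y k * orbit Ψ q.2 q.1 (k + 1) ≤ u}
  have hA : ∀ u, MeasurableSet (A u) := by
    intro u
    have h1 : A u = {q | u < a * (σ * q.1)} ∩
        ⋂ k ∈ Finset.range n, {q | y k * orbit Ψ q.2 q.1 (k + 1) ≤ u} := by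
      ext q
      simp [A]
    rw [h1]
    refine (measurableSet_lt measurable_const (by fun_prop)).inter
      (Finset.measurableSet_biInter _ fun k _ => ?_)
    exact measurableSet_le ((measurable_orbit h.measurable_map (k + 1)).const_mul _)
      measurable_const
  let H : ℝ → Ω' → ℝ≥0∞ := fun u ω =>
    ENNReal.ofReal (π.real {z | (z, fun k => ε k ω) ∈ A u} / absTail π u)
  have hHint : ∀ᶠ u in atTop, ∫⁻ ω, H u ω ∂P' = ENNReal.ofReal
      (P'.real {ω | u < a * (σ * Z 0 ω) ∧ ∀ k ∈ Finset.range n, y k * Z (k + 1) ω ≤ u} /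
        absTail π u) := by
    filter_upwards [hRV.absTail_pos] with u hu
    have h1 : {ω | u < a * (σ * Z 0 ω) ∧ ∀ k ∈ Finset.range n, y k * Z (k + 1) ω ≤ u} =
        {ω | (Z 0 ω, fun k => ε k ω) ∈ A u} := by
      ext ω
      simp only [Set.mem_ofPred_eq, A, h.eq_orbit (_ + 1) ω]
    have h2 : ∀ ω, H u ω = π {z | (z, fun k => ε k ω) ∈ A u} * (ENNReal.ofReal (absTail π u))⁻¹ :=
      fun ω => by
        simp only [H]
        rw [ENNReal.ofReal_div_of_pos hu, ofReal_measureReal, div_eq_mul_inv]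
    have h3 : (ENNReal.ofReal (absTail π u))⁻¹ ≠ ∞ :=
      ENNReal.inv_ne_top.2 (by simpa using hu)
    simp_rw [h2]
    rw [lintegral_mul_const' _ _ h3, h1, ENNReal.ofReal_div_of_pos hu, ofReal_measureReal,
      div_eq_mul_inv, h.measure_event (hA u)]
  refine Tendsto.congr' hHint ?_
  have hbd := hRV.tendsto_scaled hσ ha
  -- Dropping the later conditions leaves a bound free of ω that converges as u grows: it dominates
  -- the integrand.
  have hle : ∀ u ω, H u ω ≤ ENNReal.ofReal (π.real {z | u < a * (σ * z)} / absTail π u) := by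
    intro u ω
    refine ENNReal.ofReal_le_ofReal ?_
    have : 0 ≤ absTail π u := measureReal_nonneg
    gcongr ?_ / _
    exact measureReal_mono fun z hz => hz.1
  -- For a sign of probability zero the orbit may have no limit, but then the dominating bound
  -- itself tends to 0.
  rcases hq.eq_or_lt with hq0 | hqpos
  · rw [← hq0, ENNReal.ofReal_zero, zero_mul]
    rw [← hq0, zero_mul] at hbd
    have hbd' := ENNReal.tendsto_ofReal hbd
    rw [ENNReal.ofReal_zero] at hbd'
    refine tendsto_of_tendsto_of_tendsto_of_le_of_le tendsto_const_nhds hbd'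
      (fun u => zero_le) fun u => ?_
    refine (lintegral_mono (hle u)).trans ?_
    simp
  · rw [← lintegral_const_mul' _ _ ENNReal.ofReal_ne_top]
    refine tendsto_lintegral_filter_of_dominated_convergence
      (fun _ => ENNReal.ofReal (signProb p σ * a ^ α + 1)) ?_ ?_ (by simp) ?_
    · refine Eventually.of_forall fun u => ?_
      have he : Measurable fun ω k => ε k ω := measurable_pi_lambda _ h.measurable_innov
      have h1 : Measurable fun ω => π {z | (z, fun k => ε k ω) ∈ A u} :=
        (measurable_measure_prodMk_right (hA u)).comp he
      exact ((h1.ennreal_toReal).div_const _).ennreal_ofReal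
    · filter_upwards [hbd.eventually (gt_mem_nhds (lt_add_one _))] with u hu
      exact ae_of_all _ fun ω => (hle u ω).trans (ENNReal.ofReal_le_ofReal hu.le)
    · filter_upwards [hwk hqpos] with ω hω
      have h1 := hRV.tendsto_event hσ ha (W := fun z => (orbitMax Ψ (fun k => ε k ω) σ n y z : ℝ))
        (fun z => NNReal.zero_le_coe) (tendsto_orbitMax hσ hω)
      have h2 := ENNReal.tendsto_ofReal h1
      rw [ENNReal.ofReal_mul hq, ofReal_sub_min_rpow hα ha NNReal.zero_le_coe,
        ← iSup_posPow_eq hα] at h2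
      refine h2.congr' ?_
      filter_upwards [eventually_gt_atTop 0] with u hu
      have h3 : {z | u < a * (σ * z) ∧ (orbitMax Ψ (fun k => ε k ω) σ n y z : ℝ) * (σ * z) ≤ u} =
          {z | (z, fun k => ε k ω) ∈ A u} := by
        ext z
        simp only [Set.mem_ofPred_eq, A]
        refine and_congr_right fun hz => ?_
        refine orbitMax_mul_le_iff hu ?_
        by_contra! hcon
        linarith [mul_nonpos_of_nonneg_of_nonpos ha hcon]
      simp only [H, h3]

end

end

section

/-! ### The forward transition law belongs to the class -/

lemma isProbabilityMeasure_forwardLaw {S : Type*} [MeasurableSpace S] {ν : Measure S}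
    [IsProbabilityMeasure ν] {p : ℝ} (hp0 : 0 ≤ p) (hp1 : p ≤ 1) {φ : S → ℝ → ℝ} {m : S → ℝ × ℝ}
    (hm : Measurable m) (h : ∀ᵐ v ∂ν, ∀ σ : ℝ, (σ = 1 ∨ σ = -1) → 0 < signProb p σ →
      stepFn σ (m v) = σ * φ v σ) : IsProbabilityMeasure (forwardLaw ν p φ) := by
  have := isProbabilityMeasure_signLaw hp0 hp1
  constructor
  rw [← lintegral_one, lintegral_forwardLaw hm h (F := fun _ => 1) measurable_const]
  simp

section

variable {Ω' S : Type*} [MeasurableSpace Ω'] [MeasurableSpace S] {P' : Measure Ω'}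
  [IsProbabilityMeasure P'] {Ψ : ℝ → S → ℝ} {Z : ℕ → Ω' → ℝ} {ε : ℕ → Ω' → S} {α p : ℝ}

/-- The events that Z_0 is large on one side or the other while τ Z_1 > u are disjoint and lie in {τ
Z_1 > u}, whose probability is that of {τ Z_0 > u} by invariance. The limit of this inequality is
the moment bound. -/
lemma IsRecursiveChain.measure_sign_le (h : IsRecursiveChain P' Ψ Z ε)
    (hinv : P'.map (Z 1) = P'.map (Z 0)) {a τ u : ℝ} (hu : 0 ≤ u) :
    (P'.map (Z 0)).real {z | u < a * (1 * z)} + (P'.map (Z 0)).real {z | u < a * (-1 * z)} ≤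
      (P'.map (Z 0)).real {z | u < τ * z} +
        P'.real {ω | u < a * (1 * Z 0 ω) ∧ τ * Z 1 ω ≤ u} +
        P'.real {ω | u < a * (-1 * Z 0 ω) ∧ τ * Z 1 ω ≤ u} := by
  have hz0 := h.measurable 0
  have hz1 := h.measurable 1
  have hset : ∀ c : ℝ, MeasurableSet {z : ℝ | u < c * z} := fun c =>
    measurableSet_lt measurable_const (by fun_prop)
  have hset' : ∀ c : ℝ, MeasurableSet {z : ℝ | u < a * (c * z)} := fun c =>
    measurableSet_lt measurable_const (by fun_prop)
  have h1 : (P'.map (Z 0)).real {z | u < τ * z} = P'.real {ω | u < τ * Z 1 ω} := by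
    rw [← hinv, map_measureReal_apply hz1 (hset τ)]
    rfl
  have hE : ∀ c : ℝ, MeasurableSet {ω | u < a * (c * Z 0 ω) ∧ u < τ * Z 1 ω} := fun c =>
    MeasurableSet.inter (s₁ := {ω | u < a * (c * Z 0 ω)}) (s₂ := {ω | u < τ * Z 1 ω})
      (measurableSet_lt measurable_const (by fun_prop))
      (measurableSet_lt measurable_const (by fun_prop))
  have h2 : ∀ c : ℝ, (P'.map (Z 0)).real {z | u < a * (c * z)} ≤
      P'.real {ω | u < a * (c * Z 0 ω) ∧ u < τ * Z 1 ω} +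
        P'.real {ω | u < a * (c * Z 0 ω) ∧ τ * Z 1 ω ≤ u} := by
    intro c
    rw [map_measureReal_apply hz0 (hset' c)]
    refine (measureReal_mono fun ω hω => ?_).trans (measureReal_union_le _ _)
    rcases lt_or_ge u (τ * Z 1 ω) with h' | h'
    · exact Or.inl ⟨hω, h'⟩
    · exact Or.inr ⟨hω, h'⟩
  have h3 : P'.real {ω | u < a * (1 * Z 0 ω) ∧ u < τ * Z 1 ω} +
      P'.real {ω | u < a * (-1 * Z 0 ω) ∧ u < τ * Z 1 ω} ≤ P'.real {ω | u < τ * Z 1 ω} := by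
    rw [← measureReal_union _ (hE (-1))]
    · refine measureReal_mono fun ω hω => ?_
      rcases hω with hω | hω
      · exact hω.2
      · exact hω.2
    · rw [Set.disjoint_left]
      rintro ω ⟨hω, -⟩ ⟨hω', -⟩
      -- The two strict bounds on Z_0 add up to 2u < 0.
      nlinarith
  linarith [h2 1, h2 (-1)]

variable {φ : S → ℝ → ℝ} {m : S → ℝ × ℝ}

lemma IsAsympLinear.tendsto_step {ν : Measure S} [IsProbabilityMeasure ν]
    (hφ : IsAsympLinear ν Ψ p φ) (hmul : ∀ᵐ v ∂ν, ∀ σ : ℝ, (σ = 1 ∨ σ = -1) →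
      0 < signProb p σ → stepFn σ (m v) = σ * φ v σ) :
    ∀ᵐ v ∂ν, ∀ σ : ℝ, (σ = 1 ∨ σ = -1) → 0 < signProb p σ →
      Tendsto (fun x => (σ * x)⁻¹ * Ψ (σ * x) v) atTop (𝓝 (σ * stepFn σ (m v))) := by
  obtain ⟨V, hV, hV1, hlim, -⟩ := hφ
  have hVae : ∀ᵐ v ∂ν, v ∈ V := (prob_compl_eq_zero_iff hV).2 hV1
  filter_upwards [hVae, hmul] with v hv hv' σ hσ hp
  have hσσ : σ * σ = 1 := by rcases hσ with rfl | rfl <;> norm_num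
  rw [hv' σ hσ hp, ← mul_assoc, hσσ, one_mul]
  exact hlim σ hσ hp v hv

/-- Divide `IsRecursiveChain.measure_sign_le` by the tail and let u grow. Truncation at a^α keeps
all terms finite, so the expectations of (A - B)_+ cancel and those of min(A, B) remain; the
truncation is removed later by monotone convergence. -/
lemma IsRecursiveChain.lintegral_min_le (h : IsRecursiveChain P' Ψ Z ε)
    (hinv : P'.map (Z 1) = P'.map (Z 0)) (hRV : IsRegVar (P'.map (Z 0)) id α p)
    (hφ : IsAsympLinear (P'.map (ε 0)) Ψ p φ) (hm : Measurable m)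
    (hmul : ∀ᵐ v ∂P'.map (ε 0), ∀ σ : ℝ, (σ = 1 ∨ σ = -1) → 0 < signProb p σ →
      stepFn σ (m v) = σ * φ v σ) {τ : ℝ} (hτ : τ = 1 ∨ τ = -1) {a : ℝ} (ha : 0 ≤ a) :
    ∫⁻ z, min (ENNReal.ofReal (a ^ α)) (posPow α (τ * z.2)) ∂forwardLaw (P'.map (ε 0)) p φ ≤
      ENNReal.ofReal (signProb p τ) := by
  have hε := h.measurable_innov 0
  have := Measure.isProbabilityMeasure_map (μ := P') hε.aemeasurable
  have := Measure.isProbabilityMeasure_map (μ := P') h.measurable_init.aemeasurable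
  set π := P'.map (Z 0) with hπ
  set A := ENNReal.ofReal (a ^ α) with hA
  have hAtop : A ≠ ∞ := ENNReal.ofReal_ne_top
  have hwm : ∀ σ : ℝ, Measurable fun ω => stepFn σ (m (ε 0 ω)) := fun σ =>
    measurable_stepFn_comp measurable_const (hm.comp hε)
  let B : ℝ → Ω' → ℝ≥0∞ := fun σ ω => posPow α (τ * stepFn σ (m (ε 0 ω)))
  have hBm : ∀ σ, Measurable (B σ) := fun σ => by
    have := hwm σ
    fun_prop
  have hq := signProb_nonneg hRV.balance_nonneg hRV.balance_le_one
  have hC : ∀ σ : ℝ, (σ = 1 ∨ σ = -1) → Tendsto (fun u => ENNReal.ofReal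
      (P'.real {ω | u < a * (σ * Z 0 ω) ∧ τ * Z 1 ω ≤ u} / absTail π u)) atTop
      (𝓝 (ENNReal.ofReal (signProb p σ) * ∫⁻ ω, (A - B σ ω) ∂P')) := by
    intro σ hσ
    have h1 := h.tendsto_event hRV hσ ha 1 (fun _ => τ) (fun _ ω => stepFn σ (m (ε 0 ω))) ?_
    · simpa using h1
    · intro hp
      filter_upwards [ae_of_ae_map hε.aemeasurable (hφ.tendsto_step hmul)] with ω hω k hk
      obtain rfl : k = 0 := by omega
      have h2 := (hω σ hσ hp).const_mul σ
      have hσσ : σ * σ = 1 := by rcases hσ with rfl | rfl <;> norm_num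
      rw [← mul_assoc, hσσ, one_mul] at h2
      refine h2.congr fun r => ?_
      have hσ0 : σ ≠ 0 := by rcases hσ with rfl | rfl <;> norm_num
      simp only [orbit, mul_inv, ← mul_assoc, mul_inv_cancel₀ hσ0, one_mul]
      rw [div_eq_inv_mul]
  have hF : ∀ σ : ℝ, (σ = 1 ∨ σ = -1) → Tendsto (fun u => ENNReal.ofReal
      (π.real {z | u < a * (σ * z)} / absTail π u)) atTop
      (𝓝 (ENNReal.ofReal (signProb p σ) * A)) := by
    intro σ hσ
    rw [hA, ← ENNReal.ofReal_mul (hq σ)]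
    exact ENNReal.tendsto_ofReal (hRV.tendsto_scaled hσ ha)
  have hG := ENNReal.tendsto_ofReal (hRV.tendsto_sign hτ)
  have key := le_of_tendsto_of_tendsto ((hF 1 (Or.inl rfl)).add (hF (-1) (Or.inr rfl)))
    ((hG.add (hC 1 (Or.inl rfl))).add (hC (-1) (Or.inr rfl))) (by
      filter_upwards [eventually_ge_atTop 0] with u hu
      have hT : 0 ≤ absTail π u := measureReal_nonneg
      have hdiv : ∀ {x : ℝ}, 0 ≤ x → 0 ≤ x / absTail π u := fun hx => div_nonneg hx hT
      rw [← ENNReal.ofReal_add (hdiv measureReal_nonneg) (hdiv measureReal_nonneg),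
        ← ENNReal.ofReal_add (hdiv measureReal_nonneg) (hdiv measureReal_nonneg), ← add_div,
        ← add_div, ← ENNReal.ofReal_add (hdiv (by positivity)) (hdiv measureReal_nonneg),
        ← add_div]
      exact ENNReal.ofReal_le_ofReal
        (div_le_div_of_nonneg_right (h.measure_sign_le hinv hu) hT))
  have hsplit : ∀ σ, A = ∫⁻ ω, (A - B σ ω) ∂P' + ∫⁻ ω, min A (B σ ω) ∂P' := by
    intro σ
    have h1 : Measurable fun ω => A - B σ ω := measurable_const.sub (hBm σ)
    rw [← lintegral_add_left h1]
    simp [tsub_add_min]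
  have hfin : ∀ σ, ∫⁻ ω, (A - B σ ω) ∂P' ≠ ∞ := fun σ =>
    ne_top_of_le_ne_top hAtop (le_self_add.trans (hsplit σ).ge)
  have hlhs : ∫⁻ z, min A (posPow α (τ * z.2)) ∂forwardLaw (P'.map (ε 0)) p φ =
      ENNReal.ofReal (signProb p 1) * ∫⁻ ω, min A (B 1 ω) ∂P' +
        ENNReal.ofReal (signProb p (-1)) * ∫⁻ ω, min A (B (-1) ω) ∂P' := by
    have hst : Measurable fun z : ℝ × S => stepFn z.1 (m z.2) :=
      measurable_stepFn_comp measurable_fst (hm.comp measurable_snd)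
    have hst' : ∀ σ : ℝ, Measurable fun v => stepFn σ (m v) := fun σ =>
      measurable_stepFn_comp measurable_const hm
    rw [lintegral_forwardLaw hm hmul (by fun_prop), lintegral_signLaw p
      (Measurable.lintegral_prod_right' (f := fun z : ℝ × S =>
        min A (posPow α (τ * stepFn z.1 (m z.2)))) (by fun_prop)), signProb_one, signProb_neg_one]
    have hst1 := hst' 1
    have hst2 := hst' (-1)
    rw [lintegral_map (by fun_prop) hε, lintegral_map (by fun_prop) hε]
  rw [hlhs]
  set c₁ := ∫⁻ ω, (A - B 1 ω) ∂P' with hc₁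
  set c₂ := ∫⁻ ω, (A - B (-1) ω) ∂P' with hc₂
  set d₁ := ∫⁻ ω, min A (B 1 ω) ∂P' with hd₁
  set d₂ := ∫⁻ ω, min A (B (-1) ω) ∂P' with hd₂
  set q₁ := ENNReal.ofReal (signProb p 1)
  set q₂ := ENNReal.ofReal (signProb p (-1))
  have h1 : A = c₁ + d₁ := hsplit 1
  have h2 : A = c₂ + d₂ := hsplit (-1)
  have h3 : q₁ * A + q₂ * A = (q₁ * d₁ + q₂ * d₂) + (q₁ * c₁ + q₂ * c₂) := by
    nth_rw 1 [h1]
    rw [h2]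
    ring
  rw [h3, add_assoc (ENNReal.ofReal _)] at key
  refine (ENNReal.add_le_add_iff_right ?_).1 key
  exact ENNReal.add_ne_top.2 ⟨ENNReal.mul_ne_top ENNReal.ofReal_ne_top (hfin 1),
    ENNReal.mul_ne_top ENNReal.ofReal_ne_top (hfin (-1))⟩

lemma iSup_min_posPow (hα : 0 < α) (x : ℝ) :
    ⨆ n : ℕ, min (ENNReal.ofReal ((n : ℝ) ^ α)) (posPow α x) = posPow α x := by
  refine le_antisymm (iSup_le fun n => min_le_right _ _) ?_
  obtain ⟨n, hn⟩ := exists_nat_ge (max x 0)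
  refine le_iSup_of_le n (le_min ?_ le_rfl)
  exact ENNReal.ofReal_le_ofReal (Real.rpow_le_rpow (le_max_right _ _) hn hα.le)

lemma IsRecursiveChain.memClass_forwardLaw (h : IsRecursiveChain P' Ψ Z ε)
    (hinv : P'.map (Z 1) = P'.map (Z 0)) (hRV : IsRegVar (P'.map (Z 0)) id α p)
    (hφ : IsAsympLinear (P'.map (ε 0)) Ψ p φ) (hm : Measurable m)
    (hmul : ∀ᵐ v ∂P'.map (ε 0), ∀ σ : ℝ, (σ = 1 ∨ σ = -1) → 0 < signProb p σ →
      stepFn σ (m v) = σ * φ v σ) : MemClass p α (forwardLaw (P'.map (ε 0)) p φ) := by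
  have := Measure.isProbabilityMeasure_map (μ := P') (h.measurable_innov 0).aemeasurable
  have hα := hRV.index_pos
  refine ⟨isProbabilityMeasure_forwardLaw hRV.balance_nonneg hRV.balance_le_one hm hmul, ?_, ?_,
    fun τ hτ => ?_⟩
  · rw [forwardLaw_fst_eq hm hmul (Or.inl rfl), signProb_one]
  · rw [forwardLaw_fst_eq hm hmul (Or.inr rfl), signProb_neg_one]
  · rw [forwardLaw_fst_eq hm hmul hτ]
    rw [lintegral_congr fun z : ℝ × ℝ => (iSup_min_posPow hα (τ * z.2)).symm,
      lintegral_iSup (fun n => by fun_prop)]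
    · exact iSup_le fun n => h.lintegral_min_le hinv hRV hφ hm hmul hτ n.cast_nonneg
    · intro i j hij z
      refine min_le_min_right _ (ENNReal.ofReal_le_ofReal ?_)
      exact Real.rpow_le_rpow i.cast_nonneg (by exact_mod_cast hij) hα.le

end

end

section

/-! ### The tail chain of the recursion -/

section

variable {Ω' S : Type*} [MeasurableSpace Ω'] [MeasurableSpace S] {P' : Measure Ω'}
  {Ψ : ℝ → S → ℝ} {Z : ℕ → Ω' → ℝ} {ε : ℕ → Ω' → S} {α p : ℝ}
  {φ : S → ℝ → ℝ} {m : S → ℝ × ℝ}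

lemma IsRecursiveChain.map_innov (h : IsRecursiveChain P' Ψ Z ε) (n : ℕ) :
    P'.map (ε n) = P'.map (ε 0) := (h.ident_innov n).map_eq

lemma IsRecursiveChain.ae_innov (h : IsRecursiveChain P' Ψ Z ε) {C : S → Prop}
    (hC : ∀ᵐ v ∂P'.map (ε 0), C v) : ∀ᵐ ω ∂P', ∀ n, C (ε n ω) := by
  refine ae_all_iff.2 fun n => ?_
  rw [← h.map_innov n] at hC
  exact ae_of_ae_map (h.measurable_innov n).aemeasurable hC

variable [IsProbabilityMeasure P']

lemma IsRecursiveChain.ae_tendsto_orbit (h : IsRecursiveChain P' Ψ Z ε) (hα : 0 < α)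
    (hp0 : 0 ≤ p) (hp1 : p ≤ 1) (hφ : IsAsympLinear (P'.map (ε 0)) Ψ p φ) (hm : Measurable m)
    (hmul : ∀ᵐ v ∂P'.map (ε 0), ∀ σ : ℝ, (σ = 1 ∨ σ = -1) → 0 < signProb p σ →
      stepFn σ (m v) = σ * φ v σ) (hμ : MemClass p α (forwardLaw (P'.map (ε 0)) p φ)) :
    ∀ᵐ ω ∂P', ∀ σ : ℝ, (σ = 1 ∨ σ = -1) → 0 < signProb p σ → ∀ k,
      Tendsto (fun r => orbit Ψ (fun k => ε k ω) (σ * r) k / r) atTop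
        (𝓝 (walk (fun k => m (ε k ω)) σ k)) := by
  have := Measure.isProbabilityMeasure_map (μ := P') (h.measurable_innov 0).aemeasurable
  have hval := ae_of_ae_map hm.aemeasurable
    ((drives_forwardLaw hm hmul).ae_stepFn_mem hα hp0 hp1 hμ)
  have hlim := hφ.tendsto_step hmul
  -- The growth bound is assumed only if some relevant slope vanishes with positive probability;
  -- otherwise almost surely no relevant slope vanishes.
  have hbdd : (∀ᵐ v ∂P'.map (ε 0), ∃ C : ℝ, ∀ᶠ x : ℝ in atTop, ∀ y : ℝ, |y| ≤ x →
      |Ψ y v| ≤ C * x) ∨ ∀ᵐ v ∂P'.map (ε 0), ∀ σ : ℝ, (σ = 1 ∨ σ = -1) → 0 < signProb p σ →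
        stepFn σ (m v) ≠ 0 := by
    obtain ⟨V, hV, hV1, -, hW⟩ := hφ
    by_cases hex : ∃ σ : ℝ, (σ = 1 ∨ σ = -1) ∧ 0 < signProb p σ ∧
        0 < (P'.map (ε 0)) {v | φ v σ = 0}
    · obtain ⟨W, hWm, -, hW1, hWb⟩ := hW hex
      have hWae : ∀ᵐ v ∂P'.map (ε 0), v ∈ W := (prob_compl_eq_zero_iff hWm).2 hW1
      exact Or.inl (hWae.mono hWb)
    · push Not at hex
      have hne : ∀ σ : ℝ, (σ = 1 ∨ σ = -1) → ∀ᵐ v ∂P'.map (ε 0), 0 < signProb p σ →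
          φ v σ ≠ 0 := by
        intro σ hσ
        by_cases hp : 0 < signProb p σ
        · have h0 : (P'.map (ε 0)) {v | φ v σ = 0} = 0 := le_antisymm (hex σ hσ hp) zero_le
          have : ∀ᵐ v ∂P'.map (ε 0), ¬ φ v σ = 0 := by
            rw [ae_iff]
            simpa using h0
          exact this.mono fun v hv _ => hv
        · exact ae_of_all _ fun v hv => absurd hv hp
      right
      filter_upwards [hne 1 (Or.inl rfl), hne (-1) (Or.inr rfl), hmul] with v h1 h2 h3 σ hσ hp
      rw [h3 σ hσ hp]
      rcases hσ with rfl | rfl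
      · simpa using h1 hp
      · simpa using h2 hp
  have hbdd' : ∀ᵐ ω ∂P', (∀ n, ∃ C : ℝ, ∀ᶠ x : ℝ in atTop, ∀ y : ℝ, |y| ≤ x →
      |Ψ y (ε n ω)| ≤ C * x) ∨ ∀ n (σ : ℝ), (σ = 1 ∨ σ = -1) → 0 < signProb p σ →
        stepFn σ (m (ε n ω)) ≠ 0 := by
    rcases hbdd with hb | hb
    · exact (h.ae_innov hb).mono fun ω => Or.inl
    · exact (h.ae_innov hb).mono fun ω => Or.inr
  filter_upwards [h.ae_innov hlim, h.ae_innov hval, hbdd'] with ω h1 h2 h3 σ hσ hp k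
  exact tendsto_orbit_div (u := fun k => m (ε k ω)) h1 h2 h3 hσ hp k

/-- The forward half uses the innovations of the recursion itself, so its law is the mixture of the
walks from 1 and -1 that appear as limits of orbits. The backward half uses an independent sequence
driving the adjoint law. -/
lemma IsRecursiveChain.exists_isBFTC (h : IsRecursiveChain P' Ψ Z ε) (hα : 0 < α)
    (hp0 : 0 ≤ p) (hp1 : p ≤ 1) (hm : Measurable m)
    (hmul : ∀ᵐ v ∂P'.map (ε 0), ∀ σ : ℝ, (σ = 1 ∨ σ = -1) → 0 < signProb p σ →
      stepFn σ (m v) = σ * φ v σ) (hμ : MemClass p α (forwardLaw (P'.map (ε 0)) p φ)) :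
    ∃ (Q : Measure (ℤ → ℝ)) (_ : IsProbabilityMeasure Q),
      IsBFTC Q p α (forwardLaw (P'.map (ε 0)) p φ) (fun t m => m t) ∧
      ∀ F : (ℕ → ℝ) → ℝ≥0∞, Measurable F → ∫⁻ x, F (fun k => x k) ∂Q =
        ENNReal.ofReal (signProb p 1) * ∫⁻ ω, F (walk (fun k => m (ε k ω)) 1) ∂P' +
        ENNReal.ofReal (signProb p (-1)) * ∫⁻ ω, F (walk (fun k => m (ε k ω)) (-1)) ∂P' := by
  have := Measure.isProbabilityMeasure_map (μ := P') (h.measurable_innov 0).aemeasurable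
  have hadj := isAdjoint_adjointLaw hα hp0 hp1 hμ
  obtain ⟨η, hη⟩ := hadj.mem_right.exists_drives
  have hη1 := hη.isProb
  have hν := drives_forwardLaw hm hmul
  have hν1 := hν.isProb
  have hs := isProbabilityMeasure_signLaw hp0 hp1
  have hUm : ∀ n, Measurable fun ω => m (ε n ω) := fun n => hm.comp (h.measurable_innov n)
  have hU : iIndepFun (fun n ω => m (ε n ω)) P' := h.indep_innov.comp (fun _ => m) fun _ => hm
  have hUν : ∀ n, P'.map (fun ω => m (ε n ω)) = (P'.map (ε 0)).map m := fun n => by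
    rw [← h.map_innov n, Measure.map_map hm (h.measurable_innov n)]
    rfl
  let P₂ : Measure (ℕ → ℝ × ℝ) := Measure.infinitePi fun _ => η
  have hVm : ∀ n, Measurable fun v : ℕ → ℝ × ℝ => v n := measurable_pi_apply
  have hV : iIndepFun (fun n (v : ℕ → ℝ × ℝ) => v n) P₂ :=
    iIndepFun_infinitePi (X := fun _ => id) (P := fun _ : ℕ => η) fun _ => measurable_id
  have hVη : ∀ n, P₂.map (fun v => v n) = η := fun n => Measure.infinitePi_map_eval _ n
  have hleft := isNoise_left (P₂ := P₂) (p := p) hUm hU hUν hVm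
  have hright := isNoise_right (P₂ := P') (p := p) hVm hV hVη hUm
  have hmeas := measurable_pi_lambda _ hleft.measurable_noiseChain
  have hQ := Measure.isProbabilityMeasure_map (μ := (signLaw p).prod (P'.prod P₂))
    hmeas.aemeasurable
  refine ⟨_, hQ, isBFTC_of_isNoise hα hp0 hp1 hadj hν hη hleft hright, fun F hF => ?_⟩
  have hcast : Measurable fun (x : ℤ → ℝ) (k : ℕ) => x k := by fun_prop
  have hFc : Measurable fun x : ℤ → ℝ => F fun k : ℕ => x k := hF.comp hcast
  rw [lintegral_map hFc hmeas]
  have hwalk : Measurable fun q : ℝ × Ω' => walk (fun k => m (ε k q.2)) q.1 :=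
    measurable_pi_lambda _ fun k => (measurable_walk k).comp
      (f := fun q : ℝ × Ω' => (q.1, fun k => m (ε k q.2)))
      (measurable_fst.prodMk (measurable_pi_lambda _ fun k => (hUm k).comp measurable_snd))
  have hFw : Measurable fun q : ℝ × Ω' => F (walk (fun k => m (ε k q.2)) q.1) := hF.comp hwalk
  simp only [noiseChain, twoSidedWalk_natCast]
  have h1 : Measurable fun q : ℝ × Ω' × (ℕ → ℝ × ℝ) =>
      F (walk (fun k => m (ε k q.2.1)) q.1) :=
    hFw.comp (measurable_fst.prodMk (measurable_fst.comp measurable_snd))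
  refine (lintegral_prod_prod h1).trans ?_
  simp only [lintegral_const, measure_univ, mul_one]
  rw [lintegral_signLaw p hFw.lintegral_prod_right', signProb_one, signProb_neg_one]

end

end

section

/-! ### Exceedances of the stationary chain -/

section

variable {Ω' S : Type*} [MeasurableSpace Ω'] [MeasurableSpace S] {P' : Measure Ω'}
  [IsProbabilityMeasure P'] {Ψ : ℝ → S → ℝ} {Z : ℕ → Ω' → ℝ} {ε : ℕ → Ω' → S} {α p : ℝ}
  {m : S → ℝ × ℝ}

/-- Writing y_0 = aσ with a ≥ 0, only paths starting from the sign σ can exceed at time 0; on those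
the integrand of `lastExc_eq_lintegral` is the limit in `IsRecursiveChain.tendsto_event`. -/
lemma IsRecursiveChain.tendsto_lastExc (h : IsRecursiveChain P' Ψ Z ε)
    (hRV : IsRegVar (P'.map (Z 0)) id α p)
    (horb : ∀ᵐ ω ∂P', ∀ σ : ℝ, (σ = 1 ∨ σ = -1) → 0 < signProb p σ → ∀ k,
      Tendsto (fun r => orbit Ψ (fun k => ε k ω) (σ * r) k / r) atTop
        (𝓝 (walk (fun k => m (ε k ω)) σ k)))
    {Q : Measure (ℤ → ℝ)} [IsProbabilityMeasure Q]
    (hQ : ∀ F : (ℕ → ℝ) → ℝ≥0∞, Measurable F → ∫⁻ x, F (fun k => x k) ∂Q =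
      ENNReal.ofReal (signProb p 1) * ∫⁻ ω, F (walk (fun k => m (ε k ω)) 1) ∂P' +
      ENNReal.ofReal (signProb p (-1)) * ∫⁻ ω, F (walk (fun k => m (ε k ω)) (-1)) ∂P')
    (n : ℕ) (y : ℕ → ℝ) :
    Tendsto (fun u => ENNReal.ofReal (P'.real {ω | u < y 0 * Z 0 ω ∧
        ∀ k ∈ Finset.range n, y (k + 1) * Z (k + 1) ω ≤ u} / absTail (P'.map (Z 0)) u)) atTop
      (𝓝 (lastExc Q α (fun t x => x t) n y)) := by
  have hα := hRV.index_pos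
  obtain ⟨σ, a, hσ, ha, hy⟩ : ∃ σ a : ℝ, (σ = 1 ∨ σ = -1) ∧ 0 ≤ a ∧ y 0 = a * σ := by
    rcases le_or_gt 0 (y 0) with h0 | h0
    · exact ⟨1, y 0, Or.inl rfl, h0, by ring⟩
    · exact ⟨-1, -y 0, Or.inr rfl, by linarith, by ring⟩
  have hσσ : σ * σ = 1 := by rcases hσ with rfl | rfl <;> norm_num
  have h1 := h.tendsto_event hRV hσ ha n (fun k => y (k + 1))
    (fun k ω => walk (fun k => m (ε k ω)) σ (k + 1)) (fun hp => by
      filter_upwards [horb] with ω hω k _ using hω σ hσ hp (k + 1))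
  let F : (ℕ → ℝ) → ℝ≥0∞ := fun g =>
    posPow α (y 0 * g 0) - ⨆ k ∈ Finset.range n, posPow α (y (k + 1) * g (k + 1))
  have hF : Measurable F := by
    refine Measurable.sub (by fun_prop) ?_
    exact Measurable.biSup _ (Finset.range n).countable_toSet fun k _ => by fun_prop
  have h2 : lastExc Q α (fun t x => x t) n y = ∫⁻ x, F (fun k => x k) ∂Q := by
    rw [lastExc_eq_lintegral hα (fun t => measurable_pi_apply t)]
    refine lintegral_congr fun x => ?_
    simp only [F, supPow, Nat.cast_zero, Nat.cast_add, Nat.cast_one, add_comm (1 : ℤ)]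
  have hother : ∀ ω, F (walk (fun k => m (ε k ω)) (-σ)) = 0 := by
    intro ω
    simp only [F, walk, hy]
    rw [posPow_of_nonpos hα (by rw [mul_neg, mul_assoc, hσσ, mul_one]; linarith), zero_tsub]
  have hself : ∀ ω, F (walk (fun k => m (ε k ω)) σ) = ENNReal.ofReal (a ^ α) -
      ⨆ k ∈ Finset.range n, posPow α (y (k + 1) * walk (fun k => m (ε k ω)) σ (k + 1)) := by
    intro ω
    simp only [F, hy]
    rw [show walk (fun k => m (ε k ω)) σ 0 = σ from rfl, mul_assoc, hσσ, mul_one, posPow,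
      max_eq_left ha]
  have h3 : lastExc Q α (fun t x => x t) n y = ENNReal.ofReal (signProb p σ) *
      ∫⁻ ω, (ENNReal.ofReal (a ^ α) - ⨆ k ∈ Finset.range n,
        posPow α (y (k + 1) * walk (fun k => m (ε k ω)) σ (k + 1))) ∂P' := by
    rw [h2, hQ F hF]
    simp_rw [← hself]
    rcases hσ with rfl | rfl
    · simp only [hother, lintegral_const, zero_mul, mul_zero, add_zero]
    · rw [neg_neg] at hother
      simp only [hother, lintegral_const, zero_mul, mul_zero, zero_add]
  rw [h3]
  refine h1.congr fun u => ?_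
  simp only [hy, mul_assoc]

end

section

variable {Ω Ω' S : Type*} [MeasurableSpace Ω] [MeasurableSpace Ω'] [MeasurableSpace S]
  {P : Measure Ω} {P' : Measure Ω'} {X : ℤ → Ω → ℝ} {Ψ : ℝ → S → ℝ} {Z : ℕ → Ω' → ℝ}
  {ε : ℕ → Ω' → S}

lemma IsStationaryChain.map_zero (hX : IsStationaryChain P X P' Ψ Z ε) :
    P.map (X 0) = P'.map (Z 0) := by
  have h1 := congrArg (Measure.map fun w : Fin 1 → ℝ => w 0) (hX.law 0 0)
  have h2 : Measurable fun ω (j : Fin (0 + 1)) => X (0 + (j : ℕ)) ω :=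
    measurable_pi_lambda _ fun j => hX.measurable _
  have h3 : Measurable fun ω (j : Fin (0 + 1)) => Z j ω :=
    measurable_pi_lambda _ fun j => hX.chain.measurable _
  rw [Measure.map_map (measurable_pi_apply 0) h2, Measure.map_map (measurable_pi_apply 0) h3] at h1
  exact h1

lemma IsStationaryChain.measure_lastExc (hX : IsStationaryChain P X P' Ψ Z ε) (u : ℝ) (i n : ℕ)
    (y : ℕ → ℝ) :
    P.real {ω | u < y 0 * X i ω ∧ ∀ k ∈ Finset.range n, y (k + 1) * X (i + (k + 1 : ℕ)) ω ≤ u} =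
      P'.real {ω | u < y 0 * Z 0 ω ∧ ∀ k ∈ Finset.range n, y (k + 1) * Z (k + 1) ω ≤ u} := by
  let A : Set (Fin (n + 1) → ℝ) :=
    {w | u < y 0 * w 0} ∩ ⋂ k : Fin n, {w | y (k + 1) * w k.succ ≤ u}
  have hA : MeasurableSet A :=
    (measurableSet_lt measurable_const (by fun_prop)).inter
      (MeasurableSet.iInter fun k => measurableSet_le (by fun_prop) measurable_const)
  have h2 : Measurable fun ω (j : Fin (n + 1)) => X (i + (j : ℕ)) ω :=
    measurable_pi_lambda _ fun j => hX.measurable _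
  have h3 : Measurable fun ω (j : Fin (n + 1)) => Z j ω :=
    measurable_pi_lambda _ fun j => hX.chain.measurable _
  have h4 := congrArg (fun η : Measure (Fin (n + 1) → ℝ) => η.real A) (hX.law i n)
  simp only [map_measureReal_apply h2 hA, map_measureReal_apply h3 hA] at h4
  convert h4 using 2
  · ext ω
    simp [A, Fin.forall_iff]
  · ext ω
    simp [A, Fin.forall_iff]

variable [IsProbabilityMeasure P]

/-- The union is partitioned by the time of the last exceedance, and stationarity moves that time to
0. -/
lemma IsStationaryChain.sum_measure_lastExc (hX : IsStationaryChain P X P' Ψ Z ε) (u : ℝ) (t : ℕ)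
    (x : ℕ → ℝ) :
    P.real {ω | ∃ j ∈ Finset.range (t + 1), u < x j * X j ω} =
      ∑ i ∈ Finset.range (t + 1), P'.real {ω | u < x i * Z 0 ω ∧
        ∀ k ∈ Finset.range (t - i), x (i + (k + 1)) * Z (k + 1) ω ≤ u} := by
  let E : ℕ → Set Ω := fun i =>
    {ω | u < x i * X i ω ∧ ∀ k ∈ Finset.range (t - i), x (i + (k + 1)) * X (i + (k + 1 : ℕ)) ω ≤ u}
  have hE : ∀ i, MeasurableSet (E i) := by
    intro i
    have h1 : E i = {ω | u < x i * X i ω} ∩ ⋂ k ∈ Finset.range (t - i),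
        {ω | x (i + (k + 1)) * X (i + (k + 1 : ℕ)) ω ≤ u} := by
      ext ω
      simp [E]
    rw [h1]
    exact (measurableSet_lt measurable_const ((hX.measurable i).const_mul _)).inter
      (Finset.measurableSet_biInter _ fun k _ =>
        measurableSet_le ((hX.measurable _).const_mul _) measurable_const)
  have hunion : {ω | ∃ j ∈ Finset.range (t + 1), u < x j * X j ω} =
      ⋃ i ∈ Finset.range (t + 1), E i := by
    ext ω
    simp only [Set.mem_ofPred_eq, Set.mem_iUnion, exists_prop]
    constructor
    · rintro ⟨j, hj, hj'⟩
      classical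
      let s := (Finset.range (t + 1)).filter fun j => u < x j * X j ω
      have hs : s.Nonempty := ⟨j, Finset.mem_filter.2 ⟨hj, hj'⟩⟩
      have hmax := Finset.mem_filter.1 (s.max'_mem hs)
      refine ⟨s.max' hs, hmax.1, hmax.2, fun k hk => ?_⟩
      by_contra! hcon
      have hmem : s.max' hs + (k + 1) ∈ s := by
        refine Finset.mem_filter.2 ⟨?_, by exact_mod_cast hcon⟩
        simp only [Finset.mem_range] at hk ⊢
        omega
      have := s.le_max' _ hmem
      omega
    · rintro ⟨i, hi, hi'⟩
      exact ⟨i, hi, hi'.1⟩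
  have hdisj : Set.PairwiseDisjoint (Finset.range (t + 1) : Set ℕ) E := by
    have key : ∀ i j, i < j → j ∈ Finset.range (t + 1) → ∀ ω, ω ∈ E i → ω ∉ E j := by
      intro i j hij hj ω hi hj'
      simp only [Finset.mem_range] at hj
      have h1 := hi.2 (j - i - 1) (by simp only [Finset.mem_range]; omega)
      rw [show (i + (j - i - 1 + 1)) = j by omega,
        show ((i : ℤ) + (j - i - 1 + 1 : ℕ)) = j by omega] at h1
      exact absurd hj'.1 h1.not_gt
    intro i hi j hj hij
    refine Set.disjoint_left.2 fun ω hωi hωj => ?_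
    rcases lt_or_gt_of_ne hij with h' | h'
    · exact key i j h' hj ω hωi hωj
    · exact key j i h' hi ω hωj hωi
  rw [hunion, measureReal_biUnion_finset hdisj fun i _ => hE i]
  exact Finset.sum_congr rfl fun i _ =>
    hX.measure_lastExc u i (t - i) fun k => x (i + k)

end

end

end TailChain

end

/-! ### Assembly of the limit, the two formulas and existence -/

theorem corollaryC {Ω Ω' S : Type*} [MeasurableSpace Ω] [MeasurableSpace Ω'] [MeasurableSpace S]
    (P : Measure Ω) [IsProbabilityMeasure P] (P' : Measure Ω') [IsProbabilityMeasure P']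
    (X : ℤ → Ω → ℝ) (Ψ : ℝ → S → ℝ) (Z : ℕ → Ω' → ℝ) (ε : ℕ → Ω' → S)
    (hX : IsStationaryChain P X P' Ψ Z ε)
    (α p : ℝ) (hRV : IsRegVar P (X 0) α p)
    (φ : S → ℝ → ℝ) (hφ : IsAsympLinear (P'.map (ε 0)) Ψ p φ) :
    (∃ (Q : Measure (ℤ → ℝ)) (_ : IsProbabilityMeasure Q),
      IsBFTC Q p α (forwardLaw (P'.map (ε 0)) p φ) (fun t m => m t)) ∧
    ∀ (t : ℕ) (x : ℕ → ℝ), ∃ l : ℝ,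
      Tendsto (fun u : ℝ =>
          P.real {ω | ∃ j ∈ Finset.range (t + 1), u < x j * X j ω} / P.real {ω | u < |X 0 ω|})
        atTop (𝓝 l) ∧
      ∀ (Ω'' : Type*) [MeasurableSpace Ω''] (Q : Measure Ω'') [IsProbabilityMeasure Q]
        (M : ℤ → Ω'' → ℝ), IsBFTC Q p α (forwardLaw (P'.map (ε 0)) p φ) M →
        ENNReal.ofReal l =
            ∫⁻ ω, (⨆ j ∈ Finset.range (t + 1), posPow α (x j * M j ω)) ∂Q +
            ∑ i ∈ Finset.Icc 1 t, ∫⁻ ω in {ω | M (-1) ω = 0},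
              (⨆ j ∈ Finset.Icc i t, posPow α (x j * M ((j : ℤ) - i) ω)) ∂Q ∧
        ENNReal.ofReal l =
            ∫⁻ ω, (⨆ j ∈ Finset.range (t + 1), posPow α (x j * M ((j : ℤ) - t) ω)) ∂Q +
            ∑ i ∈ Finset.range t, ∫⁻ ω in {ω | M 1 ω = 0},
              (⨆ j ∈ Finset.range (i + 1), posPow α (x j * M ((j : ℤ) - i) ω)) ∂Q := by
  have hα := hRV.index_pos
  have hp0 := hRV.balance_nonneg
  have hp1 := hRV.balance_le_one
  have hZ := hX.chain
  have hRV' : IsRegVar (P'.map (Z 0)) id α p := by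
    rw [← hX.map_zero]
    exact isRegVar_map (hX.measurable 0) hRV
  have hinv : P'.map (Z 1) = P'.map (Z 0) := by
    rw [← hX.invariant]
    exact congrArg P'.map (funext fun ω => hZ.recursion 0 ω)
  have := Measure.isProbabilityMeasure_map (μ := P') (hZ.measurable_innov 0).aemeasurable
  obtain ⟨m, hm, hmul⟩ := exists_multipliers hZ.measurable_map hφ
  have hμ := hZ.memClass_forwardLaw hinv hRV' hφ hm hmul
  obtain ⟨Q, hQp, hQ, hQF⟩ := hZ.exists_isBFTC hα hp0 hp1 hm hmul hμ
  refine ⟨⟨Q, hQp, hQ⟩, fun t x => ?_⟩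
  have horb := hZ.ae_tendsto_orbit hα hp0 hp1 hφ hm hmul hμ
  have hfin : ∀ i, lastExc Q α (fun t m => m t) (t - i) (fun k => x (i + k)) ≠ ∞ := fun i =>
    (hQ.isTwoSided hα).lastExc_ne_top _ _
  -- The limit is expressed through the constructed chain, whose forward half is tied to the
  -- recursion. All masses are finite, so passing to real numbers loses nothing.
  refine ⟨∑ i ∈ Finset.range (t + 1),
    (lastExc Q α (fun t m => m t) (t - i) (fun k => x (i + k))).toReal, ?_, ?_⟩
  · have htail : ∀ u : ℝ, P.real {ω | u < |X 0 ω|} = absTail (P'.map (Z 0)) u := fun u => by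
      rw [← hX.map_zero, absTail, map_measureReal_apply (hX.measurable 0)
        (measurableSet_lt measurable_const (by fun_prop))]
      rfl
    simp only [hX.sum_measure_lastExc, htail, Finset.sum_div]
    refine tendsto_finsetSum _ fun i _ => ?_
    have h1 := hZ.tendsto_lastExc hRV' horb hQF (t - i) fun k => x (i + k)
    refine ((ENNReal.tendsto_toReal (hfin i)).comp h1).congr fun u => ?_
    exact ENNReal.toReal_ofReal (div_nonneg measureReal_nonneg measureReal_nonneg)
  · intro Ω'' _ Q' _ M hM
    have h1 : ENNReal.ofReal (∑ i ∈ Finset.range (t + 1),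
        (lastExc Q α (fun t m => m t) (t - i) (fun k => x (i + k))).toReal) =
        ∑ i ∈ Finset.range (t + 1), lastExc Q' α M (t - i) (fun k => x (i + k)) := by
      rw [ENNReal.ofReal_sum_of_nonneg fun i _ => ENNReal.toReal_nonneg]
      refine Finset.sum_congr rfl fun i _ => ?_
      -- Both chains have the same forward law, which alone determines the last-exceedance masses.
      -- Equality with the real number l also yields finiteness of all expectations.
      rw [ENNReal.ofReal_toReal (hfin i), (hQ.isTwoSided hα).lastExc_eq,
        (hM.isTwoSided hα).lastExc_eq]
    exact ⟨h1.trans (hM.sum_lastExc_eq_forward hα t x),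
      h1.trans (hM.sum_lastExc_eq_backward hα t x)⟩
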